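/- Let $M,N>1$ be integers, let $\varphi=L^{2M}R^{2N}$ with $L=\begin{pmatrix}1&0\\1&1\end{pmatrix}$, $R=\begin{pmatrix}1&1\\0&1\end{pmatrix}$, and put $|\varphi|=2M+2N$. Let $T$ be the monodromy ideal triangulation of the once-punctured torus bundle of $\varphi$: it consists of $|\varphi|$ tetrahedra $t_1,\dots,t_{|\varphi|}$ with vertices labelled $0,1,2,3$, layered cyclically, where with $A=t_k$ and $B=t_{k+1}$ (indices modulo $|\varphi|$) the faces are glued by $A(012)=B(312)$, $A(023)=B(013)$ if $1\le k\le 2M$ (a letter $L$), and by $A(012)=B(013)$, $A(023)=B(123)$ if $2M<k\le|\varphi|$ (a letter $R$). For an oriented ideal triangulation, the gluing equations for shape parameters $z_t\in\mathbb C\setminus\{0,1\}$ of the tetrahedra $t$ require that around every edge the parameters multiply to $1$ and the dihedral angles add up to $2\pi$, and that the holonomy of every closed path in the cusp triangulation has derivative $1$ (completeness). The triangulation is geometric if they have a solution with all $\operatorname{Im} z_t>0$; a tetrahedron with real $z_t$ is called flat. A 2-3 move replaces two distinct tetrahedra sharing a face by three distinct tetrahedra sharing an edge that joins the two opposite vertices;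 a 3-2 move is the inverse. Shapes are followed through a 2-3 move (and backwards through a 3-2 move) by keeping those of all other tetrahedra and letting the parameter of each of the three tetrahedra at the edge opposite to the new edge be the product of the parameters of the two old tetrahedra at that edge. Then there are ideal triangulations $T_1,T_2,T'$ such that $T_1$ arises from $T$ by a 2-3 move on $t_M$ and $t_{M+1}$, $T_2$ arises from $T_1$ by a 2-3 move on $t_{M+2}$ and one of the tetrahedra created by the first move, and $T'$ arises from $T_2$ by a 3-2 move on three tetrahedra created by the first two moves; and such that the following holds. The triangulation $T$ is geometric, and a solution of its gluing equations with all shapes in the upper half-plane can be followed through the three moves to solutions of the gluing equations of $T_1$, $T_2$ and $T'$. In $T_1$ exactly one tetrahedron is flat; it is created by the first move, is still present in $T_2$, where it is again the only flat one, and is one of the three removed by the last move. All other tetrahedra of $T_1$ and $T_2$, and all tetrahedra of $T'$, have shapes with positive imaginary part. In particular $T'$ is geometric. Moreover, $T'$ has $|\varphi|+1$ tetrahedra, and $T'$ is not isomorphic to $T$. -/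

import Mathlib

open Equiv

/-- A finite oriented ideal triangulation: finitely many tetrahedra, each with vertices labelled
by `Fin 4`, and a pairing of all their faces. Face `f` of a tetrahedron is the one opposite to
vertex `f`. Face `f` of `t` is glued to face `glue t f f` of `adj t f`, the vertex `i ≠ f` of `t`
being identified with the vertex `glue t f i` of `adj t f`. No face is glued to itself, and all
gluing permutations are odd, so that the labellings orient the glued-up space. -/
structure IdealTriangulation where
  Tet : Type
  fintypeTet : Fintype Tet
  adj : Tet → Fin 4 → Tet
  glue : Tet → Fin 4 → Perm (Fin 4)
  adj_adj : ∀ t f, adj (adj t f) (glue t f f) = t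
  glue_adj : ∀ t f, glue (adj t f) (glue t f f) = (glue t f)⁻¹
  not_self : ∀ t f, ¬ (adj t f = t ∧ glue t f f = f)
  odd : ∀ t f, Perm.sign (glue t f) = -1

namespace IdealTriangulation

attribute [instance] IdealTriangulation.fintypeTet

/-- A tetrahedron together with an ordering `p₀ p₁ p₂ p₃` of its vertices (`pᵢ = x.2 i`). -/
abbrev Marked (T : IdealTriangulation) : Type := T.Tet × Perm (Fin 4)

/-- Cross the face opposite to the vertex `pᵢ`. The three vertices of that face keep their
positions in the ordering; position `i` is taken by the vertex on the other side. -/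
def cross (T : IdealTriangulation) (x : T.Marked) (i : Fin 4) : T.Marked :=
  (T.adj x.1 (x.2 i), T.glue x.1 (x.2 i) * x.2)

/-- One step around the edge `p₀p₁`: cross the face `p₀p₁p₂`, then exchange the last two vertices
so that the next step leaves the new tetrahedron through its other face at that edge. -/
def rotate (T : IdealTriangulation) (x : T.Marked) : T.Marked :=
  ((T.cross x 3).1, (T.cross x 3).2 * swap 2 3)

/-- Combinatorial isomorphism: a bijection of tetrahedra and relabellings of their vertices
that carry the face pairings to each other. -/
def Isomorphic (T T' : IdealTriangulation) : Prop :=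
  ∃ (e : T.Tet ≃ T'.Tet) (π : T.Tet → Perm (Fin 4)), ∀ t f,
    T'.adj (e t) (π t f) = e (T.adj t f) ∧
      T'.glue (e t) (π t f) * π t = π (T.adj t f) * T.glue t f

end IdealTriangulation

/-- The shape parameter at the edge `ij` of an ideal tetrahedron of shape `w`, i.e. one with
vertices `0, 1, 2, 3` at `∞, 0, 1, w`. Opposite edges have the same parameter. The value at
`i = j` is never used. -/
noncomputable def edgeShape (w : ℂ) (i j : Fin 4) : ℂ :=
  match i, j with
  | 0, 1 | 1, 0 | 2, 3 | 3, 2 => w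
  | 0, 2 | 2, 0 | 1, 3 | 3, 1 => 1 / (1 - w)
  | _, _ => (w - 1) / w

namespace IdealTriangulation

/-- The edge equations: around every edge, the shape parameters multiply to `1` and the dihedral
angles add up to `2π`. The period of `x` under `rotate` is the degree of the edge `p₀p₁`. -/
def EdgeEquations (T : IdealTriangulation) (z : T.Tet → ℂ) : Prop :=
  ∀ x : T.Marked,
    (∏ k ∈ Finset.range (Function.minimalPeriod T.rotate x),
        edgeShape (z (T.rotate^[k] x).1) ((T.rotate^[k] x).2 0) ((T.rotate^[k] x).2 1)) = 1 ∧
      (∑ k ∈ Finset.range (Function.minimalPeriod T.rotate x),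
        (edgeShape (z (T.rotate^[k] x).1)
          ((T.rotate^[k] x).2 0) ((T.rotate^[k] x).2 1)).arg) = 2 * Real.pi

/-- Holonomy along paths in the cusp triangulation. A marked tetrahedron `x` is read as the
oriented side, running from the corner at `p₁` to the corner at `p₂`, of the triangle that cuts
off the ideal vertex `p₀`. `T.Holonomy z x y c` says that some path in the cusp triangulation
leads from the side `x` to the side `y` and that, when the triangles with the shapes `z` are
developed in `ℂ` along that path, the side `y` as a complex number is `c` times the side `x`.
The elementary steps are: turning about a corner inside a triangle, reversing the side, and
passing to the triangle on the other side of it. -/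
inductive Holonomy (T : IdealTriangulation) (z : T.Tet → ℂ) : T.Marked → T.Marked → ℂ → Prop
  | refl (x : T.Marked) : Holonomy T z x x 1
  | turn (x y : T.Marked) (c : ℂ) (h : Holonomy T z x y c) :
      Holonomy T z x (y.1, y.2 * swap 2 3)
        (c * edgeShape (z y.1) (y.2 0) (y.2 1) ^ ((Perm.sign y.2 : ℤˣ) : ℤ))
  | reverse (x y : T.Marked) (c : ℂ) (h : Holonomy T z x y c) :
      Holonomy T z x (y.1, y.2 * swap 1 2) (-c)
  | cross (x y : T.Marked) (c : ℂ) (h : Holonomy T z x y c) :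
      Holonomy T z x (T.cross y 3) c

/-- The completeness equations: the holonomy of every closed path in the cusps is a translation,
i.e. its derivative is `1`. -/
def CompletenessEquations (T : IdealTriangulation) (z : T.Tet → ℂ) : Prop :=
  ∀ (x : T.Marked) (c : ℂ), T.Holonomy z x x c → c = 1

/-- A solution of all gluing equations (for the complete structure) in shapes that are not
degenerate and not negatively oriented. Tetrahedra with real shape, called flat, are allowed. -/
def IsSolution (T : IdealTriangulation) (z : T.Tet → ℂ) : Prop :=
  (∀ t, z t ≠ 0 ∧ z t ≠ 1 ∧ 0 ≤ (z t).im) ∧ T.EdgeEquations z ∧ T.CompletenessEquations z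

/-- A solution of all gluing equations in which every tetrahedron is positively oriented. -/
def IsGeometricSolution (T : IdealTriangulation) (z : T.Tet → ℂ) : Prop :=
  T.IsSolution z ∧ ∀ t, 0 < (z t).im

/-- A geometric triangulation: the gluing equations have a solution in the upper half-plane. -/
def IsGeometric (T : IdealTriangulation) : Prop :=
  ∃ z : T.Tet → ℂ, T.IsGeometricSolution z

end IdealTriangulation

/-- A 2-3 move from `T` to `T'`. Distinct tetrahedra `a`, `b` of `T` share a face; together they
form a bipyramid with equatorial vertices `0, 1, 2` and apexes `N` (in `a`) and `S` (in `b`).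
They are replaced by three distinct tetrahedra `c 0`, `c 1`, `c 2` around the new edge `NS`, where
`c i` has as vertices `N`, `S` and the two equatorial vertices other than `i`.
The vertex labellings are `σ` for `a` (`σ i` is equatorial vertex `i`, `σ 3` is `N`), `τ` for `b`
(`τ i` is equatorial vertex `i`, `τ 3` is `S`) and `ρ i` for `c i` (`ρ i j` is equatorial vertex
`j ≠ i`, `ρ i i` is `S`, `ρ i 3` is `N`). All other tetrahedra are kept, with their labels. -/
structure TwoThreeMove (T T' : IdealTriangulation) where
  a : T.Tet
  b : T.Tet
  ne : a ≠ b
  σ : Perm (Fin 4)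
  τ : Perm (Fin 4)
  cross_a : T.cross (a, σ) 3 = (b, τ)
  c : Fin 3 → T'.Tet
  c_injective : Function.Injective c
  ρ : Fin 3 → Perm (Fin 4)
  sign_ρ : ∀ i, Perm.sign (ρ i) = Perm.sign σ
  keep : {t : T.Tet // t ≠ a ∧ t ≠ b} ≃ {t' : T'.Tet // ∀ i, t' ≠ c i}
  /-- The three new tetrahedra are glued to each other around the edge `NS`. -/
  cross_c : ∀ i j : Fin 3, i ≠ j →
    T'.cross (c i, ρ i) j.castSucc = (c j, ρ j * swap i.castSucc j.castSucc)
  /-- All faces other than the one shared by `a` and `b` are glued in `T'` as they are in `T`.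
  Here `corr x y f` says that the face of `x` opposite to its `f`-th vertex is a face of `T` which
  becomes, with the same ordering of its vertices, the face of `y` opposite to its `f`-th vertex:
  a face of the upper half of the bipyramid, one of the lower half, or a face of a tetrahedron
  that is kept. -/
  cross_corr :
    let corr : T.Marked → T'.Marked → Fin 4 → Prop := fun x y f =>
      (∃ (i : Fin 3) (π : Perm (Fin 4)), π f = i.castSucc ∧
        x = (a, σ * π) ∧ y = (c i, ρ i * π)) ∨
      (∃ (i : Fin 3) (π : Perm (Fin 4)), π f = i.castSucc ∧
        x = (b, τ * π) ∧ y = (c i, ρ i * swap i.castSucc 3 * π)) ∨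
      (∃ (t : {t : T.Tet // t ≠ a ∧ t ≠ b}) (π : Perm (Fin 4)),
        x = (t.1, π) ∧ y = ((keep t).1, π))
    ∀ x y f, corr x y f → corr (T.cross x f) (T'.cross y f) f

/-- A 3-2 move is the inverse of a 2-3 move: it removes the tetrahedra `c 0`, `c 1`, `c 2` around
an edge of degree three and creates the tetrahedra `a`, `b`. -/
abbrev ThreeTwoMove (T T' : IdealTriangulation) : Type := TwoThreeMove T' T

/-- The shapes before and after a move belong to each other: tetrahedra that are kept keep their
shapes, and at each equatorial edge of the bipyramid the parameter of the one tetrahedron `c i`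
there is the product of those of `a` and `b`. (That edge of `c i` is opposite to `NS`, and in `a`
and `b` it is opposite to the edge from the apex to the equatorial vertex `i`; opposite edges have
equal parameters.) -/
def TwoThreeMove.Tracks {T T' : IdealTriangulation} (m : TwoThreeMove T T')
    (z : T.Tet → ℂ) (z' : T'.Tet → ℂ) : Prop :=
  (∀ t, z' (m.keep t).1 = z t.1) ∧
    ∀ i : Fin 3, edgeShape (z' (m.c i)) (m.ρ i 3) (m.ρ i i.castSucc) =
      edgeShape (z m.a) (m.σ 3) (m.σ i.castSucc) * edgeShape (z m.b) (m.τ 3) (m.τ i.castSucc)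

/-- The letters of a cyclic word. -/
inductive Letter
  | L
  | R

/-- The gluing permutation for face `012` of a tetrahedron `A` below a letter, to the next
tetrahedron `B`: `A(012) = B(312)` for `L` and `A(012) = B(013)` for `R`. -/
def Letter.perm012 : Letter → Perm (Fin 4)
  | .L => swap 0 3
  | .R => swap 2 3

/-- The same for face `023` of `A`: `A(023) = B(013)` for `L` and `A(023) = B(123)` for `R`. -/
def Letter.perm023 : Letter → Perm (Fin 4)
  | .L => swap 1 2
  | .R => swap 0 1

/-- The monodromy ideal triangulation of the once-punctured torus bundle of a cyclic word `w` of
size `n`: `n` tetrahedra are layered cyclically, and tetrahedron `k` is glued to the next one,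
`k + 1` modulo `n`, along its faces `012` and `023` according to the letter `w k`. -/
def monodromyTriangulation {n : ℕ} (w : Fin n → Letter) : IdealTriangulation where
  Tet := Fin n
  fintypeTet := inferInstance
  adj k f := match f with
    | 3 | 1 => finRotate n k
    | 2 | 0 => (finRotate n).symm k
  glue k f := match f with
    | 3 => (w k).perm012
    | 1 => (w k).perm023
    | 0 => match w ((finRotate n).symm k) with
      | .L => Letter.perm012 .L
      | .R => Letter.perm023 .R
    | 2 => match w ((finRotate n).symm k) with
      | .L => Letter.perm023 .L
      | .R => Letter.perm012 .R
  adj_adj := by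
    intro k f
    generalize finRotate n = r
    fin_cases f
    · cases h : w (r.symm k) <;> simp [Letter.perm012, Letter.perm023]
    · cases h : w k <;> simp [Letter.perm023]
    · cases h : w (r.symm k) <;> simp [Letter.perm012, Letter.perm023]
    · cases h : w k <;> simp [Letter.perm012]
  glue_adj := by
    intro k f
    generalize finRotate n = r
    fin_cases f
    · cases h : w (r.symm k) <;> simp [Letter.perm012, Letter.perm023]
    · cases h : w k <;> simp [Letter.perm023, h]
    · cases h : w (r.symm k) <;> simp [Letter.perm012, Letter.perm023]
    · cases h : w k <;> simp [Letter.perm012, h]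
  not_self := by
    intro k f
    generalize finRotate n = r
    fin_cases f
    · cases h : w (r.symm k) <;> simp [Letter.perm012, Letter.perm023]
    · cases h : w k <;> simp [Letter.perm023]
    · cases h : w (r.symm k) <;> simp [Letter.perm012, Letter.perm023]
    · cases h : w k <;> simp [Letter.perm012]
  odd := by
    intro k f
    generalize finRotate n = r
    fin_cases f
    · cases h : w (r.symm k) <;> simp [Letter.perm012, Letter.perm023]
    · cases h : w k <;> simp [Letter.perm023]
    · cases h : w (r.symm k) <;> simp [Letter.perm012, Letter.perm023]
    · cases h : w k <;> simp [Letter.perm012]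

/-- The cyclic word `L ^ p R ^ q`. -/
def wordLR (p q : ℕ) : Fin (p + q) → Letter :=
  fun k => if k.val < p then .L else .R

/-! Nonzero complex weights on the edges (lambda lengths) solve most of the gluing equations at
once. If the weights of every tetrahedron satisfy the Ptolemy relation and its shape is their
cross-ratio, then the cusp triangles with sides ± w12 / (w01 w20) fit together along all faces
(`weightSide_turn`, `EdgeWeights.cuspSides`). A consistent system of sides gives completeness, and
going once around an edge gives product 1 (`CuspSides.prod_edgeShape`). The angle sums then follow
by counting: each is a positive multiple of 2π, there are at least as many edges as tetrahedra, and
the angles of a tetrahedron add up to 2π in total, so no multiple can exceed one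
(`edgeEquations_of_cuspSides`).

In a layered triangulation the Ptolemy relation is the exchange relation D E = A² + B². Along a fan
one of A, B is constant, and the remaining weights satisfy a quadratic recursion solved by 2i cot α
cos((k - M)α) with constant weight 2 cos α (`fanTrace_mul`). Fitting the two fans together gives
equations for two angles α, β, collected in `FanAngles`. With α = (π/2 + ie)/M and β the conjugate
of (π/2 + ie')/N they become sinh e = cos β tan α and its mirror image. These are solved by Banach's
theorem for a damped iteration clamped to a rectangle, where the signs of the equations on the
boundary show that the clamping does no harm (`exists_fanEq_eq_zero`). Positivity of the layers
comes from a monotonicity argument along the fan (`AngleBounds.im_cos_div_sin_sq_neg`).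

The weights of the first fan are symmetric about its middle layer. With v = sin² α the three middle
shapes are 2 - 1/v, 1 - 1/v, 2 - 1/v, and all shapes created by the moves are rational in v. The
symmetry makes one tetrahedron of the first move have shape exactly 2, hence flat. The other new
shapes are Möbius images of v with positive determinant, except one, which is positive because |cos²
α| > 1/2 (`im_ratio_pos`).

The moves themselves are finite: they are checked by `decide` on patches of three to five tetrahedra
with four free faces, and `Site.graft` and `PatchMove.toMove` carry them over to arbitrary M and N.
Counting tetrahedra excludes an isomorphism. -/

/-! ### Orbit sums -/

/-- If the sum of a nonnegative function over every orbit of a self-map is at least `c`,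
and its total sum is at most `c` times the number of values of an invariant function,
then all orbit sums are equal to `c`. -/
theorem orbit_sum_eq_of_sum_le {α ι : Type*} [Fintype α] [Fintype ι] {f : α → α} {g : α → ℝ} (hg : ∀ x, 0 ≤ g x) {lab : α → ι}
    (hlab : ∀ x, lab (f x) = lab x) (hsurj : Function.Surjective lab) {c : ℝ}
    (hc : ∀ x, c ≤ ∑ k ∈ Finset.range (Function.minimalPeriod f x), g (f^[k] x))
    (htot : ∑ x, g x ≤ c * Fintype.card ι) (x₀ : α) :
    ∑ k ∈ Finset.range (Function.minimalPeriod f x₀), g (f^[k] x₀) = c := by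
  classical
  -- One representative per label is chosen, with the given point representing its own label.
  obtain ⟨rep, hrep, hx₀⟩ : ∃ rep : ι → α, (∀ i, lab (rep i) = i) ∧ rep (lab x₀) = x₀ := by
    refine ⟨Function.update (Function.surjInv hsurj) (lab x₀) x₀, fun i => ?_, by simp⟩
    by_cases h : i = lab x₀
    · subst h; simp
    · rw [Function.update_of_ne h]
      exact Function.surjInv_eq hsurj i
  have hit : ∀ x k, lab (f^[k] x) = lab x := by
    intro x k
    induction k with
    | zero => rfl
    | succ k ih => rw [Function.iterate_succ_apply', hlab, ih]
  have hsum : ∑ i, ∑ k ∈ Finset.range (Function.minimalPeriod f (rep i)), g (f^[k] (rep i)) ≤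
      ∑ x, g x := by
    -- Orbits of different representatives are disjoint because the label is invariant, and within
    -- one period an orbit does not repeat. So these points are distinct, and the other points
    -- contribute nonnegative terms.
    rw [Finset.sum_sigma', ← Finset.sum_image (f := g)
      (g := fun p : (_ : ι) × ℕ => f^[p.2] (rep p.1))]
    · exact Finset.sum_le_sum_of_subset_of_nonneg (Finset.subset_univ _) fun _ _ _ => hg _
    · rintro ⟨i, k⟩ hk ⟨j, l⟩ hl h
      simp only [Finset.coe_sigma, Set.mem_sigma_iff, Finset.coe_univ, Set.mem_univ, true_and,
        Finset.coe_range] at hk hl h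
      have hij : i = j := by
        have := congrArg lab h
        rwa [hit, hit, hrep, hrep] at this
      subst hij
      have := Function.iterate_injOn_Iio_minimalPeriod hk hl h
      rw [this]
  have key : (∑ i, ∑ k ∈ Finset.range (Function.minimalPeriod f (rep i)), g (f^[k] (rep i))) =
      ∑ k ∈ Finset.range (Function.minimalPeriod f x₀), g (f^[k] x₀) +
      ∑ i ∈ Finset.univ.erase (lab x₀),
        ∑ k ∈ Finset.range (Function.minimalPeriod f (rep i)), g (f^[k] (rep i)) := by
    rw [← Finset.add_sum_erase _ _ (Finset.mem_univ (lab x₀)), hx₀]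
  have hrest : c * (Fintype.card ι - 1) ≤ ∑ i ∈ Finset.univ.erase (lab x₀),
        ∑ k ∈ Finset.range (Function.minimalPeriod f (rep i)), g (f^[k] (rep i)) := by
    have := Finset.card_nsmul_le_sum (Finset.univ.erase (lab x₀))
      (fun i => ∑ k ∈ Finset.range (Function.minimalPeriod f (rep i)), g (f^[k] (rep i))) c
      (fun i _ => hc _)
    rw [Finset.card_erase_of_mem (Finset.mem_univ _), Finset.card_univ, nsmul_eq_mul,
      Nat.cast_pred (Fintype.card_pos_iff.2 ⟨lab x₀⟩)] at this
    linarith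
  have := hc x₀
  linarith

/-! ### Angles of a tetrahedron -/

theorem im_one_div_one_sub {w : ℂ} : (1 / (1 - w)).im = w.im / Complex.normSq (1 - w) := by
  simp [Complex.inv_im]

theorem im_sub_one_div {w : ℂ} (h0 : w ≠ 0) : ((w - 1) / w).im = w.im / Complex.normSq w := by
  rw [sub_div, div_self h0]
  simp [Complex.inv_im, neg_div]

theorem edgeShape_im_nonneg {w : ℂ} (h0 : w ≠ 0) (hw : 0 ≤ w.im) (i j : Fin 4) :
    0 ≤ (edgeShape w i j).im := by
  unfold edgeShape
  split
  all_goals first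
    | assumption
    | (rw [im_one_div_one_sub]; exact div_nonneg hw (Complex.normSq_nonneg _))
    | (rw [im_sub_one_div h0]; exact div_nonneg hw (Complex.normSq_nonneg _))

theorem edgeShape_im_pos {w : ℂ} (hw : 0 < w.im) (i j : Fin 4) :
    0 < (edgeShape w i j).im := by
  have h0 : w ≠ 0 := by rintro rfl; simp at hw
  have h1 : 1 - w ≠ 0 := by
    intro h
    rw [← sub_eq_zero.1 h] at hw; simp at hw
  unfold edgeShape
  split
  all_goals first
    | assumption
    | (rw [im_one_div_one_sub]; exact div_pos hw (Complex.normSq_pos.2 h1))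
    | (rw [im_sub_one_div h0]; exact div_pos hw (Complex.normSq_pos.2 h0))

theorem arg_pos_of_im_pos {w : ℂ} (hw : 0 < w.im) : 0 < w.arg := by
  refine lt_of_le_of_ne (Complex.arg_nonneg_iff.2 hw.le) fun h => ?_
  have := Complex.arg_eq_zero_iff.1 h.symm
  linarith [this.2]

theorem exp_sum_arg_mul_I {ι : Type*} (s : Finset ι) (w : ι → ℂ) (h : ∏ k ∈ s, w k = 1) :
    Complex.exp ((∑ k ∈ s, (w k).arg : ℝ) * Complex.I) = 1 := by
  have h1 : ∏ k ∈ s, w k = (∏ k ∈ s, ‖w k‖ : ℝ) *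
      Complex.exp ((∑ k ∈ s, (w k).arg : ℝ) * Complex.I) := by
    push_cast
    rw [Finset.sum_mul, Complex.exp_sum, ← Finset.prod_mul_distrib]
    exact Finset.prod_congr rfl fun k _ => (Complex.norm_mul_exp_arg_mul_I _).symm
  have h2 : ∏ k ∈ s, ‖w k‖ = 1 := by rw [← norm_prod, h, norm_one]
  rw [h, h2] at h1
  simpa using h1.symm

theorem exists_sum_arg_eq {ι : Type*} (s : Finset ι) (w : ι → ℂ) (h : ∏ k ∈ s, w k = 1) :
    ∃ n : ℤ, ∑ k ∈ s, (w k).arg = n * (2 * Real.pi) := by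
  obtain ⟨n, hn⟩ := Complex.exp_eq_one_iff.1 (exp_sum_arg_mul_I s w h)
  refine ⟨n, ?_⟩
  have h1 : ((∑ k ∈ s, (w k).arg : ℝ) : ℂ) * Complex.I =
      ((n * (2 * Real.pi) : ℝ) : ℂ) * Complex.I := by
    rw [hn]; push_cast; ring
  exact_mod_cast mul_right_cancel₀ Complex.I_ne_zero h1

/-- The three parameters multiply to -1, so appending -1 (of argument π) gives product 1, and the
angle sum plus π is a multiple 2πn. Since all arguments lie in [0, π], only n = 1 remains once all
three being π is excluded; flat tetrahedra are covered too. -/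
theorem arg_add_arg_add_arg {w : ℂ} (h0 : w ≠ 0) (h1 : w ≠ 1) (hw : 0 ≤ w.im) :
    w.arg + (1 / (1 - w)).arg + ((w - 1) / w).arg = Real.pi := by
  have h2 : w - 1 ≠ 0 := sub_ne_zero.2 h1
  have h3 : 1 - w ≠ 0 := sub_ne_zero.2 h1.symm
  obtain ⟨n, hn⟩ := exists_sum_arg_eq Finset.univ ![w, 1 / (1 - w), (w - 1) / w, -1]
    (by simp [Fin.prod_univ_four]; field_simp; ring)
  simp only [Fin.sum_univ_four, Matrix.cons_val_zero, Matrix.cons_val_one, Matrix.cons_val,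
    Complex.arg_neg_one] at hn
  have hA : 0 ≤ (1 / (1 - w)).im := edgeShape_im_nonneg h0 hw 0 2
  have hB : 0 ≤ ((w - 1) / w).im := edgeShape_im_nonneg h0 hw 0 3
  have a0 := Complex.arg_nonneg_iff.2 hw
  have a1 := Complex.arg_nonneg_iff.2 hA
  have a2 := Complex.arg_nonneg_iff.2 hB
  have b0 := Complex.arg_le_pi w
  have b1 := Complex.arg_le_pi (1 / (1 - w))
  have b2 := Complex.arg_le_pi ((w - 1) / w)
  have hpi := Real.pi_pos
  -- If w is negative, then 1 - w is positive, so the first two arguments cannot both be π.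
  have hlt : w.arg < Real.pi ∨ (1 / (1 - w)).arg < Real.pi := by
    by_contra! h
    have c0 := Complex.arg_eq_pi_iff.1 (le_antisymm b0 h.1)
    have c1 := Complex.arg_eq_pi_iff.1 (le_antisymm b1 h.2)
    have hre : (1 / (1 - w)).re = (1 - w.re) / Complex.normSq (1 - w) := by
      simp [Complex.inv_re]
    rw [hre] at c1
    have : 0 ≤ (1 - w.re) / Complex.normSq (1 - w) :=
      div_nonneg (by linarith [c0.1]) (Complex.normSq_nonneg _)
    linarith [c1.1]
  have n1 : (n : ℝ) = 1 := by
    have hl : (0 : ℝ) < n := by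
      by_contra! h
      nlinarith
    have hu : (n : ℝ) < 2 := by
      by_contra! h
      rcases hlt with h' | h' <;> nlinarith
    have : n = 1 := by
      have : 0 < n := by exact_mod_cast hl
      have : n < 2 := by exact_mod_cast hu
      omega
    rw [this]; norm_num
  rw [n1] at hn
  linarith

theorem arg_edgeShape_sum_vertex {w : ℂ} (h0 : w ≠ 0) (h1 : w ≠ 1) (hw : 0 ≤ w.im)
    (p : Perm (Fin 4)) :
    (edgeShape w (p 0) (p 1)).arg + (edgeShape w (p 0) (p 2)).arg +
      (edgeShape w (p 0) (p 3)).arg = Real.pi := by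
  have k1 := arg_add_arg_add_arg h0 h1 hw
  have k2 : w.arg + ((w - 1) / w).arg + (1 / (1 - w)).arg = Real.pi := by linarith
  have k3 : (1 / (1 - w)).arg + w.arg + ((w - 1) / w).arg = Real.pi := by linarith
  have k4 : (1 / (1 - w)).arg + ((w - 1) / w).arg + w.arg = Real.pi := by linarith
  have k5 : ((w - 1) / w).arg + w.arg + (1 / (1 - w)).arg = Real.pi := by linarith
  have k6 : ((w - 1) / w).arg + (1 / (1 - w)).arg + w.arg = Real.pi := by linarith
  have h01 : p 0 ≠ p 1 := by simp
  have h02 : p 0 ≠ p 2 := by simp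
  have h03 : p 0 ≠ p 3 := by simp
  have h12 : p 1 ≠ p 2 := by simp
  have h13 : p 1 ≠ p 3 := by simp
  have h23 : p 2 ≠ p 3 := by simp
  generalize p 0 = i at *
  generalize p 1 = j at *
  generalize p 2 = k at *
  generalize p 3 = l at *
  fin_cases i <;> fin_cases j <;> first | (exfalso; exact h01 rfl) | skip
  all_goals fin_cases k <;> first | (exfalso; exact h02 rfl) | (exfalso; exact h12 rfl) | skip
  all_goals
    fin_cases l <;> first
      | (exfalso; exact h03 rfl) | (exfalso; exact h13 rfl) | (exfalso; exact h23 rfl)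
      | exact k1 | exact k2 | exact k3 | exact k4 | exact k5 | exact k6

/-- By symmetry the three edges at the first vertex contribute equally over all 24 orderings, and at
each vertex they add up to π; this leaves a third of 24π. -/
theorem sum_arg_edgeShape {w : ℂ} (h0 : w ≠ 0) (h1 : w ≠ 1) (hw : 0 ≤ w.im) :
    ∑ p : Perm (Fin 4), (edgeShape w (p 0) (p 1)).arg = 8 * Real.pi := by
  have e2 : ∑ p : Perm (Fin 4), (edgeShape w (p 0) (p 2)).arg =
      ∑ p : Perm (Fin 4), (edgeShape w (p 0) (p 1)).arg :=
    Fintype.sum_equiv (Equiv.mulRight (swap 1 2)) _ _ fun p => by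
      have : swap (1 : Fin 4) 2 0 = 0 := by decide
      simp [this]
  have e3 : ∑ p : Perm (Fin 4), (edgeShape w (p 0) (p 3)).arg =
      ∑ p : Perm (Fin 4), (edgeShape w (p 0) (p 1)).arg :=
    Fintype.sum_equiv (Equiv.mulRight (swap 1 3)) _ _ fun p => by
      have : swap (1 : Fin 4) 3 0 = 0 := by decide
      simp [this]
  have h := Finset.sum_congr rfl
    fun (p : Perm (Fin 4)) (_ : p ∈ Finset.univ) => arg_edgeShape_sum_vertex h0 h1 hw p
  rw [Finset.sum_add_distrib, Finset.sum_add_distrib, e2, e3, Finset.sum_const, Finset.card_univ,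
    Fintype.card_perm, Fintype.card_fin] at h
  have : ((Nat.factorial 4 : ℕ) : ℝ) = 24 := by norm_num [Nat.factorial]
  rw [nsmul_eq_mul, this] at h
  linarith

/-! ### From cusp cross-sections to the edge equations. -/

namespace IdealTriangulation

theorem cross_cross (T : IdealTriangulation) (x : T.Marked) (i : Fin 4) :
    T.cross (T.cross x i) i = x := by
  obtain ⟨t, p⟩ := x
  simp only [cross, Perm.mul_apply, T.adj_adj, T.glue_adj, inv_mul_cancel_left]

theorem rotate_injective (T : IdealTriangulation) : Function.Injective T.rotate := by
  intro x y h
  have h' : T.cross x 3 = T.cross y 3 := by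
    have h1 := congrArg Prod.fst h
    have h2 := congrArg Prod.snd h
    exact Prod.ext h1 (mul_right_cancel h2)
  rw [← T.cross_cross x 3, h', T.cross_cross]

theorem sign_cross (T : IdealTriangulation) (x : T.Marked) (i : Fin 4) :
    Perm.sign (T.cross x i).2 = - Perm.sign x.2 := by
  simp [cross, T.odd]

theorem sign_rotate (T : IdealTriangulation) (x : T.Marked) :
    Perm.sign (T.rotate x).2 = Perm.sign x.2 := by
  have : Perm.sign (swap (2 : Fin 4) 3) = -1 := Perm.sign_swap (by decide)
  rw [rotate, Perm.sign_mul, sign_cross, this]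
  simp

theorem rotate_snd_zero (T : IdealTriangulation) (x : T.Marked) :
    (T.rotate x).2 0 = T.glue x.1 (x.2 3) (x.2 0) := by
  have : swap (2 : Fin 4) 3 0 = 0 := by decide
  simp [rotate, cross, this]

theorem rotate_snd_one (T : IdealTriangulation) (x : T.Marked) :
    (T.rotate x).2 1 = T.glue x.1 (x.2 3) (x.2 1) := by
  have : swap (2 : Fin 4) 3 1 = 1 := by decide
  simp [rotate, cross, this]

/-- A consistent choice of lengths, as complex numbers, of the sides of the cusp triangles: a
developing map up to translations. -/
structure CuspSides (T : IdealTriangulation) (z : T.Tet → ℂ) where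
  side : T.Marked → ℂ
  ne_zero : ∀ x, side x ≠ 0
  turn : ∀ x, side (x.1, x.2 * swap 2 3) =
    side x * edgeShape (z x.1) (x.2 0) (x.2 1) ^ ((Perm.sign x.2 : ℤˣ) : ℤ)
  reverse : ∀ x, side (x.1, x.2 * swap 1 2) = - side x
  cross : ∀ x, side (T.cross x 3) = side x

theorem CuspSides.side_eq {T : IdealTriangulation} {z : T.Tet → ℂ} (S : CuspSides T z)
    {x y : T.Marked} {c : ℂ} (h : T.Holonomy z x y c) : S.side y = c * S.side x := by
  induction h with
  | refl => simp
  | turn y c _ ih => rw [S.turn, ih]; ring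
  | reverse y c _ ih => rw [S.reverse, ih]; ring
  | cross y c _ ih => rw [S.cross, ih]

theorem CuspSides.completenessEquations {T : IdealTriangulation} {z : T.Tet → ℂ}
    (S : CuspSides T z) : T.CompletenessEquations z := fun x _ h =>
  (mul_right_cancel₀ (S.ne_zero x) ((one_mul _).trans (S.side_eq h))).symm

/-- The exponent is negated because crossing a face reverses the sign of the ordering before the
turn takes place. -/
theorem CuspSides.side_rotate {T : IdealTriangulation} {z : T.Tet → ℂ} (S : CuspSides T z)
    (x : T.Marked) : S.side (T.rotate x) = S.side x *
      edgeShape (z (T.rotate x).1) ((T.rotate x).2 0) ((T.rotate x).2 1) ^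
        (-((Perm.sign x.2 : ℤˣ) : ℤ)) := by
  have h := S.turn (T.cross x 3)
  rw [S.cross, sign_cross] at h
  have h0 : (T.rotate x).2 0 = (T.cross x 3).2 0 := by rw [rotate_snd_zero]; rfl
  have h1 : (T.rotate x).2 1 = (T.cross x 3).2 1 := by rw [rotate_snd_one]; rfl
  rw [h0, h1]
  simp only [Units.val_neg] at h
  exact h

/-- A full turn about an edge returns to the initial side, whose nonzero length is multiplied on the
way by the parameters, all to the same power ±1. -/
theorem CuspSides.prod_edgeShape {T : IdealTriangulation} {z : T.Tet → ℂ} (S : CuspSides T z)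
    (x : T.Marked) :
    (∏ k ∈ Finset.range (Function.minimalPeriod T.rotate x),
      edgeShape (z (T.rotate^[k] x).1) ((T.rotate^[k] x).2 0) ((T.rotate^[k] x).2 1)) = 1 := by
  set F : T.Marked → ℂ := fun y => edgeShape (z y.1) (y.2 0) (y.2 1) with hF
  set s : ℤ := ((Perm.sign x.2 : ℤˣ) : ℤ) with hs
  have hsign : ∀ k, Perm.sign (T.rotate^[k] x).2 = Perm.sign x.2 := by
    intro k
    induction k with
    | zero => rfl
    | succ k ih => rw [Function.iterate_succ_apply', sign_rotate, ih]
  have hside : ∀ n, S.side (T.rotate^[n] x) =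
      S.side x * (∏ k ∈ Finset.range n, F (T.rotate^[k + 1] x)) ^ (-s) := by
    intro n
    induction n with
    | zero => simp
    | succ n ih =>
      rw [Function.iterate_succ_apply', S.side_rotate, ih, hsign, Finset.prod_range_succ, mul_zpow,
        Function.iterate_succ_apply', mul_assoc]
  set n := Function.minimalPeriod T.rotate x with hn
  have h1 := hside n
  have hx : T.rotate^[n] x = x := Function.iterate_minimalPeriod
  rw [hx] at h1
  have h2 : (∏ k ∈ Finset.range n, F (T.rotate^[k + 1] x)) ^ (-s) = 1 :=
    mul_left_cancel₀ (S.ne_zero x) (by rw [← h1, mul_one])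
  have h3 : ∏ k ∈ Finset.range n, F (T.rotate^[k + 1] x) = 1 := by
    rcases Int.units_eq_one_or (Perm.sign x.2) with h | h
    · simpa [hs, h] using h2
    · simpa [hs, h] using h2
  have hpos : 0 < n :=
    Function.minimalPeriod_pos_of_mem_periodicPts (T.rotate_injective.mem_periodicPts x)
  -- `rotate` crosses before it turns, so the product obtained starts at the first iterate;
  -- periodicity shifts it back to start at `x`.
  obtain ⟨m, hm⟩ : ∃ m, n = m + 1 := ⟨n - 1, by omega⟩
  change ∏ k ∈ Finset.range n, F (T.rotate^[k] x) = 1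
  rw [← h3, hm, Finset.prod_range_succ', Finset.prod_range_succ, ← hm, hx]
  rfl

/-- A labelling of the oriented edges of the tetrahedra which is compatible with the gluing and has
as many values as a triangulation of cusped manifold has oriented edges. -/
structure EdgeLabelling (T : IdealTriangulation) (ι : Type) [Fintype ι] where
  lab : T.Tet → Fin 4 → Fin 4 → ι
  lab_glue : ∀ t f i j, i ≠ f → j ≠ f → i ≠ j →
    lab (T.adj t f) (T.glue t f i) (T.glue t f j) = lab t i j
  surj : ∀ e, ∃ t i j, i ≠ j ∧ lab t i j = e
  card_eq : Fintype.card ι = 2 * Fintype.card T.Tet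

theorem exists_perm_sign {i j : Fin 4} (h : i ≠ j) (s : ℤˣ) :
    ∃ p : Perm (Fin 4), p 0 = i ∧ p 1 = j ∧ Perm.sign p = s := by
  rcases Int.units_eq_one_or s with rfl | rfl <;> revert i j <;> decide

/-- Each angle sum is a multiple of 2π, and it is positive because a flat tetrahedron has no flat
neighbour. Surjectivity of the labelling bounds the number of orbits from below, so the total angle
forces every multiple to be 2π. -/
theorem edgeEquations_of_cuspSides {T : IdealTriangulation} {z : T.Tet → ℂ}
    (hz : ∀ t, z t ≠ 0 ∧ z t ≠ 1 ∧ 0 ≤ (z t).im)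
    (hflat : ∀ t f, (z t).im = 0 → 0 < (z (T.adj t f)).im) (S : CuspSides T z)
    {ι : Type} [Fintype ι] (E : EdgeLabelling T ι) : T.EdgeEquations z := by
  intro x
  refine ⟨S.prod_edgeShape x, ?_⟩
  set g : T.Marked → ℝ := fun y => (edgeShape (z y.1) (y.2 0) (y.2 1)).arg with hg
  have hg0 : ∀ y, 0 ≤ g y := fun y =>
    Complex.arg_nonneg_iff.2 (edgeShape_im_nonneg (hz y.1).1 (hz y.1).2.2 _ _)
  have hpos : ∀ y, 0 < g y ∨ 0 < g (T.rotate y) := by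
    intro y
    rcases (hz y.1).2.2.lt_or_eq with h | h
    · exact Or.inl (arg_pos_of_im_pos (edgeShape_im_pos h _ _))
    · exact Or.inr (arg_pos_of_im_pos (edgeShape_im_pos (hflat y.1 (y.2 3) h.symm) _ _))
  refine orbit_sum_eq_of_sum_le (ι := ι × ℤˣ) hg0
    (lab := fun y => (E.lab y.1 (y.2 0) (y.2 1), Perm.sign y.2)) ?_ ?_ ?_ ?_ x
  · intro y
    rw [sign_rotate, rotate_snd_zero, rotate_snd_one]
    exact Prod.ext (E.lab_glue y.1 (y.2 3) (y.2 0) (y.2 1) (by simp) (by simp) (by simp)) rfl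
  · rintro ⟨e, s⟩
    obtain ⟨t, i, j, hij, rfl⟩ := E.surj e
    obtain ⟨p, rfl, rfl, rfl⟩ := exists_perm_sign hij s
    exact ⟨(t, p), rfl⟩
  · intro y
    set n := Function.minimalPeriod T.rotate y with hn
    have hn0 : 0 < n :=
      Function.minimalPeriod_pos_of_mem_periodicPts (T.rotate_injective.mem_periodicPts y)
    have hsum : 0 < ∑ k ∈ Finset.range n, g (T.rotate^[k] y) := by
      refine Finset.sum_pos' (fun _ _ => hg0 _) ?_
      rcases hpos y with h | h
      · exact ⟨0, Finset.mem_range.2 hn0, h⟩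
      -- Reducing modulo the period also covers edges of degree one.
      · refine ⟨1 % n, Finset.mem_range.2 (Nat.mod_lt _ hn0), ?_⟩
        rw [hn, Function.iterate_mod_minimalPeriod_eq]
        exact h
    obtain ⟨m, hm⟩ := exists_sum_arg_eq _ _ (S.prod_edgeShape y)
    change ∑ k ∈ Finset.range n, g (T.rotate^[k] y) = _ at hm
    rw [hm] at hsum ⊢
    have hpi := Real.pi_pos
    have hm0 : (0 : ℝ) < m := by
      by_contra! h
      nlinarith
    have : (1 : ℝ) ≤ m := by
      have : 0 < m := by exact_mod_cast hm0
      exact_mod_cast this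
    nlinarith
  -- The total is 8π per tetrahedron. It equals 2π times the number of labels: two directions and
  -- two signs for each of as many edges as tetrahedra.
  · rw [Fintype.sum_prod_type]
    simp only [hg]
    rw [Finset.sum_congr rfl fun t _ => sum_arg_edgeShape (hz t).1 (hz t).2.1 (hz t).2.2]
    simp only [Finset.sum_const, Finset.card_univ, Fintype.card_prod, E.card_eq,
      Fintype.card_units_int, nsmul_eq_mul]
    push_cast
    linarith

theorem isSolution_of_cuspSides {T : IdealTriangulation} {z : T.Tet → ℂ}
    (hz : ∀ t, z t ≠ 0 ∧ z t ≠ 1 ∧ 0 ≤ (z t).im)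
    (hflat : ∀ t f, (z t).im = 0 → 0 < (z (T.adj t f)).im) (S : CuspSides T z)
    {ι : Type} [Fintype ι] (E : EdgeLabelling T ι) : T.IsSolution z :=
  ⟨hz, edgeEquations_of_cuspSides hz hflat S E, S.completenessEquations⟩

end IdealTriangulation

/-! ### Replacing a part of a triangulation -/

/-- Finitely many tetrahedra whose faces are glued in pairs except for four of them, the ports.
The permutation `portPerm g` takes the vertex labels at port `g` to the labels in which the
outside refers to this port; the face is opposite to `g` in the latter. -/
structure Patch (m : ℕ) where
  adj : Fin m → Fin 4 → Fin m ⊕ Fin 4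
  glue : Fin m → Fin 4 → Perm (Fin 4)
  portTet : Fin 4 → Fin m
  portPerm : Fin 4 → Perm (Fin 4)
  adj_port : ∀ g, adj (portTet g) ((portPerm g)⁻¹ g) = Sum.inr g
  port_unique : ∀ c f g, adj c f = Sum.inr g → c = portTet g ∧ f = (portPerm g)⁻¹ g
  sign_port : ∀ g, Perm.sign (portPerm g) = 1
  inner : ∀ c f c', adj c f = Sum.inl c' →
    adj c' (glue c f f) = Sum.inl c ∧ glue c' (glue c f f) = (glue c f)⁻¹ ∧
      Perm.sign (glue c f) = -1 ∧ ¬ (c' = c ∧ glue c f f = f)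

theorem Patch.adj_port_symm {m : ℕ} (P : Patch m) (g : Fin 4) :
    P.adj (P.portTet g) ((P.portPerm g).symm g) = Sum.inr g := P.adj_port g

/-- A set of tetrahedra of a triangulation with four free faces, the face `g` of `base g` for
`g : Fin 4`. -/
structure Site (T : IdealTriangulation) where
  mem : T.Tet → Prop
  decMem : DecidablePred mem
  base : Fin 4 → T.Tet
  base_mem : ∀ g, mem (base g)
  not_mem : ∀ g, ¬ mem (T.adj (base g) g)
  eq_base : ∀ t f, ¬ mem t → mem (T.adj t f) → T.adj t f = base (T.glue t f f)

namespace Site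

attribute [instance] Site.decMem

variable {T : IdealTriangulation} (X : Site T) {m : ℕ} (P : Patch m)

/-- The tetrahedra outside a site. -/
abbrev Outer : Type := {t : T.Tet // ¬ X.mem t}

/-- The triangulation in which the tetrahedra of a site are replaced by a patch. -/
def graft : IdealTriangulation where
  Tet := X.Outer ⊕ Fin m
  fintypeTet := inferInstance
  adj
    | .inl t, f => if h : X.mem (T.adj t.1 f) then .inr (P.portTet (T.glue t.1 f f))
        else .inl ⟨T.adj t.1 f, h⟩
    | .inr c, f => match P.adj c f with
      | .inl c' => .inr c'
      | .inr g => .inl ⟨T.adj (X.base g) g, X.not_mem g⟩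
  glue
    | .inl t, f => if X.mem (T.adj t.1 f) then (P.portPerm (T.glue t.1 f f))⁻¹ * T.glue t.1 f
        else T.glue t.1 f
    | .inr c, f => match P.adj c f with
      | .inl _ => P.glue c f
      | .inr g => T.glue (X.base g) g * P.portPerm g
  adj_adj := by
    rintro (t | c) f
    · by_cases h : X.mem (T.adj t.1 f)
      · have h1 := X.eq_base t.1 f t.2 h
        simp [h, P.adj_port_symm, ← h1, T.adj_adj]
      · simp [h, T.adj_adj, t.2]
    · rcases h : P.adj c f with c' | g
      · simp [h, (P.inner c f c' h).1]
      · obtain ⟨rfl, h1⟩ := P.port_unique c f g h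
        have h2 : P.portPerm g f = g := by rw [h1]; simp
        simp [h, h2, T.adj_adj, T.glue_adj, X.base_mem]
  glue_adj := by
    rintro (t | c) f
    · by_cases h : X.mem (T.adj t.1 f)
      · have h1 := X.eq_base t.1 f t.2 h
        simp [h, P.adj_port_symm, ← h1, T.glue_adj]
      · simp [h, T.adj_adj, T.glue_adj, t.2]
    · rcases h : P.adj c f with c' | g
      · simp [h, (P.inner c f c' h).1, (P.inner c f c' h).2.1]
      · obtain ⟨rfl, h1⟩ := P.port_unique c f g h
        have h2 : P.portPerm g f = g := by rw [h1]; simp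
        simp [h, h2, T.adj_adj, T.glue_adj, X.base_mem]
  not_self := by
    rintro (t | c) f
    · by_cases h : X.mem (T.adj t.1 f)
      · simp [h]
      · have := T.not_self t.1 f
        simpa [h, Subtype.ext_iff] using this
    · rcases h : P.adj c f with c' | g
      · simpa [h] using (P.inner c f c' h).2.2.2
      · simp [h]
  odd := by
    rintro (t | c) f
    · by_cases h : X.mem (T.adj t.1 f)
      · simp [h, P.sign_port, T.odd]
      · simp [h, T.odd]
    · rcases h : P.adj c f with c' | g
      · simpa [h] using (P.inner c f c' h).2.2.1
      · simp [h, P.sign_port, T.odd]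

theorem graft_cross_inl_of_not_mem {t : X.Outer} {p : Perm (Fin 4)} {f : Fin 4}
    (h : ¬ X.mem (T.adj t.1 (p f))) :
    (X.graft P).cross (.inl t, p) f = (.inl ⟨T.adj t.1 (p f), h⟩, T.glue t.1 (p f) * p) := by
  simp [IdealTriangulation.cross, graft, h]

theorem graft_cross_inl_of_mem {t : X.Outer} {p : Perm (Fin 4)} {f : Fin 4}
    (h : X.mem (T.adj t.1 (p f))) :
    (X.graft P).cross (.inl t, p) f = (.inr (P.portTet (T.glue t.1 (p f) (p f))),
      (P.portPerm (T.glue t.1 (p f) (p f)))⁻¹ * T.glue t.1 (p f) * p) := by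
  simp [IdealTriangulation.cross, graft, h]

theorem graft_cross_inr_of_inl {c c' : Fin m} {p : Perm (Fin 4)} {f : Fin 4}
    (h : P.adj c (p f) = .inl c') :
    (X.graft P).cross (.inr c, p) f = (.inr c', P.glue c (p f) * p) := by
  simp [IdealTriangulation.cross, graft, h]

theorem graft_cross_inr_of_inr {c : Fin m} {g : Fin 4} {p : Perm (Fin 4)} {f : Fin 4}
    (h : P.adj c (p f) = .inr g) :
    (X.graft P).cross (.inr c, p) f =
      (.inl ⟨T.adj (X.base g) g, X.not_mem g⟩, T.glue (X.base g) g * P.portPerm g * p) := by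
  simp [IdealTriangulation.cross, graft, h]

end Site

/-! ### 2-3 moves inside a patch. -/

/-- The index of an equatorial vertex among the three of them. -/
def equatorial : Fin 4 → Fin 3 := ![0, 1, 2, 2]

/-- The entry of `equatorial` at the apex 3 is a dummy, hence the hypothesis. -/
theorem castSucc_equatorial {i : Fin 4} (h : i ≠ 3) : (equatorial i).castSucc = i := by
  revert i; decide

theorem equatorial_castSucc (i : Fin 3) : equatorial i.castSucc = i := by
  revert i; decide

/-- A 2-3 move inside a patch. -/
structure PatchMove {m m' : ℕ} (P : Patch m) (P' : Patch m') where
  a : Fin m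
  b : Fin m
  ne : a ≠ b
  σ : Perm (Fin 4)
  τ : Perm (Fin 4)
  adj_a : P.adj a (σ 3) = .inl b
  glue_a : P.glue a (σ 3) * σ = τ
  c : Fin 3 → Fin m'
  c_injective : Function.Injective c
  ρ : Fin 3 → Perm (Fin 4)
  sign_ρ : ∀ i, Perm.sign (ρ i) = Perm.sign σ
  keep : Fin m → Fin m'
  keepInv : Fin m' → Fin m
  keep_ne : ∀ x, x ≠ a → x ≠ b → ∀ i, keep x ≠ c i
  keepInv_ne : ∀ y, (∀ i, y ≠ c i) → keepInv y ≠ a ∧ keepInv y ≠ b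
  keepInv_keep : ∀ x, x ≠ a → x ≠ b → keepInv (keep x) = x
  keep_keepInv : ∀ y, (∀ i, y ≠ c i) → keep (keepInv y) = y
  cross_c : ∀ i j : Fin 3, i ≠ j → P'.adj (c i) (ρ i j.castSucc) = .inl (c j) ∧
    P'.glue (c i) (ρ i j.castSucc) * ρ i = ρ j * swap i.castSucc j.castSucc
  /-- The tetrahedron which has the face `f` of `x` after the move. -/
  imgTet : Fin m → Fin 4 → Fin m' := fun x f =>
    if x = a then c (equatorial (σ⁻¹ f)) else if x = b then c (equatorial (τ⁻¹ f)) else keep x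
  -- The equation pins the field to its default value, so that it can be unfolded for an arbitrary
  -- move.
  imgTet_eq : imgTet = fun x f =>
    if x = a then c (equatorial (σ⁻¹ f)) else if x = b then c (equatorial (τ⁻¹ f)) else keep x :=
    by rfl
  /-- The relabelling that takes the face `f` of `x` to a face of `imgTet x f`. -/
  imgPerm : Fin m → Fin 4 → Perm (Fin 4) := fun x f =>
    if x = a then ρ (equatorial (σ⁻¹ f)) * σ⁻¹ else if x = b then
      ρ (equatorial (τ⁻¹ f)) * swap (equatorial (τ⁻¹ f)).castSucc 3 * τ⁻¹ else 1
  imgPerm_eq : imgPerm = fun x f =>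
    if x = a then ρ (equatorial (σ⁻¹ f)) * σ⁻¹ else if x = b then
      ρ (equatorial (τ⁻¹ f)) * swap (equatorial (τ⁻¹ f)).castSucc 3 * τ⁻¹ else 1 := by rfl
  glue_img : ∀ x f x', ¬ (x = a ∧ f = σ 3) → ¬ (x = b ∧ f = τ 3) → P.adj x f = .inl x' →
    P'.adj (imgTet x f) (imgPerm x f f) = .inl (imgTet x' (P.glue x f f)) ∧
      P'.glue (imgTet x f) (imgPerm x f f) * imgPerm x f =
        imgPerm x' (P.glue x f f) * P.glue x f
  port_img : ∀ g, imgTet (P.portTet g) ((P.portPerm g)⁻¹ g) = P'.portTet g ∧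
    P'.portPerm g * imgPerm (P.portTet g) ((P.portPerm g)⁻¹ g) = P.portPerm g

namespace PatchMove

variable {m m' : ℕ} {P : Patch m} {P' : Patch m'} (μ : PatchMove P P')
  {T : IdealTriangulation} (X : Site T)

theorem adj_b : P.adj μ.b (μ.τ 3) = .inl μ.a := by
  have h := (P.inner _ _ _ μ.adj_a).1
  rwa [← Perm.mul_apply, μ.glue_a] at h

theorem glue_b : P.glue μ.b (μ.τ 3) = (P.glue μ.a (μ.σ 3))⁻¹ := by
  have h := (P.inner _ _ _ μ.adj_a).2.1
  rwa [← Perm.mul_apply, μ.glue_a] at h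

/-- The tetrahedra that are kept by a move inside a patch. -/
def keepEquiv : {t : (X.graft P).Tet // t ≠ .inr μ.a ∧ t ≠ .inr μ.b} ≃
    {t : (X.graft P').Tet // ∀ i, t ≠ .inr (μ.c i)} where
  toFun
    | ⟨.inl t, _⟩ => ⟨.inl t, fun _ => Sum.inl_ne_inr⟩
    | ⟨.inr x, h⟩ => ⟨.inr (μ.keep x), fun i hi => μ.keep_ne x (fun h' => h.1 (congrArg _ h'))
        (fun h' => h.2 (congrArg _ h')) i (Sum.inr_injective hi)⟩
  invFun
    | ⟨.inl t, _⟩ => ⟨.inl t, Sum.inl_ne_inr, Sum.inl_ne_inr⟩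
    | ⟨.inr y, h⟩ => ⟨.inr (μ.keepInv y),
        fun h' => (μ.keepInv_ne y fun i hi => h i (congrArg _ hi)).1 (Sum.inr_injective h'),
        fun h' => (μ.keepInv_ne y fun i hi => h i (congrArg _ hi)).2 (Sum.inr_injective h')⟩
  left_inv := by
    rintro ⟨t | x, h⟩
    · rfl
    · exact Subtype.ext (congrArg Sum.inr (μ.keepInv_keep x (fun h' => h.1 (congrArg _ h'))
        (fun h' => h.2 (congrArg _ h'))))
  right_inv := by
    rintro ⟨t | y, h⟩
    · rfl
    · exact Subtype.ext (congrArg Sum.inr (μ.keep_keepInv y fun i hi => h i (congrArg _ hi)))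

/-- The correspondence of faces before and after a move inside a patch. -/
def Corr (x : (X.graft P).Marked) (y : (X.graft P').Marked) (f : Fin 4) : Prop :=
  (∃ (i : Fin 3) (π : Perm (Fin 4)), π f = i.castSucc ∧
    x = (.inr μ.a, μ.σ * π) ∧ y = (.inr (μ.c i), μ.ρ i * π)) ∨
  (∃ (i : Fin 3) (π : Perm (Fin 4)), π f = i.castSucc ∧
    x = (.inr μ.b, μ.τ * π) ∧ y = (.inr (μ.c i), μ.ρ i * swap i.castSucc 3 * π)) ∨
  (∃ (t : {t : (X.graft P).Tet // t ≠ .inr μ.a ∧ t ≠ .inr μ.b}) (π : Perm (Fin 4)),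
    x = (t.1, π) ∧ y = ((μ.keepEquiv X t).1, π))

theorem corr_outer (t : X.Outer) (p : Perm (Fin 4)) (f : Fin 4) :
    μ.Corr X (.inl t, p) (.inl t, p) f :=
  .inr (.inr ⟨⟨.inl t, Sum.inl_ne_inr, Sum.inl_ne_inr⟩, p, rfl, rfl⟩)

theorem corr_inner (x : Fin m) (p : Perm (Fin 4)) (f : Fin 4)
    (ha : ¬ (x = μ.a ∧ p f = μ.σ 3)) (hb : ¬ (x = μ.b ∧ p f = μ.τ 3)) :
    μ.Corr X (.inr x, p) (.inr (μ.imgTet x (p f)), μ.imgPerm x (p f) * p) f := by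
  rw [μ.imgTet_eq, μ.imgPerm_eq]
  by_cases h : x = μ.a
  · subst h
    have h3 : μ.σ⁻¹ (p f) ≠ 3 := fun h' => ha ⟨rfl, by rw [← h']; simp⟩
    refine .inl ⟨equatorial (μ.σ⁻¹ (p f)), μ.σ⁻¹ * p, ?_, ?_, ?_⟩
    · rw [castSucc_equatorial h3]; rfl
    · simp
    · simp [mul_assoc]
  · by_cases h' : x = μ.b
    · subst h'
      have h3 : μ.τ⁻¹ (p f) ≠ 3 := fun h' => hb ⟨rfl, by rw [← h']; simp⟩
      refine .inr (.inl ⟨equatorial (μ.τ⁻¹ (p f)), μ.τ⁻¹ * p, ?_, ?_, ?_⟩)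
      · rw [castSucc_equatorial h3]; rfl
      · simp
      · simp [mul_assoc, h]
    · refine .inr (.inr ⟨⟨.inr x, fun h'' => h (Sum.inr_injective h''),
        fun h'' => h' (Sum.inr_injective h'')⟩, p, rfl, ?_⟩)
      simp [h, h', keepEquiv]

theorem corr_cases {x : (X.graft P).Marked} {y : (X.graft P').Marked} {f : Fin 4}
    (h : μ.Corr X x y f) :
    (∃ (t : X.Outer) (p : Perm (Fin 4)), x = (.inl t, p) ∧ y = (.inl t, p)) ∨
    ∃ (k : Fin m) (p : Perm (Fin 4)), ¬ (k = μ.a ∧ p f = μ.σ 3) ∧ ¬ (k = μ.b ∧ p f = μ.τ 3) ∧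
      x = (.inr k, p) ∧ y = (.inr (μ.imgTet k (p f)), μ.imgPerm k (p f) * p) := by
  rw [μ.imgTet_eq, μ.imgPerm_eq]
  have hne : ∀ i : Fin 3, i.castSucc ≠ 3 := by decide
  rcases h with ⟨i, π, hπ, rfl, rfl⟩ | ⟨i, π, hπ, rfl, rfl⟩ | ⟨⟨t | k, ht⟩, π, rfl, rfl⟩
  · refine .inr ⟨μ.a, μ.σ * π, ?_, fun h => μ.ne h.1, rfl, ?_⟩
    · rintro ⟨-, h⟩
      rw [Perm.mul_apply, hπ] at h
      exact hne i (μ.σ.injective h)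
    · simp [hπ, equatorial_castSucc, mul_assoc]
  · refine .inr ⟨μ.b, μ.τ * π, fun h => μ.ne h.1.symm, ?_, rfl, ?_⟩
    · rintro ⟨-, h⟩
      rw [Perm.mul_apply, hπ] at h
      exact hne i (μ.τ.injective h)
    · simp [hπ, equatorial_castSucc, mul_assoc, μ.ne.symm]
  · exact .inl ⟨t, π, rfl, rfl⟩
  · have h1 : k ≠ μ.a := fun h => ht.1 (congrArg _ h)
    have h2 : k ≠ μ.b := fun h => ht.2 (congrArg _ h)
    refine .inr ⟨k, π, fun h => h1 h.1, fun h => h2 h.1, rfl, ?_⟩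
    simp [h1, h2, keepEquiv]

/-- Crossings between the outside and the patch are governed by `port_img`, those inside the patch
by `glue_img`, and those outside are unchanged. -/
theorem corr_cross {x : (X.graft P).Marked} {y : (X.graft P').Marked} {f : Fin 4}
    (h : μ.Corr X x y f) : μ.Corr X ((X.graft P).cross x f) ((X.graft P').cross y f) f := by
  rcases μ.corr_cases X h with ⟨t, p, rfl, rfl⟩ | ⟨k, p, ha, hb, rfl, rfl⟩
  · by_cases hm : X.mem (T.adj t.1 (p f))
    · rw [X.graft_cross_inl_of_mem P hm, X.graft_cross_inl_of_mem P' hm]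
      set g := T.glue t.1 (p f) (p f) with hg
      obtain ⟨h1, h2⟩ := μ.port_img g
      have h3 := P.adj_port g
      have e : ((P.portPerm g)⁻¹ * T.glue t.1 (p f) * p) f = (P.portPerm g)⁻¹ g := rfl
      -- A port is a free face of the patch, so it is not the face shared by `a` and `b`.
      have key := μ.corr_inner X (P.portTet g) ((P.portPerm g)⁻¹ * T.glue t.1 (p f) * p) f
        (fun h => by
          rw [e] at h
          rw [h.1, h.2, μ.adj_a] at h3
          exact absurd h3 (by simp))
        (fun h => by
          rw [e] at h
          rw [h.1, h.2, μ.adj_b] at h3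
          exact absurd h3 (by simp))
      rw [e, h1] at key
      convert key using 2
      generalize μ.imgPerm (P.portTet g) ((P.portPerm g)⁻¹ g) = r at h2 ⊢
      rw [← h2]
      simp [mul_assoc]
    · rw [X.graft_cross_inl_of_not_mem P hm, X.graft_cross_inl_of_not_mem P' hm]
      exact μ.corr_outer X _ _ _
  · rcases hk : P.adj k (p f) with k' | g
    · obtain ⟨h1, h2⟩ := μ.glue_img k (p f) k' ha hb hk
      have h1' : P'.adj (μ.imgTet k (p f)) ((μ.imgPerm k (p f) * p) f) =
        .inl (μ.imgTet k' (P.glue k (p f) (p f))) := h1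
      rw [X.graft_cross_inr_of_inl P hk, X.graft_cross_inr_of_inl P' h1']
      have key := μ.corr_inner X k' (P.glue k (p f) * p) f (fun h => ?_) (fun h => ?_)
      · rw [← mul_assoc] at key ⊢
        convert key using 2
        exact congrArg (fun q => (Sum.inr (μ.imgTet k' (P.glue k (p f) (p f))), q * p)) h2
      -- Arriving at the shared face from one side means having left through it from the other,
      -- since gluing is an involution; this was excluded.
      · have h3 := (P.inner _ _ _ hk)
        rw [Perm.mul_apply] at h
        rw [h.1, h.2, μ.adj_a] at h3
        refine hb ⟨(Sum.inl_injective h3.1).symm, ?_⟩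
        have h4 := h3.2.1
        have h5 : p f = (P.glue k (p f))⁻¹ (μ.σ 3) := by rw [← h.2]; simp
        rw [h5, ← h4, ← Perm.mul_apply, μ.glue_a]
      · have h3 := (P.inner _ _ _ hk)
        rw [Perm.mul_apply] at h
        rw [h.1, h.2, μ.adj_b] at h3
        refine ha ⟨(Sum.inl_injective h3.1).symm, ?_⟩
        have h4 := h3.2.1
        have h5 : p f = (P.glue k (p f))⁻¹ (μ.τ 3) := by rw [← h.2]; simp
        rw [h5, ← h4, μ.glue_b, ← μ.glue_a]
        simp
    · obtain ⟨h1, h2⟩ := P.port_unique _ _ _ hk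
      obtain ⟨h3, h4⟩ := μ.port_img g
      have h5 : P'.adj (μ.imgTet k (p f)) ((μ.imgPerm k (p f) * p) f) = .inr g := by
        rw [Perm.mul_apply, h1, h2, h3]
        have : μ.imgPerm (P.portTet g) ((P.portPerm g)⁻¹ g) ((P.portPerm g)⁻¹ g) =
            (P'.portPerm g)⁻¹ g := by
          generalize μ.imgPerm (P.portTet g) ((P.portPerm g)⁻¹ g) = r at h4 ⊢
          rw [Perm.eq_inv_iff_eq, ← Perm.mul_apply, h4]
          simp
        rw [this, P'.adj_port]
      rw [X.graft_cross_inr_of_inr P hk, X.graft_cross_inr_of_inr P' h5]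
      have h6 : P'.portPerm g * (μ.imgPerm k (p f) * p) = P.portPerm g * p := by
        rw [← mul_assoc, h1, h2, h4]
      rw [mul_assoc, mul_assoc, h6]
      exact μ.corr_outer X _ _ _

/-- A 2-3 move inside a patch is a 2-3 move of the triangulations. -/
def toMove : TwoThreeMove (X.graft P) (X.graft P') where
  a := .inr μ.a
  b := .inr μ.b
  ne := fun h => μ.ne (Sum.inr_injective h)
  σ := μ.σ
  τ := μ.τ
  cross_a := by rw [X.graft_cross_inr_of_inl P μ.adj_a, μ.glue_a]
  c := fun i => .inr (μ.c i)
  c_injective := Sum.inr_injective.comp μ.c_injective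
  ρ := μ.ρ
  sign_ρ := μ.sign_ρ
  keep := μ.keepEquiv X
  cross_c := fun i j hij => by
    rw [X.graft_cross_inr_of_inl P' (μ.cross_c i j hij).1, (μ.cross_c i j hij).2]
  cross_corr := fun _ _ _ h => μ.corr_cross X h

end PatchMove

/-! ### Renaming tetrahedra. -/

/-- A bijection of tetrahedra that respects all gluings and labels. -/
structure IdealTriangulation.LabelledIso (G T : IdealTriangulation) where
  equiv : G.Tet ≃ T.Tet
  adj : ∀ t f, T.adj (equiv t) f = equiv (G.adj t f)
  glue : ∀ t f, T.glue (equiv t) f = G.glue t f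

/-- A 2-3 move, read in a triangulation that differs by names of tetrahedra. -/
def TwoThreeMove.rename {G T T' : IdealTriangulation} (m : TwoThreeMove G T')
    (e : G.LabelledIso T) : TwoThreeMove T T' where
  a := e.equiv m.a
  b := e.equiv m.b
  ne := fun h => m.ne (e.equiv.injective h)
  σ := m.σ
  τ := m.τ
  cross_a := by
    have h := m.cross_a
    simp only [IdealTriangulation.cross, Prod.mk.injEq] at h ⊢
    rw [e.adj, e.glue, h.1]
    exact ⟨rfl, h.2⟩
  c := m.c
  c_injective := m.c_injective
  ρ := m.ρ
  sign_ρ := m.sign_ρ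
  keep := (e.equiv.symm.subtypeEquiv fun t => by
    simp only [ne_eq, Equiv.symm_apply_eq]).trans m.keep
  cross_c := m.cross_c
  cross_corr := by
    have key := m.cross_corr
    have hc : ∀ (x : G.Marked) f, T.cross (e.equiv x.1, x.2) f =
        (e.equiv (G.cross x f).1, (G.cross x f).2) := fun x f => by
      simp only [IdealTriangulation.cross, e.adj, e.glue]
    intro corr x y f h
    have h' := key (e.equiv.symm x.1, x.2) y f (by
      rcases h with ⟨i, π, h1, rfl, rfl⟩ | ⟨i, π, h1, rfl, rfl⟩ | ⟨t, π, rfl, rfl⟩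
      · exact .inl ⟨i, π, h1, by simp, rfl⟩
      · exact .inr (.inl ⟨i, π, h1, by simp, rfl⟩)
      · exact .inr (.inr ⟨_, π, rfl, rfl⟩))
    have hx := hc (e.equiv.symm x.1, x.2) f
    simp only [Equiv.apply_symm_apply] at hx
    rw [hx]
    rcases h' with ⟨i, π, h1, h2, h3⟩ | ⟨i, π, h1, h2, h3⟩ | ⟨t, π, h2, h3⟩
    · exact .inl ⟨i, π, h1, by rw [h2], h3⟩
    · exact .inr (.inl ⟨i, π, h1, by rw [h2], h3⟩)
    · refine .inr (.inr ⟨⟨e.equiv t.1, fun h => t.2.1 (e.equiv.injective h),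
        fun h => t.2.2 (e.equiv.injective h)⟩, π, by rw [h2], ?_⟩)
      rw [h3]
      simp

/-! ### The four patches and the three moves between them. -/

set_option maxRecDepth 8000
set_option synthInstance.maxHeartbeats 200000
set_option synthInstance.maxSize 1024

/-- Three consecutive layers inside a fan. -/
def fanPatch : Patch 3 where
  adj := ![![.inr 0, .inl 1, .inr 2, .inl 1], ![.inl 0, .inl 2, .inl 0, .inl 2], ![.inl 1, .inr 1, .inl 1, .inr 3]]
  -- The entries at free faces are placeholders; `Site.graft` uses `portPerm` there. The same holds
  -- for the patches below.
  glue := ![![1, swap 1 2, 1, swap 0 3],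
    ![swap 0 3, swap 1 2, swap 1 2, swap 0 3],
    ![swap 0 3, 1, swap 1 2, 1]]
  portTet := ![0, 2, 0, 2]
  portPerm := ![1, 1, 1, 1]
  adj_port := by decide
  port_unique := by decide
  sign_port := by decide
  inner := by decide

/-- The result of a 2-3 move on the lower two of three layers of a fan. -/
def firstPatch : Patch 4 where
  adj := ![![.inr 0, .inl 1, .inl 2, .inl 3], ![.inl 0, .inl 2, .inl 2, .inl 3], ![.inl 1, .inl 0, .inr 2, .inl 1], ![.inl 0, .inr 1, .inl 1, .inr 3]]
  glue := ![![1, swap 0 1, swap 0 2 * swap 2 1 * swap 1 3, swap 0 3],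
    ![swap 0 1, swap 0 2 * swap 2 3 * swap 3 1, swap 0 1 * swap 1 2 * swap 2 3, swap 0 3 * swap 3 2 * swap 2 1],
    ![swap 0 1 * swap 1 3 * swap 3 2, swap 0 3 * swap 3 1 * swap 1 2, swap 0 3 * swap 3 1, swap 0 3 * swap 3 2 * swap 2 1],
    ![swap 0 3, 1, swap 0 1 * swap 1 2 * swap 2 3, 1]]
  portTet := ![0, 3, 2, 3]
  portPerm := ![1, 1, swap 0 3 * swap 3 1, 1]
  adj_port := by decide
  port_unique := by decide
  sign_port := by decide
  inner := by decide

/-- The result of a second 2-3 move. -/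
def secondPatch : Patch 5 where
  adj := ![![.inr 0, .inl 1, .inl 2, .inr 3], ![.inl 0, .inl 3, .inl 2, .inr 1], ![.inl 3, .inl 0, .inl 4, .inl 1], ![.inl 1, .inl 4, .inl 4, .inl 2], ![.inl 3, .inl 2, .inr 2, .inl 3]]
  glue := ![![1, swap 0 1, swap 0 2 * swap 2 1 * swap 1 3, 1],
    ![swap 0 1, swap 0 1, swap 0 1 * swap 1 2 * swap 2 3, swap 0 3 * swap 3 1],
    ![swap 0 3 * swap 3 2 * swap 2 1, swap 0 3 * swap 3 1 * swap 1 2, swap 1 2, swap 0 3 * swap 3 2 * swap 2 1],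
    ![swap 0 1, swap 0 2 * swap 2 3 * swap 3 1, swap 0 1 * swap 1 2 * swap 2 3, swap 0 1 * swap 1 2 * swap 2 3],
    ![swap 0 1 * swap 1 3 * swap 3 2, swap 1 2, swap 0 3 * swap 3 1, swap 0 3 * swap 3 2 * swap 2 1]]
  portTet := ![0, 1, 4, 0]
  portPerm := ![1, swap 0 3 * swap 3 1, swap 0 3 * swap 3 1, 1]
  adj_port := by decide
  port_unique := by decide
  sign_port := by decide
  inner := by decide

/-- The result of the final 3-2 move. -/
def thirdPatch : Patch 4 where
  adj := ![![.inr 0, .inl 1, .inl 2, .inr 3], ![.inl 0, .inl 2, .inl 3, .inr 1], ![.inl 1, .inl 0, .inr 2, .inl 3], ![.inl 3, .inl 1, .inl 2, .inl 3]]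
  glue := ![![1, swap 0 1, swap 0 2 * swap 2 1 * swap 1 3, 1],
    ![swap 0 1, swap 0 2 * swap 2 3 * swap 3 1, swap 0 2 * swap 2 1 * swap 1 3, swap 0 3 * swap 3 1],
    ![swap 0 1 * swap 1 3 * swap 3 2, swap 0 3 * swap 3 1 * swap 1 2, swap 0 3 * swap 3 1, swap 2 3],
    ![swap 0 3 * swap 3 2 * swap 2 1, swap 0 3 * swap 3 1 * swap 1 2, swap 2 3, swap 0 1 * swap 1 2 * swap 2 3]]
  portTet := ![0, 1, 2, 0]
  portPerm := ![1, swap 0 3 * swap 3 1, swap 0 3 * swap 3 1, 1]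
  adj_port := by decide
  port_unique := by decide
  sign_port := by decide
  inner := by decide

/-- The 2-3 move on the lower two layers. -/
def firstMove : PatchMove fanPatch firstPatch where
  a := 0
  b := 1
  ne := by decide
  σ := 1
  τ := swap 0 3
  adj_a := by decide
  glue_a := by decide
  c := ![0, 1, 2]
  c_injective := by decide
  ρ := ![1, 1, swap 0 1 * swap 1 3]
  sign_ρ := by decide
  -- Only the third layer is kept; the entries at `a` and `b`, and those of `keepInv` at new
  -- tetrahedra, are placeholders.
  keep := ![0, 0, 3]
  keepInv := ![0, 0, 0, 2]
  keep_ne := by decide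
  keepInv_ne := by decide
  keepInv_keep := by decide
  keep_keepInv := by decide
  cross_c := by decide
  glue_img := by decide
  port_img := by decide

/-- The 2-3 move on the third layer and a tetrahedron created before. -/
def secondMove : PatchMove firstPatch secondPatch where
  a := 0
  b := 3
  ne := by decide
  σ := 1
  τ := swap 0 3
  adj_a := by decide
  glue_a := by decide
  c := ![0, 1, 2]
  c_injective := by decide
  ρ := ![1, 1, swap 0 1 * swap 1 3]
  sign_ρ := by decide
  keep := ![0, 3, 4, 0]
  keepInv := ![0, 0, 0, 1, 2]
  keep_ne := by decide
  keepInv_ne := by decide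
  keepInv_keep := by decide
  keep_keepInv := by decide
  cross_c := by decide
  glue_img := by decide
  port_img := by decide

/-- The inverse of the final 3-2 move. -/
def thirdMove : PatchMove thirdPatch secondPatch where
  a := 2
  b := 3
  ne := by decide
  σ := 1
  τ := swap 2 3
  adj_a := by decide
  glue_a := by decide
  -- These surround the edge of degree three, which was the middle rung of the fan. Tetrahedra 3 and
  -- 4 stem from the first move, 2 from the second; 3 is the flat one.
  c := ![3, 2, 4]
  c_injective := by decide
  ρ := ![swap 1 3 * swap 3 2, 1, 1]
  sign_ρ := by decide
  keep := ![0, 1, 0, 0]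
  keepInv := ![0, 1, 0, 0, 0]
  keep_ne := by decide
  keepInv_ne := by decide
  keepInv_keep := by decide
  keep_keepInv := by decide
  cross_c := by decide
  glue_img := by decide
  port_img := by decide

/-! ### Weights on edges -/

/-- The sign of a pair of vertices, for the order of the labels. -/
def ordSign (i j : Fin 4) : ℤ := if i < j then 1 else -1

/-- The sign of a triple of vertices, for the cyclic order of the labels. -/
def cyclicSign (i j k : Fin 4) : ℤ := ordSign i j * ordSign j k * ordSign k i

theorem sign_eq_prod_ordSign (p : Perm (Fin 4)) : ((Perm.sign p : ℤˣ) : ℤ) =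
    ordSign (p 0) (p 1) * ordSign (p 0) (p 2) * ordSign (p 0) (p 3) * ordSign (p 1) (p 2) *
      ordSign (p 1) (p 3) * ordSign (p 2) (p 3) := by
  revert p; decide

/-- The side of the cusp triangle at the first vertex that runs from the second to the third one,
for given weights of the edges of a tetrahedron. -/
noncomputable def weightSide (w : Fin 4 → Fin 4 → ℂ) (p : Perm (Fin 4)) : ℂ :=
  cyclicSign (p 0) (p 1) (p 2) * w (p 1) (p 2) / (w (p 0) (p 1) * w (p 2) (p 0))

/-- Two sides meeting at a corner have as quotient, up to sign, a cross-ratio of the six weights.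
The Ptolemy relation turns the three cross-ratios into z, 1/(1 - z) and (z - 1)/z, and the cyclic
signs absorb the minus sign in the second one. -/
theorem weightSide_turn {w : Fin 4 → Fin 4 → ℂ} {z : ℂ} (hs : ∀ i j, w i j = w j i)
    (h0 : ∀ i j, i ≠ j → w i j ≠ 0) (hz : z * (w 0 3 * w 1 2) = w 0 2 * w 1 3)
    (hp : w 0 2 * w 1 3 = w 0 3 * w 1 2 + w 0 1 * w 2 3) (p : Perm (Fin 4)) :
    weightSide w (p * swap 2 3) =
      weightSide w p * edgeShape z (p 0) (p 1) ^ ((Perm.sign p : ℤˣ) : ℤ) := by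
  have s0 : swap (2 : Fin 4) 3 0 = 0 := by decide
  have s1 : swap (2 : Fin 4) 3 1 = 1 := by decide
  have n01 := h0 0 1 (by decide)
  have n02 := h0 0 2 (by decide)
  have n03 := h0 0 3 (by decide)
  have n12 := h0 1 2 (by decide)
  have n13 := h0 1 3 (by decide)
  have n23 := h0 2 3 (by decide)
  have e0 : z = w 0 2 * w 1 3 / (w 0 3 * w 1 2) := by
    rw [eq_div_iff (mul_ne_zero n03 n12), hz]
  have e1 : 1 / (1 - z) = - (w 0 3 * w 1 2) / (w 0 1 * w 2 3) := by
    have : 1 - z = - (w 0 1 * w 2 3) / (w 0 3 * w 1 2) := by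
      rw [e0]; field_simp; linear_combination -hp
    rw [this]; field_simp
  have e2 : (z - 1) / z = (w 0 1 * w 2 3) / (w 0 2 * w 1 3) := by
    have : z - 1 = (w 0 1 * w 2 3) / (w 0 3 * w 1 2) := by
      rw [e0]; field_simp; linear_combination hp
    rw [this, e0]; field_simp
  have h10 := hs 1 0
  have h20 := hs 2 0
  have h30 := hs 3 0
  have h21 := hs 2 1
  have h31 := hs 3 1
  have h32 := hs 3 2
  have z01 : edgeShape z 0 1 = w 0 2 * w 1 3 / (w 0 3 * w 1 2) := e0
  have z02 : edgeShape z 0 2 = - (w 0 3 * w 1 2) / (w 0 1 * w 2 3) := e1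
  have z03 : edgeShape z 0 3 = w 0 1 * w 2 3 / (w 0 2 * w 1 3) := e2
  have z10 : edgeShape z 1 0 = w 0 2 * w 1 3 / (w 0 3 * w 1 2) := e0
  have z12 : edgeShape z 1 2 = w 0 1 * w 2 3 / (w 0 2 * w 1 3) := e2
  have z13 : edgeShape z 1 3 = - (w 0 3 * w 1 2) / (w 0 1 * w 2 3) := e1
  have z20 : edgeShape z 2 0 = - (w 0 3 * w 1 2) / (w 0 1 * w 2 3) := e1
  have z21 : edgeShape z 2 1 = w 0 1 * w 2 3 / (w 0 2 * w 1 3) := e2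
  have z23 : edgeShape z 2 3 = w 0 2 * w 1 3 / (w 0 3 * w 1 2) := e0
  have z30 : edgeShape z 3 0 = w 0 1 * w 2 3 / (w 0 2 * w 1 3) := e2
  have z31 : edgeShape z 3 1 = - (w 0 3 * w 1 2) / (w 0 1 * w 2 3) := e1
  have z32 : edgeShape z 3 2 = w 0 2 * w 1 3 / (w 0 3 * w 1 2) := e0
  have o01 : ordSign 0 1 = 1 := rfl
  have o02 : ordSign 0 2 = 1 := rfl
  have o03 : ordSign 0 3 = 1 := rfl
  have o10 : ordSign 1 0 = -1 := rfl
  have o12 : ordSign 1 2 = 1 := rfl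
  have o13 : ordSign 1 3 = 1 := rfl
  have o20 : ordSign 2 0 = -1 := rfl
  have o21 : ordSign 2 1 = -1 := rfl
  have o23 : ordSign 2 3 = 1 := rfl
  have o30 : ordSign 3 0 = -1 := rfl
  have o31 : ordSign 3 1 = -1 := rfl
  have o32 : ordSign 3 2 = -1 := rfl
  rw [sign_eq_prod_ordSign]
  simp only [weightSide, Perm.mul_apply, s0, s1, swap_apply_left]
  have d01 : p 0 ≠ p 1 := by simp
  have d02 : p 0 ≠ p 2 := by simp
  have d03 : p 0 ≠ p 3 := by simp
  have d12 : p 1 ≠ p 2 := by simp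
  have d13 : p 1 ≠ p 3 := by simp
  have d23 : p 2 ≠ p 3 := by simp
  generalize p 0 = i at *
  generalize p 1 = j at *
  generalize p 2 = k at *
  generalize p 3 = l at *
  -- The 24 orderings are checked one by one, after the weights and shapes have been brought to
  -- increasing indices.
  fin_cases i <;> fin_cases j <;> first | (exfalso; exact d01 rfl) | skip
  all_goals fin_cases k <;> first | (exfalso; exact d02 rfl) | (exfalso; exact d12 rfl) | skip
  all_goals
    fin_cases l <;> first
      | (exfalso; exact d03 rfl) | (exfalso; exact d13 rfl) | (exfalso; exact d23 rfl) | skip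
  all_goals
    clear d01 d02 d03 d12 d13 d23
    simp only [Fin.zero_eta, Fin.mk_one, Fin.reduceFinMk, cyclicSign,
      o01, o02, o03, o10, o12, o13, o20, o21, o23, o30, o31, o32,
      z01, z02, z03, z10, z12, z13, z20, z21, z23, z30, z31, z32,
      h10, h20, h30, h21, h31, h32]
    norm_num
    try field_simp

theorem weightSide_reverse {w : Fin 4 → Fin 4 → ℂ} (hs : ∀ i j, w i j = w j i)
    (p : Perm (Fin 4)) : weightSide w (p * swap 1 2) = - weightSide w p := by
  have s0 : swap (1 : Fin 4) 2 0 = 0 := by decide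
  have hc : cyclicSign (p 0) (p 2) (p 1) = - cyclicSign (p 0) (p 1) (p 2) := by
    revert p; decide
  simp only [weightSide, Perm.mul_apply, s0, swap_apply_left, swap_apply_right, hc]
  rw [hs (p 2) (p 1), hs (p 0) (p 2), hs (p 0) (p 1)]
  push_cast
  ring

theorem weightSide_ne_zero {w : Fin 4 → Fin 4 → ℂ} (h0 : ∀ i j, i ≠ j → w i j ≠ 0)
    (p : Perm (Fin 4)) : weightSide w p ≠ 0 := by
  have hc : cyclicSign (p 0) (p 1) (p 2) ≠ 0 := by revert p; decide
  exact div_ne_zero (mul_ne_zero (by exact_mod_cast hc) (h0 _ _ (by simp)))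
    (mul_ne_zero (h0 _ _ (by simp)) (h0 _ _ (by simp)))

namespace IdealTriangulation

/-- Complex weights of the edges of a triangulation that satisfy Ptolemy relations and have the
shape parameters `z` as cross-ratios. -/
structure EdgeWeights (T : IdealTriangulation) (z : T.Tet → ℂ) where
  wt : T.Tet → Fin 4 → Fin 4 → ℂ
  symm : ∀ t i j, wt t i j = wt t j i
  ne_zero : ∀ t i j, i ≠ j → wt t i j ≠ 0
  shape : ∀ t, z t * (wt t 0 3 * wt t 1 2) = wt t 0 2 * wt t 1 3
  ptolemy : ∀ t, wt t 0 2 * wt t 1 3 = wt t 0 3 * wt t 1 2 + wt t 0 1 * wt t 2 3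
  wt_glue : ∀ t f i j, i ≠ f → j ≠ f → i ≠ j →
    wt (T.adj t f) (T.glue t f i) (T.glue t f j) = wt t i j

/-- All gluings preserve the cyclic order of labels. -/
def IsCyclic (T : IdealTriangulation) : Prop :=
  ∀ t f i j k, i ≠ f → j ≠ f → k ≠ f → i ≠ j → j ≠ k → k ≠ i →
    cyclicSign (T.glue t f i) (T.glue t f j) (T.glue t f k) = cyclicSign i j k

theorem EdgeWeights.shape_ne {T : IdealTriangulation} {z : T.Tet → ℂ} (W : EdgeWeights T z)
    (t : T.Tet) : z t ≠ 0 ∧ z t ≠ 1 := by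
  have h := W.shape t
  constructor
  · intro h0
    rw [h0, zero_mul] at h
    exact mul_ne_zero (W.ne_zero t 0 2 (by decide)) (W.ne_zero t 1 3 (by decide)) h.symm
  · intro h1
    rw [h1, one_mul, W.ptolemy] at h
    exact mul_ne_zero (W.ne_zero t 0 1 (by decide)) (W.ne_zero t 2 3 (by decide))
      (left_eq_add.1 h)

/-- The cusp cross-section defined by edge weights. -/
noncomputable def EdgeWeights.cuspSides {T : IdealTriangulation} {z : T.Tet → ℂ}
    (W : EdgeWeights T z) (hT : T.IsCyclic) : CuspSides T z where
  side x := weightSide (W.wt x.1) x.2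
  ne_zero x := weightSide_ne_zero (W.ne_zero x.1) x.2
  turn x := weightSide_turn (W.symm x.1) (W.ne_zero x.1) (W.shape x.1) (W.ptolemy x.1) x.2
  reverse x := weightSide_reverse (W.symm x.1) x.2
  -- The side uses only the weights on the crossed face and the cyclic sign of its vertices; gluings
  -- preserve both.
  cross x := by
    obtain ⟨t, p⟩ := x
    simp only [weightSide, IdealTriangulation.cross, Perm.mul_apply]
    rw [hT, W.wt_glue, W.wt_glue, W.wt_glue] <;> simp

theorem EdgeWeights.isSolution {T : IdealTriangulation} {z : T.Tet → ℂ} (W : EdgeWeights T z)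
    (hT : T.IsCyclic) (hz : ∀ t, 0 ≤ (z t).im)
    (hflat : ∀ t f, (z t).im = 0 → 0 < (z (T.adj t f)).im)
    {ι : Type} [Fintype ι] (E : EdgeLabelling T ι) : T.IsSolution z :=
  isSolution_of_cuspSides (fun t => ⟨(W.shape_ne t).1, (W.shape_ne t).2, hz t⟩) hflat
    (W.cuspSides hT) E

end IdealTriangulation

/-! ### Labels of edges -/

namespace IdealTriangulation

/-- Names and directions for the edges of all tetrahedra, respected by the gluings. -/
structure DirectedLabelling (T : IdealTriangulation) (ε : Type) where
  name : T.Tet → Fin 4 → Fin 4 → ε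
  dir : T.Tet → Fin 4 → Fin 4 → Bool
  name_symm : ∀ t i j, name t i j = name t j i
  dir_swap : ∀ t i j, i ≠ j → dir t j i = !dir t i j
  glue : ∀ t f i j, i ≠ f → j ≠ f → i ≠ j →
    name (T.adj t f) (T.glue t f i) (T.glue t f j) = name t i j ∧
      dir (T.adj t f) (T.glue t f i) (T.glue t f j) = dir t i j

namespace DirectedLabelling

variable {T : IdealTriangulation} {ε : Type} (D : T.DirectedLabelling ε)

/-- The labelling of oriented edges defined by names and directions. -/
def edgeLabelling [Fintype ε] (hs : ∀ e, ∃ t i j, i ≠ j ∧ D.name t i j = e)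
    (hc : Fintype.card ε = Fintype.card T.Tet) : EdgeLabelling T (ε × Bool) where
  lab t i j := (D.name t i j, D.dir t i j)
  lab_glue t f i j hi hj hij :=
    Prod.ext (D.glue t f i j hi hj hij).1 (D.glue t f i j hi hj hij).2
  surj := by
    rintro ⟨e, b⟩
    obtain ⟨t, i, j, hij, rfl⟩ := hs e
    by_cases h : D.dir t i j = b
    · exact ⟨t, i, j, hij, by rw [h]⟩
    · refine ⟨t, j, i, hij.symm, Prod.ext (D.name_symm t j i) ?_⟩
      change D.dir t j i = b
      rw [D.dir_swap t i j hij]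
      cases b <;> simpa using h
  card_eq := by rw [Fintype.card_prod, Fintype.card_bool, hc, mul_comm]

/-- Edge weights that only depend on the names of edges. -/
def edgeWeights {z : T.Tet → ℂ} (ω : ε → ℂ) (h0 : ∀ t i j, i ≠ j → ω (D.name t i j) ≠ 0)
    (hs : ∀ t, z t * (ω (D.name t 0 3) * ω (D.name t 1 2)) = ω (D.name t 0 2) * ω (D.name t 1 3))
    (hp : ∀ t, ω (D.name t 0 2) * ω (D.name t 1 3) =
      ω (D.name t 0 3) * ω (D.name t 1 2) + ω (D.name t 0 1) * ω (D.name t 2 3)) :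
    EdgeWeights T z where
  wt t i j := ω (D.name t i j)
  symm t i j := by rw [D.name_symm]
  ne_zero := h0
  shape := hs
  ptolemy := hp
  wt_glue t f i j hi hj hij := by rw [(D.glue t f i j hi hj hij).1]

end DirectedLabelling

end IdealTriangulation

/-- The names of the edges of three consecutive layers inside a fan. -/
def fanName : Fin 3 → Fin 4 → Fin 4 → Fin 8 :=
  ![![![0, 2, 1, 0], ![2, 0, 0, 4], ![1, 0, 0, 2], ![0, 4, 2, 0]],
    ![![0, 1, 3, 0], ![1, 0, 0, 2], ![3, 0, 0, 1], ![0, 2, 1, 0]],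
    ![![0, 3, 5, 0], ![3, 0, 0, 1], ![5, 0, 0, 3], ![0, 1, 3, 0]]]

/-- The directions of the edges of three consecutive layers inside a fan. -/
def fanDir : Fin 3 → Fin 4 → Fin 4 → Bool :=
  ![![![true, true, true, true], ![false, true, true, false], ![false, false, true, false], ![false, true, true, true]],
    ![![true, true, true, true], ![false, true, true, false], ![false, false, true, false], ![false, true, true, true]],
    ![![true, true, true, true], ![false, true, true, false], ![false, false, true, false], ![false, true, true, true]]]

/-- The layer at each port of the fan. -/
def fanBase : Fin 4 → Fin 3 := ![0, 2, 0, 2]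

/-- Names and directions of the edges of a patch that agree at the ports with those of the three
layers of a fan, for a patch whose gluings preserve the cyclic order of labels. -/
structure EdgeTable {m : ℕ} (P : Patch m) where
  name : Fin m → Fin 4 → Fin 4 → Fin 8
  dir : Fin m → Fin 4 → Fin 4 → Bool
  name_symm : ∀ c i j, name c i j = name c j i
  dir_swap : ∀ c i j, i ≠ j → dir c j i = !dir c i j
  inner : ∀ c f c', P.adj c f = .inl c' → ∀ i j, i ≠ f → j ≠ f → i ≠ j →
    name c' (P.glue c f i) (P.glue c f j) = name c i j ∧
      dir c' (P.glue c f i) (P.glue c f j) = dir c i j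
  port : ∀ g i j, P.portPerm g i ≠ g → P.portPerm g j ≠ g → i ≠ j →
    name (P.portTet g) i j = fanName (fanBase g) (P.portPerm g i) (P.portPerm g j) ∧
      dir (P.portTet g) i j = fanDir (fanBase g) (P.portPerm g i) (P.portPerm g j)
  cyclic_inner : ∀ c f c', P.adj c f = .inl c' →
    ∀ i j k, i ≠ f → j ≠ f → k ≠ f → i ≠ j → j ≠ k → k ≠ i →
      cyclicSign (P.glue c f i) (P.glue c f j) (P.glue c f k) = cyclicSign i j k
  cyclic_port : ∀ g i j k, P.portPerm g i ≠ g → P.portPerm g j ≠ g → P.portPerm g k ≠ g →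
    i ≠ j → j ≠ k → k ≠ i →
      cyclicSign (P.portPerm g i) (P.portPerm g j) (P.portPerm g k) = cyclicSign i j k

theorem perm_apply_inv (p : Perm (Fin 4)) (i : Fin 4) : p (p⁻¹ i) = i := p.apply_symm_apply i

namespace Site

variable {T : IdealTriangulation} (X : Site T) {m : ℕ} {P : Patch m}

theorem graft_isCyclic (E : EdgeTable P) (hT : T.IsCyclic) : (X.graft P).IsCyclic := by
  rintro (t | c) f i j k hi hj hk hij hjk hki
  · by_cases h : X.mem (T.adj t.1 f)
    · have hg : (X.graft P).glue (.inl t) f = (P.portPerm (T.glue t.1 f f))⁻¹ * T.glue t.1 f := by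
        simp [graft, h]
      have key := E.cyclic_port (T.glue t.1 f f)
        ((P.portPerm (T.glue t.1 f f))⁻¹ (T.glue t.1 f i))
        ((P.portPerm (T.glue t.1 f f))⁻¹ (T.glue t.1 f j))
        ((P.portPerm (T.glue t.1 f f))⁻¹ (T.glue t.1 f k))
      simp only [perm_apply_inv, ne_eq, EmbeddingLike.apply_eq_iff_eq] at key
      rw [hg]
      simp only [Perm.mul_apply]
      rw [← key hi hj hk hij hjk hki, hT _ _ _ _ _ hi hj hk hij hjk hki]
    · have hg : (X.graft P).glue (.inl t) f = T.glue t.1 f := by simp [graft, h]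
      rw [hg, hT _ _ _ _ _ hi hj hk hij hjk hki]
  · rcases h : P.adj c f with c' | g
    · have hg : (X.graft P).glue (.inr c) f = P.glue c f := by simp [graft, h]
      rw [hg, E.cyclic_inner c f c' h _ _ _ hi hj hk hij hjk hki]
    · obtain ⟨rfl, h1⟩ := P.port_unique c f g h
      have hg : (X.graft P).glue (.inr (P.portTet g)) f = T.glue (X.base g) g * P.portPerm g := by
        simp [graft, h]
      have hne : ∀ l, l ≠ f → P.portPerm g l ≠ g := fun l hl h' => hl (h1 ▸ Perm.eq_inv_iff_eq.2 h')
      rw [hg]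
      simp only [Perm.mul_apply]
      rw [hT _ _ _ _ _ (hne i hi) (hne j hj) (hne k hk) (by simpa) (by simpa) (by simpa),
        E.cyclic_port _ _ _ _ (hne i hi) (hne j hj) (hne k hk) hij hjk hki]

/-- The labelling of a graft that is given outside by the labelling `D` and on the patch by a
table whose entries are interpreted by `emb`. -/
def graftLabelling {ε κ : Type} (E : EdgeTable P) (D : T.DirectedLabelling ε) (r : ε → κ) (emb : Fin 8 → κ)
    (hn : ∀ g i j, i ≠ g → j ≠ g → i ≠ j →
      r (D.name (X.base g) i j) = emb (fanName (fanBase g) i j))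
    (hd : ∀ g i j, i ≠ j → D.dir (X.base g) i j = fanDir (fanBase g) i j) :
    (X.graft P).DirectedLabelling κ where
  name := Sum.elim (fun t i j => r (D.name t.1 i j)) fun c i j => emb (E.name c i j)
  dir := Sum.elim (fun t i j => D.dir t.1 i j) E.dir
  name_symm := by
    rintro (t | c) i j
    · exact congrArg r (D.name_symm _ _ _)
    · exact congrArg emb (E.name_symm _ _ _)
  dir_swap := by
    rintro (t | c) i j hij
    · exact D.dir_swap _ _ _ hij
    · exact E.dir_swap _ _ _ hij
  glue := by
    rintro (t | c) f i j hi hj hij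
    · by_cases h : X.mem (T.adj t.1 f)
      · have hg : (X.graft P).glue (.inl t) f =
            (P.portPerm (T.glue t.1 f f))⁻¹ * T.glue t.1 f := by simp [graft, h]
        have ha : (X.graft P).adj (.inl t) f = .inr (P.portTet (T.glue t.1 f f)) := by
          simp [graft, h]
        have hb := X.eq_base t.1 f t.2 h
        have key := E.port (T.glue t.1 f f)
          ((P.portPerm (T.glue t.1 f f))⁻¹ (T.glue t.1 f i))
          ((P.portPerm (T.glue t.1 f f))⁻¹ (T.glue t.1 f j))
        simp only [perm_apply_inv, ne_eq, EmbeddingLike.apply_eq_iff_eq] at key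
        obtain ⟨k1, k2⟩ := key hi hj hij
        obtain ⟨d1, d2⟩ := D.glue t.1 f i j hi hj hij
        rw [hg, ha]
        simp only [Perm.mul_apply, Sum.elim_inl, Sum.elim_inr]
        rw [k1, k2, ← hn, ← hd, ← hb, d1, d2] <;> simp [hi, hj, hij]
      · have hg : (X.graft P).glue (.inl t) f = T.glue t.1 f := by simp [graft, h]
        have ha : (X.graft P).adj (.inl t) f = .inl ⟨T.adj t.1 f, h⟩ := by simp [graft, h]
        obtain ⟨d1, d2⟩ := D.glue t.1 f i j hi hj hij
        rw [hg, ha]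
        simp only [Sum.elim_inl]
        rw [d1, d2]
        simp
    · rcases h : P.adj c f with c' | g
      · have hg : (X.graft P).glue (.inr c) f = P.glue c f := by simp [graft, h]
        have ha : (X.graft P).adj (.inr c) f = .inr c' := by simp [graft, h]
        obtain ⟨d1, d2⟩ := E.inner c f c' h i j hi hj hij
        rw [hg, ha]
        simp only [Sum.elim_inr]
        rw [d1, d2]
        simp
      · obtain ⟨rfl, h1⟩ := P.port_unique c f g h
        have hg : (X.graft P).glue (.inr (P.portTet g)) f =
          T.glue (X.base g) g * P.portPerm g := by simp [graft, h]
        have ha : (X.graft P).adj (.inr (P.portTet g)) f =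
          .inl ⟨T.adj (X.base g) g, X.not_mem g⟩ := by simp [graft, h]
        have hne : ∀ l, l ≠ f → P.portPerm g l ≠ g := fun l hl h' => hl (h1 ▸ Perm.eq_inv_iff_eq.2 h')
        have hij' : P.portPerm g i ≠ P.portPerm g j := by simpa
        obtain ⟨d1, d2⟩ := D.glue (X.base g) g _ _ (hne i hi) (hne j hj) hij'
        obtain ⟨e1, e2⟩ := E.port g i j (hne i hi) (hne j hj) hij
        rw [hg, ha]
        simp only [Perm.mul_apply, Sum.elim_inl, Sum.elim_inr]
        rw [d1, d2, e1, e2, hn _ _ _ (hne i hi) (hne j hj) hij', hd _ _ _ hij']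
        simp

end Site

/-- Names of edges in `firstPatch`. -/
def firstTable : EdgeTable firstPatch where
  name := ![![![0, 1, 3, 6], ![1, 0, 0, 4], ![3, 0, 0, 2], ![6, 4, 2, 0]],
    ![![0, 0, 1, 0], ![0, 0, 3, 6], ![1, 3, 0, 2], ![0, 6, 2, 0]],
    ![![0, 0, 6, 4], ![0, 0, 0, 2], ![6, 0, 0, 1], ![4, 2, 1, 0]],
    ![![0, 3, 5, 0], ![3, 0, 0, 1], ![5, 0, 0, 3], ![0, 1, 3, 0]]]
  dir := ![![![true, false, true, true], ![true, true, true, false], ![false, false, true, false], ![false, true, true, true]],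
    ![![true, false, false, true], ![true, true, true, true], ![true, false, true, false], ![false, false, true, true]],
    ![![true, false, false, true], ![true, true, false, true], ![true, true, true, false], ![false, false, true, true]],
    ![![true, true, true, true], ![false, true, true, true], ![false, false, true, false], ![false, false, true, true]]]
  name_symm := by decide
  dir_swap := by decide
  inner := by decide
  port := by decide
  cyclic_inner := by decide
  cyclic_port := by decide

/-- Names of edges in `secondPatch`. -/
def secondTable : EdgeTable secondPatch where
  name := ![![![0, 3, 5, 7], ![3, 0, 0, 4], ![5, 0, 0, 2], ![7, 4, 2, 0]],
    ![![0, 0, 3, 6], ![0, 0, 5, 7], ![3, 5, 0, 2], ![6, 7, 2, 0]],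
    ![![0, 6, 7, 4], ![6, 0, 0, 1], ![7, 0, 0, 3], ![4, 1, 3, 0]],
    ![![0, 0, 1, 0], ![0, 0, 3, 6], ![1, 3, 0, 2], ![0, 6, 2, 0]],
    ![![0, 0, 6, 4], ![0, 0, 0, 2], ![6, 0, 0, 1], ![4, 2, 1, 0]]]
  dir := ![![![true, true, true, true], ![false, true, true, false], ![false, false, true, false], ![false, true, true, true]],
    ![![true, false, true, true], ![true, true, true, true], ![false, false, true, false], ![false, false, true, true]],
    ![![true, false, false, true], ![true, true, false, true], ![true, true, true, true], ![false, false, false, true]],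
    ![![true, false, true, true], ![true, true, true, true], ![false, false, true, false], ![false, false, true, true]],
    ![![true, false, false, true], ![true, true, false, true], ![true, true, true, true], ![false, false, false, true]]]
  name_symm := by decide
  dir_swap := by decide
  inner := by decide
  port := by decide
  cyclic_inner := by decide
  cyclic_port := by decide

/-- Names of edges in `thirdPatch`. -/
def thirdTable : EdgeTable thirdPatch where
  name := ![![![0, 3, 5, 7], ![3, 0, 0, 4], ![5, 0, 0, 2], ![7, 4, 2, 0]],
    ![![0, 0, 3, 6], ![0, 0, 5, 7], ![3, 5, 0, 2], ![6, 7, 2, 0]],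
    ![![0, 0, 7, 4], ![0, 0, 6, 2], ![7, 6, 0, 3], ![4, 2, 3, 0]],
    ![![0, 0, 6, 7], ![0, 0, 0, 6], ![6, 0, 0, 0], ![7, 6, 0, 0]]]
  dir := ![![![true, true, true, false], ![false, true, true, false], ![false, false, true, false], ![true, true, true, true]],
    ![![true, false, true, false], ![true, true, true, false], ![false, false, true, false], ![true, true, true, true]],
    ![![true, false, true, true], ![true, true, true, true], ![false, false, true, true], ![false, false, false, true]],
    ![![true, false, true, true], ![true, true, false, true], ![false, true, true, false], ![false, false, true, true]]]
  name_symm := by decide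
  dir_swap := by decide
  inner := by decide
  port := by decide
  cyclic_inner := by decide
  cyclic_port := by decide

/-! ### The monodromy triangulation -/

theorem val_finRotate {n : ℕ} (k : Fin n) :
    (finRotate n k).val = if k.val + 1 < n then k.val + 1 else 0 := by
  obtain _ | n := n
  · exact k.elim0
  · rw [finRotate_apply, Fin.val_add_one]
    have := k.2
    split_ifs with h h' h' <;> simp only [Fin.ext_iff, Fin.val_last] at * <;> omega

theorem val_finRotate_symm {n : ℕ} (k : Fin n) :
    ((finRotate n).symm k).val = if k.val = 0 then n - 1 else k.val - 1 := by
  obtain ⟨j, rfl⟩ := (finRotate n).surjective k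
  rw [Equiv.symm_apply_apply, val_finRotate]
  have := j.2
  by_cases h : j.val + 1 < n
  · simp [h]
  · simp only [h, if_false, if_true]
    omega

/-- The edge of a layer with the given vertices, for the name `A` of the edges `01`, `23`, the name
`B` of `12`, `03`, the name `D` of `02` and the name `E` of `13`. -/
def layerName {ε : Type} (A B D E : ε) (i j : Fin 4) : ε :=
  match i, j with
  | 0, 1 | 1, 0 | 2, 3 | 3, 2 => A
  | 0, 2 | 2, 0 => D
  | 1, 3 | 3, 1 => E
  | _, _ => B

/-- The direction of the edge of a layer with the given vertices; `s` tells whether the edge `13`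
is directed from `3` to `1`. -/
def layerDir (s : Bool) (i j : Fin 4) : Bool :=
  match i, j with
  | 1, 0 | 2, 3 | 2, 1 | 3, 0 | 2, 0 => false
  | 3, 1 => s
  | 1, 3 => !s
  | _, _ => true

/-- Names of the edges of the layers, for a layering with the letters `w`. -/
structure LayerNames {n : ℕ} (w : Fin n → Letter) (ε : Type) where
  A : Fin n → ε
  B : Fin n → ε
  D : Fin n → ε
  E : Fin n → ε
  s : Fin n → Bool
  next_L : ∀ k, w k = .L → A (finRotate n k) = D k ∧ B (finRotate n k) = B k ∧
    E (finRotate n k) = A k ∧ s (finRotate n k) = true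
  next_R : ∀ k, w k = .R → A (finRotate n k) = A k ∧ B (finRotate n k) = D k ∧
    E (finRotate n k) = B k ∧ s (finRotate n k) = false

/-- Faces 0 and 2 are glued to the preceding layer; writing a layer as a successor there replaces
the inverse rotation by the letter below. -/
theorem forall_face_monodromy {n : ℕ} {Q : Fin n → Fin 4 → Prop}
    (h3 : ∀ k, Q k 3) (h1 : ∀ k, Q k 1) (h2 : ∀ k, Q (finRotate n k) 2)
    (h0 : ∀ k, Q (finRotate n k) 0) (k : Fin n) (f : Fin 4) : Q k f := by
  obtain ⟨j, hj⟩ := (finRotate n).surjective k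
  fin_cases f
  · exact hj ▸ h0 j
  · exact h1 k
  · exact hj ▸ h2 j
  · exact h3 k

/-- The labelling of edges defined by names. -/
def LayerNames.labelling {n : ℕ} {w : Fin n → Letter} {ε : Type} (N : LayerNames w ε) :
    (monodromyTriangulation w).DirectedLabelling ε where
  name k := layerName (N.A k) (N.B k) (N.D k) (N.E k)
  dir k := layerDir (N.s k)
  name_symm k i j := by fin_cases i <;> fin_cases j <;> rfl
  dir_swap k i j hij := by
    generalize N.s k = s
    revert s i j
    decide
  glue := by
    intro k f
    refine forall_face_monodromy (Q := fun k f => ∀ i j, i ≠ f → j ≠ f → i ≠ j →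
      layerName (N.A ((monodromyTriangulation w).adj k f)) (N.B ((monodromyTriangulation w).adj k f))
        (N.D ((monodromyTriangulation w).adj k f)) (N.E ((monodromyTriangulation w).adj k f))
        ((monodromyTriangulation w).glue k f i) ((monodromyTriangulation w).glue k f j) =
        layerName (N.A k) (N.B k) (N.D k) (N.E k) i j ∧
      layerDir (N.s ((monodromyTriangulation w).adj k f))
        ((monodromyTriangulation w).glue k f i) ((monodromyTriangulation w).glue k f j) =
        layerDir (N.s k) i j) ?_ ?_ ?_ ?_ k f
    all_goals
      intro k i j
      simp only [monodromyTriangulation, Equiv.symm_apply_apply]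
      have hL := N.next_L k
      have hR := N.next_R k
      generalize N.A (finRotate n k) = a at *
      generalize N.B (finRotate n k) = b at *
      generalize N.D (finRotate n k) = d at *
      generalize N.E (finRotate n k) = e at *
      generalize N.s (finRotate n k) = s at *
      cases hw : w k
      · obtain ⟨rfl, rfl, rfl, rfl⟩ := hL hw
        fin_cases i <;> fin_cases j <;> intro hi hj hij <;>
          first
          | exact absurd rfl hi
          | exact absurd rfl hj
          | exact absurd rfl hij
          | exact ⟨rfl, rfl⟩
      · obtain ⟨rfl, rfl, rfl, rfl⟩ := hR hw
        fin_cases i <;> fin_cases j <;> intro hi hj hij <;>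
          first
          | exact absurd rfl hi
          | exact absurd rfl hj
          | exact absurd rfl hij
          | exact ⟨rfl, rfl⟩

theorem isCyclic_monodromyTriangulation {n : ℕ} (w : Fin n → Letter) :
    (monodromyTriangulation w).IsCyclic := by
  intro k f
  refine forall_face_monodromy (Q := fun k f => ∀ i j l, i ≠ f → j ≠ f → l ≠ f →
    i ≠ j → j ≠ l → l ≠ i → cyclicSign ((monodromyTriangulation w).glue k f i)
      ((monodromyTriangulation w).glue k f j) ((monodromyTriangulation w).glue k f l) =
        cyclicSign i j l) ?_ ?_ ?_ ?_ k f
  all_goals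
    intro k i j l
    simp only [monodromyTriangulation, Equiv.symm_apply_apply]
    generalize w k = c
    revert i j l
    cases c <;> decide

/-! ### Two fans -/

/-- The name of the edge `01` of the layer `k`, for the word `L ^ p R ^ q`. -/
def fanA (p k : ℕ) : ℕ := if 1 ≤ k ∧ k ≤ p then k - 1 else p - 1

/-- The name of the edge `12` of the layer `k`, for the word `L ^ p R ^ q`. -/
def fanB (p q k : ℕ) : ℕ := if p < k then k - 1 else p + q - 1

/-- The name of the edge `13` of the layer `k`, for the word `L ^ p R ^ q`. -/
def fanE (p q k : ℕ) : ℕ :=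
  if k = 0 then fanB p q (p + q - 1) else if k ≤ p then fanA p (k - 1) else fanB p q (k - 1)

theorem fanA_lt {p k : ℕ} (hp : 0 < p) : fanA p k < p := by
  unfold fanA; split_ifs <;> omega

theorem fanB_lt {p q k : ℕ} (hk : k < p + q) : fanB p q k < p + q := by
  unfold fanB; split_ifs <;> omega

theorem fanE_lt {p q k : ℕ} (hp : 0 < p) (hk : k < p + q) : fanE p q k < p + q := by
  unfold fanE
  split_ifs
  · exact fanB_lt (by omega)
  · exact (fanA_lt hp).trans_le (by omega)
  · exact fanB_lt (by omega)

/-- The names of the edges for the word `L ^ p R ^ q`: the upper edge of each layer is named like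
the layer. -/
def fanNames (p q : ℕ) (hp : 0 < p) (hq : 0 < q) : LayerNames (wordLR p q) (Fin (p + q)) where
  A k := ⟨fanA p k, (fanA_lt hp).trans_le (by omega)⟩
  B k := ⟨fanB p q k, fanB_lt k.2⟩
  D k := k
  E k := ⟨fanE p q k, fanE_lt hp k.2⟩
  s k := decide (1 ≤ k.val ∧ k.val ≤ p)
  next_L k hk := by
    have h : k.val < p := by
      by_contra h
      simp [wordLR, h] at hk
    have e : (finRotate (p + q) k).val = k.val + 1 := by rw [val_finRotate, if_pos (by omega)]
    have h1 : k.val + 1 ≤ p := h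
    have h2 : ¬ p < k.val + 1 := by omega
    have h3 : ¬ p < k.val := by omega
    simp only [Fin.ext_iff, e, fanA, fanB, fanE]
    simp [h1, h2, h3]
  next_R k hk := by
    have h : ¬ k.val < p := by
      intro h
      simp [wordLR, h] at hk
    have hk := k.2
    by_cases hl : k.val + 1 < p + q
    · have e : (finRotate (p + q) k).val = k.val + 1 := by rw [val_finRotate, if_pos hl]
      simp only [Fin.ext_iff, e, decide_eq_false_iff_not, fanE, fanA, Nat.add_sub_cancel]
      refine ⟨?_, ?_, ?_, by omega⟩
      · split_ifs <;> omega
      · unfold fanB; split_ifs <;> omega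
      · rw [if_neg (by omega), if_neg (by omega)]
    -- The last letter leads back to the layer 0.
    · have e : (finRotate (p + q) k).val = 0 := by rw [val_finRotate, if_neg hl]
      have e' : k.val = p + q - 1 := by omega
      simp only [Fin.ext_iff, e, decide_eq_false_iff_not, fanE, fanA]
      refine ⟨?_, ?_, ?_, by omega⟩
      · split_ifs <;> omega
      · unfold fanB; split_ifs <;> omega
      · rw [if_pos trivial, e']

/-! ### The three layers in the middle of a fan -/

section Layers

variable {p q : ℕ}

theorem wordLR_eq_L {k : Fin (p + q)} (h : k.val < p) : wordLR p q k = .L := by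
  simp [wordLR, h]

theorem monodromyTriangulation_glue_three {k : Fin (p + q)} (h : k.val < p) :
    (monodromyTriangulation (wordLR p q)).glue k 3 = swap 0 3 := by
  change (wordLR p q k).perm012 = _
  rw [wordLR_eq_L h]
  rfl

theorem monodromyTriangulation_glue_one {k : Fin (p + q)} (h : k.val < p) :
    (monodromyTriangulation (wordLR p q)).glue k 1 = swap 1 2 := by
  change (wordLR p q k).perm023 = _
  rw [wordLR_eq_L h]
  rfl

theorem val_finRotate_symm_lt {k : Fin (p + q)} (h0 : 1 ≤ k.val) (h : k.val ≤ p) :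
    ((finRotate (p + q)).symm k).val < p := by
  rw [val_finRotate_symm, if_neg (by omega)]
  omega

theorem monodromyTriangulation_glue_two {k : Fin (p + q)} (h0 : 1 ≤ k.val) (h : k.val ≤ p) :
    (monodromyTriangulation (wordLR p q)).glue k 2 = swap 1 2 := by
  simp only [monodromyTriangulation, wordLR_eq_L (val_finRotate_symm_lt h0 h)]
  rfl

theorem monodromyTriangulation_glue_zero {k : Fin (p + q)} (h0 : 1 ≤ k.val) (h : k.val ≤ p) :
    (monodromyTriangulation (wordLR p q)).glue k 0 = swap 0 3 := by
  simp only [monodromyTriangulation, wordLR_eq_L (val_finRotate_symm_lt h0 h)]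
  rfl

end Layers

/-- The layer `M - 1 + c` of the word `L ^ (2 * M) R ^ (2 * N)`. -/
def middleLayer {M : ℕ} (N : ℕ) (hM : 1 < M) (c : Fin 3) : Fin (2 * M + 2 * N) :=
  ⟨M - 1 + c.val, by omega⟩

theorem finRotate_middleLayer {M N : ℕ} (hM : 1 < M) (k : Fin (2 * M + 2 * N)) (c : Fin 3) :
    finRotate _ k = middleLayer N hM c ↔ k.val + 1 = M - 1 + c.val := by
  have := k.2
  have := c.2
  rw [Fin.ext_iff, val_finRotate]
  simp only [middleLayer]
  split_ifs <;> omega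

theorem finRotate_symm_middleLayer {M N : ℕ} (hM : 1 < M) (hN : 0 < N) (k : Fin (2 * M + 2 * N))
    (c : Fin 3) : (finRotate _).symm k = middleLayer N hM c ↔ k.val = M + c.val := by
  have := k.2
  have := c.2
  rw [Fin.ext_iff, val_finRotate_symm]
  simp only [middleLayer]
  split_ifs <;> omega

/-- The three layers in the middle of the fan of `L ^ (2 * M)`. -/
def middleSite (M N : ℕ) (hM : 1 < M) (hN : 1 < N) :
    Site (monodromyTriangulation (wordLR (2 * M) (2 * N))) where
  mem := fun k : Fin (2 * M + 2 * N) => M ≤ k.val + 1 ∧ k.val ≤ M + 1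
  decMem := fun k : Fin (2 * M + 2 * N) =>
    inferInstanceAs (Decidable (M ≤ k.val + 1 ∧ k.val ≤ M + 1))
  base g := middleLayer N hM (fanBase g)
  base_mem g := by
    have := (fanBase g).2
    simp only [middleLayer]
    omega
  not_mem := by
    have h : ∀ k : Fin (2 * M + 2 * N), (finRotate _ k).val = if k.val + 1 < _ then _ else _ :=
      val_finRotate
    have h' : ∀ k : Fin (2 * M + 2 * N),
      ((finRotate _).symm k).val = if k.val = 0 then _ else _ := val_finRotate_symm
    intro g
    fin_cases g <;>
      simp only [monodromyTriangulation, fanBase, middleLayer, h, h'] <;> simp <;>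
        split_ifs <;> omega
  eq_base := by
    intro (k : Fin (2 * M + 2 * N)) f
    have h : (finRotate _ k).val = if k.val + 1 < _ then _ else _ := val_finRotate k
    have h' : ((finRotate _).symm k).val = if k.val = 0 then _ else _ := val_finRotate_symm k
    have hk := k.2
    -- The middle is entered from layer M - 2 through faces 1 and 3, reaching its lowest layer, and
    -- from layer M + 2 through faces 0 and 2, reaching its highest one.
    fin_cases f
    · change ¬ (M ≤ k.val + 1 ∧ k.val ≤ M + 1) → (M ≤ ((finRotate _).symm k).val + 1 ∧
        ((finRotate _).symm k).val ≤ M + 1) → _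
      intro h1 h2
      have h3 : k.val = M + 2 := by split_ifs at h' <;> omega
      change (finRotate _).symm k = middleLayer N hM (fanBase
        ((monodromyTriangulation (wordLR (2 * M) (2 * N))).glue k 0 0))
      rw [monodromyTriangulation_glue_zero (by omega) (by omega)]
      exact (finRotate_symm_middleLayer hM (by omega) k 2).2 h3
    · change ¬ (M ≤ k.val + 1 ∧ k.val ≤ M + 1) → (M ≤ (finRotate _ k).val + 1 ∧
        (finRotate _ k).val ≤ M + 1) → _
      intro h1 h2
      have h3 : k.val + 1 = M - 1 := by split_ifs at h <;> omega
      change finRotate _ k = middleLayer N hM (fanBase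
        ((monodromyTriangulation (wordLR (2 * M) (2 * N))).glue k 1 1))
      rw [monodromyTriangulation_glue_one (by omega)]
      exact (finRotate_middleLayer hM k 0).2 h3
    · change ¬ (M ≤ k.val + 1 ∧ k.val ≤ M + 1) → (M ≤ ((finRotate _).symm k).val + 1 ∧
        ((finRotate _).symm k).val ≤ M + 1) → _
      intro h1 h2
      have h3 : k.val = M + 2 := by split_ifs at h' <;> omega
      change (finRotate _).symm k = middleLayer N hM (fanBase
        ((monodromyTriangulation (wordLR (2 * M) (2 * N))).glue k 2 2))
      rw [monodromyTriangulation_glue_two (by omega) (by omega)]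
      exact (finRotate_symm_middleLayer hM (by omega) k 2).2 h3
    · change ¬ (M ≤ k.val + 1 ∧ k.val ≤ M + 1) → (M ≤ (finRotate _ k).val + 1 ∧
        (finRotate _ k).val ≤ M + 1) → _
      intro h1 h2
      have h3 : k.val + 1 = M - 1 := by split_ifs at h <;> omega
      change finRotate _ k = middleLayer N hM (fanBase
        ((monodromyTriangulation (wordLR (2 * M) (2 * N))).glue k 3 3))
      rw [monodromyTriangulation_glue_three (by omega)]
      exact (finRotate_middleLayer hM k 0).2 h3

/-- The tetrahedra outside the middle together with the three middle layers. -/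
def middleEquiv (M N : ℕ) (hM : 1 < M) (hN : 1 < N) :
    (middleSite M N hM hN).Outer ⊕ Fin 3 ≃ Fin (2 * M + 2 * N) where
  toFun := Sum.elim (fun t => t.1) (middleLayer N hM)
  invFun k := if h : M ≤ k.val + 1 ∧ k.val ≤ M + 1 then .inr ⟨k.val - (M - 1), by omega⟩
    else .inl ⟨k, h⟩
  left_inv := by
    rintro (t | c)
    · exact dif_neg t.2
    · have h : M ≤ (middleLayer N hM c).val + 1 ∧ (middleLayer N hM c).val ≤ M + 1 := by
        simp only [middleLayer]
        omega
      refine (dif_pos h).trans (congrArg Sum.inr (Fin.ext ?_))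
      change M - 1 + c.val - (M - 1) = c.val
      omega
  right_inv k := by
    by_cases h : M ≤ k.val + 1 ∧ k.val ≤ M + 1
    · simp only [h, and_self, dite_true]
      refine Fin.ext ?_
      change M - 1 + (k.val - (M - 1)) = k.val
      omega
    · simp only [h, dite_false]
      rfl

/-- The monodromy triangulation is the result of grafting three layers in the middle of a fan. -/
def middleIso (M N : ℕ) (hM : 1 < M) (hN : 1 < N) :
    ((middleSite M N hM hN).graft fanPatch).LabelledIso
      (monodromyTriangulation (wordLR (2 * M) (2 * N))) where
  equiv := middleEquiv M N hM hN
  adj := by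
    rintro (t | c) f
    · by_cases h : (middleSite M N hM hN).mem
        ((monodromyTriangulation (wordLR (2 * M) (2 * N))).adj t.1 f)
      · have := (middleSite M N hM hN).eq_base t.1 f t.2 h
        have hg : ((middleSite M N hM hN).graft fanPatch).adj (.inl t) f =
          .inr (fanPatch.portTet _) := dif_pos h
        rw [hg]
        refine Eq.trans this ?_
        generalize (monodromyTriangulation (wordLR (2 * M) (2 * N))).glue t.1 f f = g
        fin_cases g <;> rfl
      · have hg : ((middleSite M N hM hN).graft fanPatch).adj (.inl t) f = .inl ⟨_, h⟩ :=
          dif_neg h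
        rw [hg]
        rfl
    · have h0 := (finRotate_middleLayer (N := N) hM (middleLayer N hM 0) 1).2
        (by simp [middleLayer])
      have h1 := (finRotate_middleLayer (N := N) hM (middleLayer N hM 1) 2).2
        (by simp [middleLayer])
      have h2 := (Equiv.eq_symm_apply _).2 h0
      have h3 := (Equiv.eq_symm_apply _).2 h1
      fin_cases c <;> fin_cases f <;> first | rfl | exact h0 | exact h1 | exact h2.symm | exact h3.symm
  glue := by
    rintro (t | c) f
    · by_cases h : (middleSite M N hM hN).mem
        ((monodromyTriangulation (wordLR (2 * M) (2 * N))).adj t.1 f)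
      · have : ∀ g, fanPatch.portPerm g = 1 := by decide
        have hg : ((middleSite M N hM hN).graft fanPatch).glue (.inl t) f =
          (fanPatch.portPerm _)⁻¹ * (monodromyTriangulation (wordLR (2 * M) (2 * N))).glue t.1 f :=
          if_pos h
        rw [hg, this, inv_one, one_mul]
        rfl
      · exact (if_neg h).symm
    · have h3 := monodromyTriangulation_glue_three (p := 2 * M) (q := 2 * N)
        (k := middleLayer N hM c) (by simp only [middleLayer]; omega)
      have h1 := monodromyTriangulation_glue_one (p := 2 * M) (q := 2 * N)
        (k := middleLayer N hM c) (by simp only [middleLayer]; omega)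
      have h2 := monodromyTriangulation_glue_two (p := 2 * M) (q := 2 * N)
        (k := middleLayer N hM c) (by simp only [middleLayer]; omega)
        (by simp only [middleLayer]; omega)
      have h0 := monodromyTriangulation_glue_zero (p := 2 * M) (q := 2 * N)
        (k := middleLayer N hM c) (by simp only [middleLayer]; omega)
        (by simp only [middleLayer]; omega)
      fin_cases c <;> fin_cases f <;>
        first | exact h0 | exact h1 | exact h2 | exact h3 | exact (mul_one _).symm

/-! ### The shapes of the layers -/

/-- The numbers that solve the exchange relations in a fan of length `2 * M`. -/
noncomputable def fanTrace (a : ℂ) (M k : ℕ) : ℂ :=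
  2 * Complex.I * (Complex.cos a / Complex.sin a) * Complex.cos ((k - M) * a)

/-- This is cos(x + a) cos(x - a) = cos² x - sin² a, multiplied by -4 cot² a. -/
theorem fanTrace_mul {a : ℂ} (ha : Complex.sin a ≠ 0) (M k : ℕ) :
    fanTrace a M (k + 2) * fanTrace a M k =
      fanTrace a M (k + 1) ^ 2 + (2 * Complex.cos a) ^ 2 := by
  have h1 : (((k + 2 : ℕ) : ℂ) - M) * a = (((k + 1 : ℕ) : ℂ) - M) * a + a := by push_cast; ring
  have h2 : ((k : ℂ) - M) * a = (((k + 1 : ℕ) : ℂ) - M) * a - a := by push_cast; ring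
  simp only [fanTrace]
  rw [h1, h2, Complex.cos_add, Complex.cos_sub]
  have h3 := Complex.sin_sq_add_cos_sq ((((k + 1 : ℕ) : ℂ) - M) * a)
  have h4 := Complex.sin_sq_add_cos_sq a
  generalize Complex.cos ((((k + 1 : ℕ) : ℂ) - M) * a) = c at *
  generalize Complex.sin ((((k + 1 : ℕ) : ℂ) - M) * a) = s at *
  field_simp
  have h5 := Complex.I_sq
  linear_combination (Complex.cos a ^ 2 * ((c * Complex.cos a - s * Complex.sin a) *
    (c * Complex.cos a + s * Complex.sin a) - c ^ 2)) * h5 +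
    Complex.cos a ^ 2 * (Complex.sin a ^ 2 * h3 - c ^ 2 * h4)

theorem fanTrace_symm (a : ℂ) {M k l : ℕ} (h : k + l = 2 * M) :
    fanTrace a M k = fanTrace a M l := by
  have h1 : ((k : ℂ) - M) * a = -(((l : ℂ) - M) * a) := by
    have : (k : ℂ) + l = 2 * M := by exact_mod_cast h
    linear_combination a * this
  rw [fanTrace, h1, Complex.cos_neg, fanTrace]

/-- The cosine is even, so only distances from the middle of the fan matter. -/
theorem exists_cos_sub {P : ℂ → Prop} (a : ℂ) {M : ℕ}
    (h : ∀ j : ℕ, j ≤ M → P (Complex.cos (j * a))) {k : ℕ} (hk : k ≤ 2 * M) :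
    P (Complex.cos ((k - M) * a)) := by
  rcases le_total M k with hMk | hMk
  · have := h (k - M) (by omega)
    rwa [Nat.cast_sub hMk] at this
  · have := h (M - k) (by omega)
    rw [Nat.cast_sub hMk, ← Complex.cos_neg] at this
    convert this using 2
    ring

/-- Angles that define a solution of the exchange relations in two fans, with the conditions that
make all shapes positive. -/
structure FanAngles (M N : ℕ) where
  α : ℂ
  β : ℂ
  cos_β : Complex.I * Complex.cos α * Complex.cos (M * α) = Complex.cos β * Complex.sin α
  cos_α : -(Complex.I * Complex.cos β * Complex.cos (N * β)) = Complex.cos α * Complex.sin β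
  sin_mul : Complex.cos α * Complex.sin (M * α) = Complex.cos β * Complex.sin (N * β)
  im_α : ∀ j : ℕ, j ≤ M → ((Complex.cos (j * α) / Complex.sin α) ^ 2).im < 0
  im_β : ∀ j : ℕ, j ≤ N → 0 < ((Complex.cos (j * β) / Complex.sin β) ^ 2).im
  norm_cos : 1 / 2 < ‖Complex.cos α ^ 2‖

namespace FanAngles

variable {M N : ℕ} (Θ : FanAngles M N)

/-- With division by zero giving zero, the strict inequality on the imaginary part already excludes
a vanishing sine; the cosines below are treated alike. -/
theorem sin_α_ne_zero : Complex.sin Θ.α ≠ 0 := fun h => by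
  simpa [h] using Θ.im_α 0 (Nat.zero_le _)

theorem sin_β_ne_zero : Complex.sin Θ.β ≠ 0 := fun h => by
  simpa [h] using Θ.im_β 0 (Nat.zero_le _)

theorem cos_mul_α_ne_zero {k : ℕ} (hk : k ≤ 2 * M) : Complex.cos ((k - M) * Θ.α) ≠ 0 :=
  exists_cos_sub (P := fun c => c ≠ 0) _ (fun j hj h => by simpa [h] using Θ.im_α j hj) hk

theorem cos_mul_β_ne_zero {k : ℕ} (hk : k ≤ 2 * N) : Complex.cos ((k - N) * Θ.β) ≠ 0 :=
  exists_cos_sub (P := fun c => c ≠ 0) _ (fun j hj h => by simpa [h] using Θ.im_β j hj) hk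

theorem cos_α_ne_zero (hM : 1 < M) : Complex.cos Θ.α ≠ 0 := fun h => by
  simpa [h] using Θ.im_α 1 hM.le

theorem cos_β_ne_zero (hN : 1 < N) : Complex.cos Θ.β ≠ 0 := fun h => by
  simpa [h] using Θ.im_β 1 hN.le

/-- The weights of the edges in the first fan. -/
noncomputable def y (k : ℕ) : ℂ := fanTrace Θ.α M k

/-- The weights of the edges in the second fan. -/
noncomputable def x (k : ℕ) : ℂ := -fanTrace Θ.β N k

theorem y_ne_zero (hM : 1 < M) {k : ℕ} (hk : k ≤ 2 * M) : Θ.y k ≠ 0 :=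
  mul_ne_zero (mul_ne_zero (by simp) (div_ne_zero (Θ.cos_α_ne_zero hM) Θ.sin_α_ne_zero))
    (Θ.cos_mul_α_ne_zero hk)

theorem x_ne_zero (hN : 1 < N) {k : ℕ} (hk : k ≤ 2 * N) : Θ.x k ≠ 0 :=
  neg_ne_zero.2 (mul_ne_zero (mul_ne_zero (by simp) (div_ne_zero (Θ.cos_β_ne_zero hN)
    Θ.sin_β_ne_zero)) (Θ.cos_mul_β_ne_zero hk))

theorem y_mul (k : ℕ) : Θ.y (k + 2) * Θ.y k = Θ.y (k + 1) ^ 2 + (2 * Complex.cos Θ.α) ^ 2 :=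
  fanTrace_mul Θ.sin_α_ne_zero M k

theorem x_mul (k : ℕ) : Θ.x (k + 2) * Θ.x k = Θ.x (k + 1) ^ 2 + (2 * Complex.cos Θ.β) ^ 2 := by
  simp only [x, neg_mul_neg, neg_sq]
  exact fanTrace_mul Θ.sin_β_ne_zero N k

theorem y_symm {k l : ℕ} (h : k + l = 2 * M) : Θ.y k = Θ.y l := fanTrace_symm _ h

theorem x_symm {k l : ℕ} (h : k + l = 2 * N) : Θ.x k = Θ.x l :=
  congrArg Neg.neg (fanTrace_symm _ h)

theorem y_last : Θ.y (2 * M) = 2 * Complex.cos Θ.β := by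
  have h : (((2 * M : ℕ) : ℂ) - M) * Θ.α = M * Θ.α := by push_cast; ring
  have h1 := Θ.sin_α_ne_zero
  rw [y, fanTrace, h]
  field_simp
  linear_combination Θ.cos_β

theorem x_last : Θ.x (2 * N) = 2 * Complex.cos Θ.α := by
  have h : (((2 * N : ℕ) : ℂ) - N) * Θ.β = N * Θ.β := by push_cast; ring
  have h1 := Θ.sin_β_ne_zero
  rw [x, fanTrace, h]
  field_simp
  linear_combination Θ.cos_α

/-- The weight following the last rung of the first fan is the first one of the second fan. After
expanding the cosines the two sides differ only in the terms compared by `sin_mul`. -/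
theorem x_one : Θ.x 1 = Θ.y (2 * M + 1) := by
  have h1 : (((2 * M + 1 : ℕ) : ℂ) - M) * Θ.α = M * Θ.α + Θ.α := by push_cast; ring
  have h2 : (((1 : ℕ) : ℂ) - N) * Θ.β = -(N * Θ.β) + Θ.β := by push_cast; ring
  have h3 := Θ.sin_α_ne_zero
  have h4 := Θ.sin_β_ne_zero
  rw [x, y, fanTrace, fanTrace, h1, h2, Complex.cos_add, Complex.cos_add, Complex.cos_neg,
    Complex.sin_neg]
  have e1 : 2 * Complex.I * (Complex.cos Θ.α / Complex.sin Θ.α) *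
      (Complex.cos (M * Θ.α) * Complex.cos Θ.α - Complex.sin (M * Θ.α) * Complex.sin Θ.α) =
      2 * Complex.cos Θ.β * Complex.cos Θ.α -
        2 * Complex.I * (Complex.cos Θ.α * Complex.sin (M * Θ.α)) := by
    field_simp
    linear_combination Complex.cos Θ.α * Θ.cos_β
  have e2 : -(2 * Complex.I * (Complex.cos Θ.β / Complex.sin Θ.β) *
      (Complex.cos (N * Θ.β) * Complex.cos Θ.β - -Complex.sin (N * Θ.β) * Complex.sin Θ.β)) =
      2 * Complex.cos Θ.β * Complex.cos Θ.α -
        2 * Complex.I * (Complex.cos Θ.β * Complex.sin (N * Θ.β)) := by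
    field_simp
    linear_combination Complex.cos Θ.β * Θ.cos_α
  rw [e1, e2, Θ.sin_mul]

/-- The weights of the edges, by the names of the edges. -/
noncomputable def weight (k : ℕ) : ℂ := if k < 2 * M then Θ.y (k + 1) else Θ.x (k - 2 * M + 1)

theorem weight_ne_zero (hM : 1 < M) (hN : 1 < N) {k : ℕ} (hk : k < 2 * M + 2 * N) :
    Θ.weight k ≠ 0 := by
  unfold weight
  split_ifs
  · exact Θ.y_ne_zero hM (by omega)
  · exact Θ.x_ne_zero hN (by omega)

theorem weight_fanA_of_le {k : ℕ} (h1 : 1 ≤ k) (h2 : k ≤ 2 * M) :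
    Θ.weight (fanA (2 * M) k) = Θ.y k := by
  rw [fanA, if_pos ⟨h1, h2⟩, weight, if_pos (by omega), Nat.sub_add_cancel h1]

theorem weight_fanA_of_not (hM : 1 < M) {k : ℕ} (h : ¬ (1 ≤ k ∧ k ≤ 2 * M)) :
    Θ.weight (fanA (2 * M) k) = 2 * Complex.cos Θ.β := by
  rw [fanA, if_neg h, weight, if_pos (by omega), Nat.sub_add_cancel (by omega), y_last]

theorem weight_fanB_of_lt {k : ℕ} (h : 2 * M < k) :
    Θ.weight (fanB (2 * M) (2 * N) k) = Θ.x (k - 2 * M) := by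
  rw [fanB, if_pos h, weight, if_neg (by omega)]
  congr 1
  omega

theorem weight_fanB_of_le (hN : 1 < N) {k : ℕ} (h : k ≤ 2 * M) :
    Θ.weight (fanB (2 * M) (2 * N) k) = 2 * Complex.cos Θ.α := by
  rw [fanB, if_neg (by omega), weight, if_neg (by omega), ← x_last]
  congr 1
  omega

theorem weight_fanE_of_le (hM : 1 < M) {k : ℕ} (h1 : 1 ≤ k) (h2 : k ≤ 2 * M) :
    Θ.weight (fanE (2 * M) (2 * N) k) = Θ.y (k - 1) := by
  rw [fanE, if_neg (by omega), if_pos h2]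
  -- For `k = 1` the edge 13 already occurs before the fan; its weight is the value at the far end,
  -- equal to `y 0` by symmetry.
  by_cases h : k = 1
  · subst h
    rw [weight_fanA_of_not _ hM (by omega), ← y_last]
    exact Θ.y_symm (by omega)
  · exact Θ.weight_fanA_of_le (by omega) (by omega)

theorem weight_fanE_of_lt (hN : 1 < N) {k : ℕ} (h : 2 * M < k) :
    Θ.weight (fanE (2 * M) (2 * N) k) = Θ.x (k - 1 - 2 * M) := by
  rw [fanE, if_neg (by omega), if_neg (by omega)]
  by_cases h' : k = 2 * M + 1
  · subst h'
    rw [weight_fanB_of_le _ hN (by omega), ← x_last]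
    exact Θ.x_symm (by omega)
  · exact Θ.weight_fanB_of_lt (by omega)

theorem weight_fanE_zero (hN : 1 < N) :
    Θ.weight (fanE (2 * M) (2 * N) 0) = Θ.x (2 * N - 1) := by
  rw [fanE, if_pos rfl, weight_fanB_of_lt _ (by omega)]
  congr 1
  omega

/-- Inside each fan this is the recursion of `fanTrace_mul`; at the two layers where the letter
changes it uses how the fans fit together. -/
theorem weight_mul_fanE (hM : 1 < M) (hN : 1 < N) {k : ℕ} (hk : k < 2 * M + 2 * N) :
    Θ.weight k * Θ.weight (fanE (2 * M) (2 * N) k) =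
      Θ.weight (fanB (2 * M) (2 * N) k) ^ 2 + Θ.weight (fanA (2 * M) k) ^ 2 := by
  -- Because of `x_one` the toggle after the first fan is one more step of its recursion; reflecting
  -- both fans turns this into the relation at layer 0.
  have hmid : Θ.x 1 * Θ.y (2 * M - 1) = (2 * Complex.cos Θ.α) ^ 2 + Θ.y (2 * M) ^ 2 := by
    have := Θ.y_mul (2 * M - 1)
    rw [show 2 * M - 1 + 2 = 2 * M + 1 by omega, show 2 * M - 1 + 1 = 2 * M by omega] at this
    rw [x_one, this, add_comm]
  by_cases h0 : k = 0
  · subst h0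
    rw [weight_fanE_zero _ hN, weight_fanB_of_le _ hN (by omega),
      weight_fanA_of_not _ hM (by omega), ← y_last, ← hmid, weight, if_pos (by omega),
      Θ.y_symm (show 0 + 1 + (2 * M - 1) = 2 * M by omega),
      Θ.x_symm (show 2 * N - 1 + 1 = 2 * N by omega), mul_comm]
  by_cases h1 : k < 2 * M
  · have := Θ.y_mul (k - 1)
    rw [show k - 1 + 2 = k + 1 by omega, show k - 1 + 1 = k by omega] at this
    rw [weight_fanE_of_le _ hM (by omega) h1.le, weight_fanB_of_le _ hN h1.le,
      weight_fanA_of_le _ (by omega) h1.le, weight, if_pos h1, this, add_comm]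
  by_cases h2 : k = 2 * M
  · subst h2
    rw [weight_fanE_of_le _ hM (by omega) le_rfl, weight_fanB_of_le _ hN le_rfl,
      weight_fanA_of_le _ (by omega) le_rfl, weight, if_neg (by omega), ← hmid, Nat.sub_self]
  · have := Θ.x_mul (k - 1 - 2 * M)
    rw [show k - 1 - 2 * M + 2 = k - 2 * M + 1 by omega,
      show k - 1 - 2 * M + 1 = k - 2 * M by omega] at this
    rw [weight_fanE_of_lt _ hN (by omega), weight_fanB_of_lt _ (by omega),
      weight_fanA_of_not _ hM (by omega), weight, if_neg (by omega), this]

/-- The shapes of the layers. -/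
noncomputable def shape (k : Fin (2 * M + 2 * N)) : ℂ :=
  1 + Θ.weight (fanA (2 * M) k) ^ 2 / Θ.weight (fanB (2 * M) (2 * N) k) ^ 2

theorem shape_of_le (hM : 1 < M) (hN : 1 < N) {k : Fin (2 * M + 2 * N)} (h : k.val ≤ 2 * M)
    (h0 : 1 ≤ k.val) :
    Θ.shape k = 1 - (Complex.cos ((k.val - M) * Θ.α) / Complex.sin Θ.α) ^ 2 := by
  have h1 := Θ.sin_α_ne_zero
  have h2 := Θ.cos_α_ne_zero hM
  rw [shape, weight_fanB_of_le _ hN h, weight_fanA_of_le _ h0 h, y, fanTrace]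
  field_simp
  linear_combination Complex.cos ((k.val - M) * Θ.α) ^ 2 * Complex.I_sq

/-- In the first fan, both toggle layers included, the shape is 1 - (cos/sin)², in the second one 1
- ((cos/sin)²)⁻¹. The inversion explains the opposite signs in `im_α` and `im_β`. -/
theorem shape_im_pos (hM : 1 < M) (hN : 1 < N) (k : Fin (2 * M + 2 * N)) :
    0 < (Θ.shape k).im := by
  have hY : ∀ j : ℕ, j ≤ 2 * M → 0 < (1 + Θ.y j ^ 2 / (2 * Complex.cos Θ.α) ^ 2).im := by
    intro j hj
    have h1 := Θ.sin_α_ne_zero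
    have h2 := Θ.cos_α_ne_zero hM
    have key := exists_cos_sub (P := fun c => ((c / Complex.sin Θ.α) ^ 2).im < 0) Θ.α Θ.im_α hj
    have e : Θ.y j ^ 2 / (2 * Complex.cos Θ.α) ^ 2 =
        -(Complex.cos ((j - M) * Θ.α) / Complex.sin Θ.α) ^ 2 := by
      rw [y, fanTrace]
      field_simp
      linear_combination Complex.cos ((j - M) * Θ.α) ^ 2 * Complex.I_sq
    rw [e]
    simpa using key
  have hX : ∀ j : ℕ, j ≤ 2 * N → 0 < (1 + (2 * Complex.cos Θ.β) ^ 2 / Θ.x j ^ 2).im := by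
    intro j hj
    have h1 := Θ.sin_β_ne_zero
    have h2 := Θ.cos_β_ne_zero hN
    have h3 := Θ.cos_mul_β_ne_zero hj
    have key := exists_cos_sub (P := fun c => 0 < ((c / Complex.sin Θ.β) ^ 2).im) Θ.β Θ.im_β hj
    have e : (2 * Complex.cos Θ.β) ^ 2 / Θ.x j ^ 2 =
        -((Complex.cos ((j - N) * Θ.β) / Complex.sin Θ.β) ^ 2)⁻¹ := by
      rw [x, fanTrace, neg_sq]
      have := Complex.I_ne_zero
      field_simp
      linear_combination Complex.I_sq
    rw [e, Complex.add_im, Complex.one_im, Complex.neg_im, Complex.inv_im, neg_div, neg_neg,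
      zero_add]
    exact div_pos key (Complex.normSq_pos.2 (pow_ne_zero _ (div_ne_zero h3 h1)))
  rw [shape]
  by_cases h0 : k.val = 0
  · rw [h0, weight_fanB_of_le _ hN (by omega), weight_fanA_of_not _ hM (by omega), ← y_last]
    exact hY _ le_rfl
  by_cases h1 : k.val ≤ 2 * M
  · rw [weight_fanB_of_le _ hN h1, weight_fanA_of_le _ (by omega) h1]
    exact hY _ h1
  · rw [weight_fanB_of_lt _ (by omega), weight_fanA_of_not _ hM (by omega)]
    exact hX _ (by omega)

end FanAngles

/-! ### Shapes in the patches -/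

/-- The weights of the edges in the middle of a fan, before and after the moves. -/
noncomputable def coreWeight (p r : ℂ) : Fin 8 → ℂ :=
  ![p, r, p * r / 2, p * r / 2, r * (p ^ 2 - 2) / 2, r * (p ^ 2 - 2) / 2, p ^ 2, p * (p ^ 2 - 1)]

/-- The shapes of three layers in the middle of a fan. -/
noncomputable def fanShape (v : ℂ) : Fin 3 → ℂ := ![2 - 1 / v, 1 - 1 / v, 2 - 1 / v]

/-- The shapes after the first move. -/
noncomputable def firstShape (v : ℂ) : Fin 4 → ℂ :=
  ![(2 * v - 1) / (2 * v), 2, (2 * v - 2) / (2 * v - 1), 2 - 1 / v]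

/-- The shapes after the second move. -/
noncomputable def secondShape (v : ℂ) : Fin 5 → ℂ :=
  ![(1 - 2 * v) ^ 2 / (v * (4 * v - 3)), (4 * v - 3) / (2 * (2 * v - 1)), (4 * v - 3) / (2 * v - 1), 2,
    (2 * v - 2) / (2 * v - 1)]

/-- The shapes after the third move. -/
noncomputable def thirdShape (v : ℂ) : Fin 4 → ℂ :=
  ![(1 - 2 * v) ^ 2 / (v * (4 * v - 3)), (4 * v - 3) / (2 * (2 * v - 1)), (4 * v - 3) / (2 * (2 * v - 1)),
    (4 * v - 4) / (4 * v - 3)]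

/-- The shapes `z` are cross-ratios of the edge weights in a patch. -/
def EdgeTable.IsShape {m : ℕ} {P : Patch m} (E : EdgeTable P) (ω : Fin 8 → ℂ) (z : Fin m → ℂ) :
    Prop :=
  ∀ c, z c * (ω (E.name c 0 3) * ω (E.name c 1 2)) = ω (E.name c 0 2) * ω (E.name c 1 3) ∧
    ω (E.name c 0 2) * ω (E.name c 1 3) =
      ω (E.name c 0 3) * ω (E.name c 1 2) + ω (E.name c 0 1) * ω (E.name c 2 3)

section Shapes

variable {p r v : ℂ}

theorem ne_of_im_pos (hv : 0 < v.im) (x : ℝ) : v ≠ x := by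
  rintro rfl
  simp at hv

/-- All these expressions vanish only at real numbers. -/
theorem denominators_ne_zero (hv : 0 < v.im) :
    v ≠ 0 ∧ v - 1 ≠ 0 ∧ 2 * v - 1 ≠ 0 ∧ 4 * v - 3 ≠ 0 := by
  refine ⟨?_, ?_, ?_, ?_⟩
  · simpa using ne_of_im_pos hv 0
  · simpa [sub_eq_zero] using ne_of_im_pos hv 1
  · intro h
    refine ne_of_im_pos hv (1 / 2) ?_
    push_cast
    linear_combination h / 2
  · intro h
    refine ne_of_im_pos hv (3 / 4) ?_
    push_cast
    linear_combination h / 4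

/-- The weight p² of the new edge is the one dictated by the Ptolemy relations. In the flat
tetrahedron the weights cancel to the cross-ratio 2, since the rungs next to the middle one both
weigh p r / 2. -/
theorem isShape_first (hv : 0 < v.im) (hp : p ^ 2 = 4 - 4 * v) (hr : r ^ 2 * v = -p ^ 2) :
    firstTable.IsShape (coreWeight p r) (firstShape v) := by
  obtain ⟨h0, h1, h2, h3⟩ := denominators_ne_zero hv
  have h4 : v * 2 - 1 ≠ 0 := by rwa [mul_comm]
  intro c
  fin_cases c <;> simp [firstTable, coreWeight, firstShape] <;> refine ⟨?_, ?_⟩ <;>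
    field_simp <;> grind

theorem isShape_second (hv : 0 < v.im) (hp : p ^ 2 = 4 - 4 * v) (hr : r ^ 2 * v = -p ^ 2) :
    secondTable.IsShape (coreWeight p r) (secondShape v) := by
  obtain ⟨h0, h1, h2, h3⟩ := denominators_ne_zero hv
  have h4 : v * 2 - 1 ≠ 0 := by rwa [mul_comm]
  intro c
  fin_cases c <;> simp [secondTable, coreWeight, secondShape] <;> refine ⟨?_, ?_⟩ <;>
    field_simp <;> grind

theorem isShape_third (hv : 0 < v.im) (hp : p ^ 2 = 4 - 4 * v) (hr : r ^ 2 * v = -p ^ 2) :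
    thirdTable.IsShape (coreWeight p r) (thirdShape v) := by
  obtain ⟨h0, h1, h2, h3⟩ := denominators_ne_zero hv
  have h4 : v * 2 - 1 ≠ 0 := by rwa [mul_comm]
  intro c
  fin_cases c <;> simp [thirdTable, coreWeight, thirdShape] <;> refine ⟨?_, ?_⟩ <;>
    field_simp <;> grind

end Shapes

section Positivity

variable {v : ℂ}

theorem im_moebius_pos (hv : 0 < v.im) {a b c d : ℝ} (h : 0 < a * d - b * c)
    (h0 : (c * v + d : ℂ) ≠ 0) : 0 < ((a * v + b) / (c * v + d) : ℂ).im := by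
  have e : ((a * v + b) / (c * v + d) : ℂ).im =
      (a * d - b * c) * v.im / Complex.normSq (c * v + d) := by
    rw [Complex.div_im]
    simp
    ring
  rw [e]
  exact div_pos (mul_pos h hv) (Complex.normSq_pos.2 h0)

/-- The only new shape that is not a Möbius image of v. It equals 1 plus the inverse of 1/(1 - v) -
5 + 4(1 - v), whose imaginary part is Im v (1/|1 - v|² - 4); its sign changes exactly at |1 - v| =
1/2. -/
theorem im_ratio_pos (hv : 0 < v.im) (h1 : 1 / 2 < ‖1 - v‖) :
    0 < ((1 - 2 * v) ^ 2 / (v * (4 * v - 3))).im := by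
  obtain ⟨n0, n1, -, n3⟩ := denominators_ne_zero hv
  have n4 : 1 - v ≠ 0 := by rwa [← neg_sub, neg_ne_zero] at n1
  have e : (1 - 2 * v) ^ 2 / (v * (4 * v - 3)) = 1 + (1 / (1 - v) - 5 + 4 * (1 - v))⁻¹ := by
    have : 1 / (1 - v) - 5 + 4 * (1 - v) = v * (4 * v - 3) / (1 - v) := by
      field_simp
      ring
    rw [this]
    have n5 : v * 4 - 3 ≠ 0 := by rwa [mul_comm]
    field_simp
    ring
  have hn : 1 / 4 < Complex.normSq (1 - v) := by
    rw [Complex.normSq_eq_norm_sq]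
    nlinarith
  have h2 : (1 / (1 - v) - 5 + 4 * (1 - v)).im < 0 := by
    have : (1 / (1 - v) - 5 + 4 * (1 - v)).im = v.im * (1 / Complex.normSq (1 - v) - 4) := by
      simp [Complex.inv_im]
      ring
    rw [this]
    refine mul_neg_of_pos_of_neg hv ?_
    rw [sub_neg, div_lt_iff₀ (by linarith)]
    linarith
  rw [e, Complex.add_im, Complex.one_im, zero_add, Complex.inv_im]
  exact div_pos (neg_pos.2 h2) (Complex.normSq_pos.2 fun h => by
    rw [h] at h2; exact lt_irrefl _ h2)

theorem firstShape_im (hv : 0 < v.im) (c : Fin 4) :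
    (c = 1 → (firstShape v c).im = 0) ∧ (c ≠ 1 → 0 < (firstShape v c).im) := by
  obtain ⟨n0, n1, n2, n3⟩ := denominators_ne_zero hv
  fin_cases c <;> simp [firstShape]
  · simpa [sub_eq_add_neg, n0] using im_moebius_pos hv (a := 2) (b := -1) (c := 2) (d := 0)
      (by norm_num)
  · simpa [sub_eq_add_neg] using im_moebius_pos hv (a := 2) (b := -2) (c := 2) (d := -1)
      (by norm_num) (by simpa [sub_eq_add_neg] using n2)
  · rw [neg_div, Left.neg_neg_iff]
    exact div_pos hv (Complex.normSq_pos.2 n0)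

theorem secondShape_im (hv : 0 < v.im) (h1 : 1 / 2 < ‖1 - v‖) (c : Fin 5) :
    (c = 3 → (secondShape v c).im = 0) ∧ (c ≠ 3 → 0 < (secondShape v c).im) := by
  obtain ⟨n0, n1, n2, n3⟩ := denominators_ne_zero hv
  fin_cases c <;> simp only [secondShape, Fin.zero_eta, Fin.mk_one, Fin.reduceFinMk,
    Matrix.cons_val, Matrix.cons_val_zero, Matrix.cons_val_one] <;> refine ⟨fun h => ?_, fun h => ?_⟩
  all_goals try exact absurd h (by decide)
  · exact im_ratio_pos hv h1
  · have := im_moebius_pos hv (a := 4) (b := -3) (c := 4) (d := -2) (by norm_num)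
    rw [show (2 * (2 * v - 1) : ℂ) = (4 : ℝ) * v + (-2 : ℝ) by push_cast; ring,
      show (4 * v - 3 : ℂ) = (4 : ℝ) * v + (-3 : ℝ) by push_cast; ring]
    refine this ?_
    rw [show ((4 : ℝ) * v + (-2 : ℝ) : ℂ) = 2 * (2 * v - 1) by push_cast; ring]
    exact mul_ne_zero two_ne_zero n2
  · simpa [sub_eq_add_neg] using im_moebius_pos hv (a := 4) (b := -3) (c := 2) (d := -1)
      (by norm_num) (by simpa [sub_eq_add_neg] using n2)
  · simp
  · simpa [sub_eq_add_neg] using im_moebius_pos hv (a := 2) (b := -2) (c := 2) (d := -1)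
      (by norm_num) (by simpa [sub_eq_add_neg] using n2)

theorem thirdShape_im_pos (hv : 0 < v.im) (h1 : 1 / 2 < ‖1 - v‖) (c : Fin 4) :
    0 < (thirdShape v c).im := by
  obtain ⟨n0, n1, n2, n3⟩ := denominators_ne_zero hv
  fin_cases c
  · exact (secondShape_im hv h1 0).2 (by decide)
  · exact (secondShape_im hv h1 1).2 (by decide)
  · exact (secondShape_im hv h1 1).2 (by decide)
  · simp only [thirdShape, Fin.reduceFinMk, Matrix.cons_val]
    simpa [sub_eq_add_neg] using im_moebius_pos hv (a := 4) (b := -4) (c := 4) (d := -3)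
      (by norm_num) (by simpa [sub_eq_add_neg] using n3)

end Positivity

/-! ### The geometric solution of the monodromy triangulation. -/

namespace IdealTriangulation

/-- Change of names. -/
def DirectedLabelling.map {T : IdealTriangulation} {ε κ : Type} (D : T.DirectedLabelling ε)
    (r : ε → κ) : T.DirectedLabelling κ where
  name t i j := r (D.name t i j)
  dir := D.dir
  name_symm t i j := congrArg r (D.name_symm t i j)
  dir_swap := D.dir_swap
  glue t f i j hi hj hij :=
    ⟨congrArg r (D.glue t f i j hi hj hij).1, (D.glue t f i j hi hj hij).2⟩

end IdealTriangulation

namespace FanAngles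

variable {M N : ℕ} (Θ : FanAngles M N)

/-- The edge weights of the monodromy triangulation. -/
noncomputable def edgeWeights (hM : 1 < M) (hN : 1 < N) :
    (monodromyTriangulation (wordLR (2 * M) (2 * N))).EdgeWeights Θ.shape :=
  (fanNames (2 * M) (2 * N) (by omega) (by omega)).labelling.edgeWeights
    (fun e : Fin (2 * M + 2 * N) => Θ.weight e.val)
    (fun _ _ _ _ => Θ.weight_ne_zero hM hN (Fin.is_lt _))
    (fun k : Fin (2 * M + 2 * N) => by
      have h := Θ.weight_mul_fanE hM hN k.2
      have h0 : Θ.weight (fanB (2 * M) (2 * N) k.val) ≠ 0 :=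
        Θ.weight_ne_zero hM hN (fanB_lt k.2)
      change Θ.shape k * (Θ.weight (fanB (2 * M) (2 * N) k.val) *
        Θ.weight (fanB (2 * M) (2 * N) k.val)) =
        Θ.weight k.val * Θ.weight (fanE (2 * M) (2 * N) k.val)
      rw [h, shape]
      field_simp)
    (fun k : Fin (2 * M + 2 * N) => by
      have h := Θ.weight_mul_fanE hM hN k.2
      rw [sq, sq] at h
      exact h)

theorem isGeometricSolution (hM : 1 < M) (hN : 1 < N) :
    (monodromyTriangulation (wordLR (2 * M) (2 * N))).IsGeometricSolution Θ.shape := by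
  refine ⟨(Θ.edgeWeights hM hN).isSolution (isCyclic_monodromyTriangulation _)
    (fun k => (Θ.shape_im_pos hM hN k).le) (fun k f _ => Θ.shape_im_pos hM hN _)
    ((fanNames (2 * M) (2 * N) (by omega) (by omega)).labelling.edgeLabelling (fun e => ?_) rfl),
    Θ.shape_im_pos hM hN⟩
  exact ⟨e, 0, 2, by decide, rfl⟩

/-- The square of the sine that determines the shapes in the middle of the first fan. -/
noncomputable def v : ℂ := Complex.sin Θ.α ^ 2

/-- The condition `im_α` at `j = 0` says that 1/v has negative imaginary part. -/
theorem v_im_pos : 0 < Θ.v.im := by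
  have h := Θ.im_α 0 (Nat.zero_le _)
  have h0 := Θ.sin_α_ne_zero
  have e : Θ.v = ((Complex.cos ((0 : ℕ) * Θ.α) / Complex.sin Θ.α) ^ 2)⁻¹ := by
    simp [v]
  rw [e, Complex.inv_im]
  refine div_pos (neg_pos.2 h) (Complex.normSq_pos.2 fun h' => ?_)
  rw [h'] at h
  simp at h

theorem one_sub_v : 1 - Θ.v = Complex.cos Θ.α ^ 2 := by
  rw [v, Complex.cos_sq']

/-- The weight of the common edge of all layers of the first fan. -/
noncomputable def pivot : ℂ := 2 * Complex.cos Θ.α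

/-- The weight of the edge in the middle of the first fan. -/
noncomputable def rung : ℂ := 2 * Complex.I * (Complex.cos Θ.α / Complex.sin Θ.α)

theorem pivot_sq : Θ.pivot ^ 2 = 4 - 4 * Θ.v := by
  rw [pivot]
  linear_combination -4 * Θ.one_sub_v

theorem rung_sq : Θ.rung ^ 2 * Θ.v = -Θ.pivot ^ 2 := by
  have := Θ.sin_α_ne_zero
  rw [rung, pivot, v]
  field_simp
  linear_combination Complex.cos Θ.α ^ 2 * Complex.I_sq

theorem coreWeight_ne_zero (e : Fin 8) : coreWeight Θ.pivot Θ.rung e ≠ 0 := by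
  obtain ⟨n0, n1, n2, n3⟩ := denominators_ne_zero Θ.v_im_pos
  have hp : Θ.pivot ≠ 0 := fun h => n1 (by
    have := Θ.pivot_sq
    rw [h] at this
    linear_combination this / 4)
  have hr : Θ.rung ≠ 0 := fun h => hp (by
    have := Θ.rung_sq
    rw [h] at this
    simpa using this)
  have ht : Θ.pivot ^ 2 - 2 ≠ 0 := by
    rw [pivot_sq]
    intro h
    exact n2 (by linear_combination -h / 2)
  have hn : Θ.pivot ^ 2 - 1 ≠ 0 := by
    rw [pivot_sq]
    intro h
    exact n3 (by linear_combination -h)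
  fin_cases e <;> simp [coreWeight, hp, hr, ht, hn]

/-- The shapes of the middle layers. -/
theorem shape_middleLayer (hM : 1 < M) (hN : 1 < N) (c : Fin 3) : Θ.shape (middleLayer N hM c) = fanShape Θ.v c := by
  have h0 := Θ.sin_α_ne_zero
  have hc : Complex.cos Θ.α ^ 2 = 1 - Θ.v := Θ.one_sub_v.symm
  have hv : Complex.sin Θ.α ^ 2 = Θ.v := rfl
  have n0 := (denominators_ne_zero Θ.v_im_pos).1
  have hm : ((middleLayer N hM c).val : ℂ) - M = (c.val : ℂ) - 1 := by
    have : (middleLayer N hM c).val + 1 = M + c.val := by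
      simp only [middleLayer]
      omega
    have := congrArg (Nat.cast (R := ℂ)) this
    push_cast at this
    linear_combination this
  rw [Θ.shape_of_le hM hN (by simp only [middleLayer]; omega) (by simp only [middleLayer]; omega),
    hm]
  fin_cases c <;> norm_num [fanShape, div_pow, hc, hv] <;> field_simp <;> ring

end FanAngles

/-! ### The triangulations with a new middle -/

/-- The names of the edges in the middle of the first fan, and two names for new edges. -/
def middleName {M : ℕ} (N : ℕ) (hM : 1 < M) : Fin 8 → Fin (2 * M + 2 * N) ⊕ Fin 2 :=
  ![.inl ⟨2 * M + 2 * N - 1, by omega⟩, .inl ⟨M - 1, by omega⟩, .inl ⟨M - 2, by omega⟩,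
    -- Two rungs before the middle is not always inside the fan: for `M = 2` the edge is the one at
    -- its far end, and the names 4 and 5 then agree. `fanE` covers both cases.
    .inl ⟨M, by omega⟩, .inl ⟨fanE (2 * M) (2 * N) (M - 1), fanE_lt (by omega) (by omega)⟩,
    .inl ⟨M + 1, by omega⟩, .inr 0, .inr 1]

theorem name_middleLayer {M N : ℕ} (hM : 1 < M) (hN : 1 < N) (c : Fin 3) (i j : Fin 4) :
    (.inl ((fanNames (2 * M) (2 * N) (by omega) (by omega)).labelling.name
      (middleLayer N hM c) i j) : Fin (2 * M + 2 * N) ⊕ Fin 2) =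
      middleName N hM (fanName c i j) := by
  set F := fanNames (2 * M) (2 * N) (by omega) (by omega)
  have hA : ∀ c : Fin 3, (F.A (middleLayer N hM c)).val = M - 2 + c.val := by
    intro c
    change fanA (2 * M) (M - 1 + c.val) = M - 2 + c.val
    rw [fanA, if_pos (by omega)]
    omega
  have hB : ∀ c : Fin 3, (F.B (middleLayer N hM c)).val = 2 * M + 2 * N - 1 := by
    intro c
    change fanB (2 * M) (2 * N) (M - 1 + c.val) = _
    rw [fanB, if_neg (by omega)]
  have hD : ∀ c : Fin 3, (F.D (middleLayer N hM c)).val = M - 1 + c.val := fun c => rfl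
  have hE : ∀ c : Fin 3, 1 ≤ c.val → (F.E (middleLayer N hM c)).val + 3 = M + c.val := by
    intro c hc
    change fanE (2 * M) (2 * N) (M - 1 + c.val) + 3 = _
    rw [fanE, if_neg (by omega), if_pos (by omega), fanA]
    split_ifs <;> omega
  have hE0 : (F.E (middleLayer N hM 0)).val = fanE (2 * M) (2 * N) (M - 1) := rfl
  change Sum.inl (layerName (F.A (middleLayer N hM c)) (F.B (middleLayer N hM c))
    (F.D (middleLayer N hM c)) (F.E (middleLayer N hM c)) i j) = _
  have hA0 : Sum.inl (F.A (middleLayer N hM 0)) = middleName N hM 2 :=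
    congrArg Sum.inl (Fin.ext ((hA 0).trans (by simp)))
  have hA1 : Sum.inl (F.A (middleLayer N hM 1)) = middleName N hM 1 :=
    congrArg Sum.inl (Fin.ext ((hA 1).trans (by simp; omega)))
  have hA2 : Sum.inl (F.A (middleLayer N hM 2)) = middleName N hM 3 :=
    congrArg Sum.inl (Fin.ext ((hA 2).trans (by simp; omega)))
  have hB' : ∀ c, Sum.inl (F.B (middleLayer N hM c)) = middleName N hM 0 := fun c =>
    congrArg Sum.inl (Fin.ext (hB c))
  have hD0 : Sum.inl (F.D (middleLayer N hM 0)) = middleName N hM 1 :=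
    congrArg Sum.inl (Fin.ext ((hD 0).trans (by simp)))
  have hD1 : Sum.inl (F.D (middleLayer N hM 1)) = middleName N hM 3 :=
    congrArg Sum.inl (Fin.ext ((hD 1).trans (by simp; omega)))
  have hD2 : Sum.inl (F.D (middleLayer N hM 2)) = middleName N hM 5 :=
    congrArg Sum.inl (Fin.ext ((hD 2).trans (by simp; omega)))
  have hE0' : Sum.inl (F.E (middleLayer N hM 0)) = middleName N hM 4 :=
    congrArg Sum.inl (Fin.ext hE0)
  have hE1 : Sum.inl (F.E (middleLayer N hM 1)) = middleName N hM 2 :=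
    congrArg Sum.inl (Fin.ext (by have := hE 1 (by simp); simp at this ⊢; omega))
  have hE2 : Sum.inl (F.E (middleLayer N hM 2)) = middleName N hM 1 :=
    congrArg Sum.inl (Fin.ext (by have := hE 2 (by simp); simp at this ⊢; omega))
  fin_cases c <;> fin_cases i <;> fin_cases j <;>
    first
    | exact hB' _
    | exact hA0
    | exact hA1
    | exact hA2
    | exact hD0
    | exact hD1
    | exact hD2
    | exact hE0'
    | exact hE1
    | exact hE2

theorem dir_middleLayer {M N : ℕ} (hM : 1 < M) (hN : 1 < N) (c : Fin 3) {i j : Fin 4}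
    (hij : i ≠ j) : (fanNames (2 * M) (2 * N) (by omega) (by omega)).labelling.dir
      (middleLayer N hM c) i j = fanDir c i j := by
  have hs : (fanNames (2 * M) (2 * N) (by omega) (by omega)).s (middleLayer N hM c) = true := by
    refine decide_eq_true ⟨?_, ?_⟩ <;> simp only [middleLayer] <;> omega
  change layerDir ((fanNames (2 * M) (2 * N) (by omega) (by omega)).s (middleLayer N hM c)) i j = _
  rw [hs]
  clear hs
  revert c i j
  decide

/-- The labelling of the edges of a triangulation with a new middle. -/
def middleLabelling {M N m : ℕ} (hM : 1 < M) (hN : 1 < N) {P : Patch m} (E : EdgeTable P) :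
    ((middleSite M N hM hN).graft P).DirectedLabelling (Fin (2 * M + 2 * N) ⊕ Fin 2) :=
  (middleSite M N hM hN).graftLabelling E
    (fanNames (2 * M) (2 * N) (by omega) (by omega)).labelling Sum.inl (middleName N hM)
    (fun g i j _ _ _ => name_middleLayer hM hN (fanBase g) i j)
    (fun g _ _ hij => dir_middleLayer hM hN (fanBase g) hij)

theorem card_graft {M N m : ℕ} (hM : 1 < M) (hN : 1 < N) (P : Patch m) :
    Fintype.card ((middleSite M N hM hN).graft P).Tet + 3 = 2 * M + 2 * N + m := by
  have h := Fintype.card_congr (middleEquiv M N hM hN)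
  rw [Fintype.card_sum, Fintype.card_fin, Fintype.card_fin] at h
  have h' : Fintype.card ((middleSite M N hM hN).graft P).Tet =
      Fintype.card (middleSite M N hM hN).Outer + m := by
    refine (Fintype.card_congr (Equiv.refl ((middleSite M N hM hN).Outer ⊕ Fin m))).trans ?_
    rw [Fintype.card_sum, Fintype.card_fin]
  omega

/-- The edge labelling of a triangulation with a new middle that is defined by an identification
`ρ` of names, if the table contains the names of all edges in the middle. -/
def middleEdgeLabelling {M N m : ℕ} (hM : 1 < M) (hN : 1 < N) {P : Patch m} (E : EdgeTable P)
    {κ : Type} [Fintype κ] (ρ : Fin (2 * M + 2 * N) ⊕ Fin 2 → κ) (l : Fin 3 → Fin 8)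
    (hl : ∀ c, ρ (middleName N hM (l c)) = ρ (.inl (middleLayer N hM c)))
    (hE : ∀ c, ∃ t i j, i ≠ j ∧ E.name t i j = l c)
    (hρ : ∀ e, (∃ k, ρ (.inl k) = e) ∨
      ∃ t i j, i ≠ j ∧ ρ (middleName N hM (E.name t i j)) = e)
    (hc : Fintype.card κ + 3 = 2 * M + 2 * N + m) :
    ((middleSite M N hM hN).graft P).EdgeLabelling (κ × Bool) :=
  ((middleLabelling hM hN E).map ρ).edgeLabelling (fun e => by
    rcases hρ e with ⟨k, rfl⟩ | ⟨t, i, j, hij, rfl⟩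
    · obtain ⟨t | c, rfl⟩ := (middleEquiv M N hM hN).surjective k
      · exact ⟨.inl t, 0, 2, by decide, rfl⟩
      · obtain ⟨t, i, j, hij, h⟩ := hE c
        refine ⟨.inr t, i, j, hij, ?_⟩
        change ρ (middleName N hM (E.name t i j)) = _
        rw [h]
        exact hl c
    · exact ⟨.inr t, i, j, hij, rfl⟩) (by
    have := card_graft hM hN P
    omega)

namespace FanAngles

variable {M N : ℕ} (Θ : FanAngles M N)

/-- The weights of all edges, by their names. -/
noncomputable def middleWeight : Fin (2 * M + 2 * N) ⊕ Fin 2 → ℂ :=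
  Sum.elim (fun k => Θ.weight k.val) ![Θ.pivot ^ 2, Θ.pivot * (Θ.pivot ^ 2 - 1)]

/-- Around the middle of the fan the cosines are those of 0, ± α and ± 2α, hence polynomials in the
pivot. -/
theorem middleWeight_middleName (hM : 1 < M) (hN : 1 < N) (e : Fin 8) :
    Θ.middleWeight (middleName N hM e) = coreWeight Θ.pivot Θ.rung e := by
  have hy : ∀ (k : ℕ) (j : ℤ), (k : ℤ) - M = j →
      Θ.y k = Θ.rung * Complex.cos (j * Θ.α) := by
    intro k j h
    have : (k : ℂ) - M = j := by exact_mod_cast congrArg (Int.cast (R := ℂ)) h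
    rw [y, fanTrace, this]
    rfl
  have hc : Complex.cos (2 * Θ.α) = (Θ.pivot ^ 2 - 2) / 2 := by
    rw [Complex.cos_two_mul, pivot]
    ring
  fin_cases e
  · change Θ.weight (2 * M + 2 * N - 1) = Θ.pivot
    rw [pivot, ← x_last, weight, if_neg (by omega)]
    congr 1
    omega
  · change Θ.weight (M - 1) = Θ.rung
    rw [weight, if_pos (by omega), hy _ 0 (by omega)]
    simp
  · change Θ.weight (M - 2) = Θ.pivot * Θ.rung / 2
    rw [weight, if_pos (by omega), hy _ (-1) (by omega), pivot]
    simp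
    ring
  · change Θ.weight M = Θ.pivot * Θ.rung / 2
    rw [weight, if_pos (by omega), hy _ 1 (by omega), pivot]
    simp
    ring
  · change Θ.weight (fanE (2 * M) (2 * N) (M - 1)) = Θ.rung * (Θ.pivot ^ 2 - 2) / 2
    rw [weight_fanE_of_le _ hM (by omega) (by omega), hy _ (-2) (by omega)]
    push_cast
    rw [neg_mul, Complex.cos_neg, hc]
    ring
  · change Θ.weight (M + 1) = Θ.rung * (Θ.pivot ^ 2 - 2) / 2
    rw [weight, if_pos (by omega), hy _ 2 (by omega)]
    push_cast
    rw [hc]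
    ring
  · rfl
  · rfl

/-- The shapes of a triangulation with a new middle. -/
noncomputable def graftShape (hM : 1 < M) (hN : 1 < N) {m : ℕ} (P : Patch m) (z : Fin m → ℂ) :
    ((middleSite M N hM hN).graft P).Tet → ℂ :=
  Sum.elim (fun t => Θ.shape t.1) z

/-- Outer tetrahedra retain their weights, and the table of the patch agrees with them at the ports.
Flat tetrahedra need checking only within the patch, as everything outside is positive. -/
theorem graft_isSolution (hM : 1 < M) (hN : 1 < N) {m : ℕ} {P : Patch m} (E : EdgeTable P)
    {z : Fin m → ℂ} (hz : ∀ c, 0 ≤ (z c).im)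
    (hflat : ∀ c f c', P.adj c f = .inl c' → (z c).im = 0 → 0 < (z c').im)
    (hs : E.IsShape (coreWeight Θ.pivot Θ.rung) z)
    {κ : Type} [Fintype κ] (L : ((middleSite M N hM hN).graft P).EdgeLabelling κ) :
    ((middleSite M N hM hN).graft P).IsSolution (Θ.graftShape hM hN P z) := by
  have hin : ∀ c i j, Θ.middleWeight ((middleLabelling hM hN E).name (.inr c) i j) =
      coreWeight Θ.pivot Θ.rung (E.name c i j) := fun c i j =>
    Θ.middleWeight_middleName hM hN (E.name c i j)
  have W : ((middleSite M N hM hN).graft P).EdgeWeights (Θ.graftShape hM hN P z) := by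
    refine (middleLabelling hM hN E).edgeWeights Θ.middleWeight ?_ ?_ ?_
    · rintro (t | c) i j hij
      · exact (Θ.edgeWeights hM hN).ne_zero t.1 i j hij
      · rw [hin]
        exact Θ.coreWeight_ne_zero _
    · rintro (t | c)
      · exact (Θ.edgeWeights hM hN).shape t.1
      · simp only [hin]
        exact (hs c).1
    · rintro (t | c)
      · exact (Θ.edgeWeights hM hN).ptolemy t.1
      · simp only [hin]
        exact (hs c).2
  refine W.isSolution ((middleSite M N hM hN).graft_isCyclic E
    (isCyclic_monodromyTriangulation _)) ?_ ?_ L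
  · rintro (t | c)
    · exact (Θ.shape_im_pos hM hN t.1).le
    · exact hz c
  · rintro (t | c) f h
    · exact absurd h (Θ.shape_im_pos hM hN t.1).ne'
    · rcases h' : P.adj c f with c' | g
      · have : ((middleSite M N hM hN).graft P).adj (.inr c) f = .inr c' := by
          simp [Site.graft, h']
        rw [this]
        exact hflat c f c' h' h
      · have : ((middleSite M N hM hN).graft P).adj (.inr c) f = .inl ⟨_,
            (middleSite M N hM hN).not_mem g⟩ := by
          simp [Site.graft, h']
        rw [this]
        exact Θ.shape_im_pos hM hN _

end FanAngles

/-! ### Following the shapes through the moves. -/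

theorem TwoThreeMove.tracks_rename {G T T' : IdealTriangulation} (m : TwoThreeMove G T')
    (e : G.LabelledIso T) {z : T.Tet → ℂ} {z' : T'.Tet → ℂ}
    (h : m.Tracks (fun t => z (e.equiv t)) z') : (m.rename e).Tracks z z' := by
  refine ⟨fun t => ?_, h.2⟩
  have := h.1 (e.equiv.symm.subtypeEquiv (q := fun t => t ≠ m.a ∧ t ≠ m.b) (fun t => by
    simp only [TwoThreeMove.rename, ne_eq, Equiv.symm_apply_eq]) t)
  exact Eq.trans this (congrArg z (e.equiv.apply_symm_apply t.1))

namespace PatchMove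

variable {m m' : ℕ} {P : Patch m} {P' : Patch m'} (μ : PatchMove P P')
  {T : IdealTriangulation} (X : Site T)

theorem tracks_toMove {z : (X.graft P).Tet → ℂ} {z' : (X.graft P').Tet → ℂ} {u : Fin m → ℂ}
    {u' : Fin m' → ℂ} (hz : ∀ t, z' (.inl t) = z (.inl t)) (hu : ∀ c, z (.inr c) = u c)
    (hu' : ∀ c, z' (.inr c) = u' c) (hk : ∀ c, c ≠ μ.a → c ≠ μ.b → u' (μ.keep c) = u c)
    (hp : ∀ i : Fin 3, edgeShape (u' (μ.c i)) (μ.ρ i 3) (μ.ρ i i.castSucc) =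
      edgeShape (u μ.a) (μ.σ 3) (μ.σ i.castSucc) * edgeShape (u μ.b) (μ.τ 3) (μ.τ i.castSucc)) :
    (μ.toMove X).Tracks z z' := by
  constructor
  · rintro ⟨t | c, h⟩
    · exact hz t
    · refine (hu' _).trans ((hk c (fun h' => h.1 (congrArg _ h')) fun h' =>
        h.2 (congrArg _ h')).trans (hu c).symm)
  · intro i
    change edgeShape (z' (.inr (μ.c i))) (μ.ρ i 3) (μ.ρ i i.castSucc) =
      edgeShape (z (.inr μ.a)) (μ.σ 3) (μ.σ i.castSucc) *
        edgeShape (z (.inr μ.b)) (μ.τ 3) (μ.τ i.castSucc)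
    rw [hu, hu, hu']
    exact hp i

end PatchMove

section Tracks

variable {v : ℂ}

theorem firstMove_tracks (hv : 0 < v.im) :
    (∀ c, c ≠ firstMove.a → c ≠ firstMove.b → firstShape v (firstMove.keep c) = fanShape v c) ∧
    ∀ i : Fin 3, edgeShape (firstShape v (firstMove.c i)) (firstMove.ρ i 3)
      (firstMove.ρ i i.castSucc) =
      edgeShape (fanShape v firstMove.a) (firstMove.σ 3) (firstMove.σ i.castSucc) *
        edgeShape (fanShape v firstMove.b) (firstMove.τ 3) (firstMove.τ i.castSucc) := by
  obtain ⟨n0, n1, n2, n3⟩ := denominators_ne_zero hv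
  constructor
  · intro c ha hb
    fin_cases c <;> first | exact absurd rfl ha | exact absurd rfl hb | rfl
  · intro i
    fin_cases i
    · change ((((2 * v - 1) / (2 * v)) - 1) / ((2 * v - 1) / (2 * v))) =
        (((2 - 1 / v) - 1) / (2 - 1 / v)) * (((1 - 1 / v) - 1) / (1 - 1 / v))
      grind
    · change (1 / (1 - 2)) =
        (1 / (1 - (2 - 1 / v))) * (1 - 1 / v)
      grind
    · change (1 / (1 - ((2 * v - 2) / (2 * v - 1)))) =
        (2 - 1 / v) * (1 / (1 - (1 - 1 / v)))
      grind

theorem secondMove_tracks (hv : 0 < v.im) :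
    (∀ c, c ≠ secondMove.a → c ≠ secondMove.b → secondShape v (secondMove.keep c) = firstShape v c) ∧
    ∀ i : Fin 3, edgeShape (secondShape v (secondMove.c i)) (secondMove.ρ i 3)
      (secondMove.ρ i i.castSucc) =
      edgeShape (firstShape v secondMove.a) (secondMove.σ 3) (secondMove.σ i.castSucc) *
        edgeShape (firstShape v secondMove.b) (secondMove.τ 3) (secondMove.τ i.castSucc) := by
  obtain ⟨n0, n1, n2, n3⟩ := denominators_ne_zero hv
  constructor
  · intro c ha hb
    fin_cases c <;> first | exact absurd rfl ha | exact absurd rfl hb | rfl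
  · intro i
    fin_cases i
    · change ((((1 - 2 * v) ^ 2 / (v * (4 * v - 3))) - 1) / ((1 - 2 * v) ^ 2 / (v * (4 * v - 3)))) =
        ((((2 * v - 1) / (2 * v)) - 1) / ((2 * v - 1) / (2 * v))) * (((2 - 1 / v) - 1) / (2 - 1 / v))
      grind
    · change (1 / (1 - ((4 * v - 3) / (2 * (2 * v - 1))))) =
        (1 / (1 - ((2 * v - 1) / (2 * v)))) * (2 - 1 / v)
      grind
    · change (1 / (1 - ((4 * v - 3) / (2 * v - 1)))) =
        ((2 * v - 1) / (2 * v)) * (1 / (1 - (2 - 1 / v)))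
      grind

theorem thirdMove_tracks (hv : 0 < v.im) :
    (∀ c, c ≠ thirdMove.a → c ≠ thirdMove.b → secondShape v (thirdMove.keep c) = thirdShape v c) ∧
    ∀ i : Fin 3, edgeShape (secondShape v (thirdMove.c i)) (thirdMove.ρ i 3)
      (thirdMove.ρ i i.castSucc) =
      edgeShape (thirdShape v thirdMove.a) (thirdMove.σ 3) (thirdMove.σ i.castSucc) *
        edgeShape (thirdShape v thirdMove.b) (thirdMove.τ 3) (thirdMove.τ i.castSucc) := by
  obtain ⟨n0, n1, n2, n3⟩ := denominators_ne_zero hv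
  constructor
  · intro c ha hb
    fin_cases c <;> first | exact absurd rfl ha | exact absurd rfl hb | rfl
  · intro i
    fin_cases i
    · change (1 / (1 - 2)) =
        ((((4 * v - 3) / (2 * (2 * v - 1))) - 1) / ((4 * v - 3) / (2 * (2 * v - 1)))) * (1 / (1 - ((4 * v - 4) / (4 * v - 3))))
      grind
    · change (1 / (1 - ((4 * v - 3) / (2 * v - 1)))) =
        (1 / (1 - ((4 * v - 3) / (2 * (2 * v - 1))))) * ((((4 * v - 4) / (4 * v - 3)) - 1) / ((4 * v - 4) / (4 * v - 3)))
      grind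
    · change ((2 * v - 2) / (2 * v - 1)) =
        ((4 * v - 3) / (2 * (2 * v - 1))) * ((4 * v - 4) / (4 * v - 3))
      grind

end Tracks

section

open ComplexConjugate

/-! ### Existence of the angles -/

/-- The length of the interval in which the real parameters are found; its hyperbolic cosine is
`2`. -/
noncomputable def boxWidth : ℝ := Real.arsinh √3

theorem sinh_boxWidth : Real.sinh boxWidth = √3 := Real.sinh_arsinh _

theorem cosh_boxWidth : Real.cosh boxWidth = 2 := by
  have h := Real.cosh_sq boxWidth
  rw [sinh_boxWidth, Real.sq_sqrt (by norm_num)] at h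
  nlinarith [Real.cosh_pos boxWidth]

theorem boxWidth_nonneg : 0 ≤ boxWidth := Real.arsinh_nonneg_iff.2 (Real.sqrt_nonneg _)

theorem sinh_sq_half_boxWidth : Real.sinh (boxWidth / 2) ^ 2 = 1 / 2 := by
  have h := Real.cosh_two_mul (boxWidth / 2)
  rw [mul_div_cancel₀ _ (two_ne_zero), cosh_boxWidth, Real.cosh_sq] at h
  linarith

/-- The rectangle in which the parameters are found. -/
def box : Set ℂ := {e | (0 ≤ e.re ∧ e.re ≤ boxWidth) ∧ 0 ≤ e.im ∧ e.im ≤ Real.pi / 4}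

/-- The angle of a fan of length `2 * M` with the given parameter. -/
noncomputable def fanAngle (M : ℕ) (e : ℂ) : ℂ := (Real.pi / 2 + Complex.I * e) / M

theorem fanAngle_eq (M : ℕ) (e : ℂ) : fanAngle M e =
    (((Real.pi / 2 - e.im) / M : ℝ) : ℂ) + ((e.re / M : ℝ) : ℂ) * Complex.I := by
  rw [fanAngle]
  nth_rw 1 [← Complex.re_add_im e]
  push_cast
  linear_combination (e.im / M : ℂ) * Complex.I_sq

theorem cos_re_im (θ s : ℝ) : (Complex.cos (θ + s * Complex.I)).re = Real.cos θ * Real.cosh s ∧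
    (Complex.cos (θ + s * Complex.I)).im = -(Real.sin θ * Real.sinh s) := by
  rw [Complex.cos_add_mul_I, ← Complex.ofReal_cos, ← Complex.ofReal_cosh, ← Complex.ofReal_sin,
    ← Complex.ofReal_sinh]
  simp [Complex.cos_ofReal_re, Complex.sin_ofReal_re, Complex.sinh_ofReal_re]

theorem sin_re_im (θ s : ℝ) : (Complex.sin (θ + s * Complex.I)).re = Real.sin θ * Real.cosh s ∧
    (Complex.sin (θ + s * Complex.I)).im = Real.cos θ * Real.sinh s := by
  rw [Complex.sin_add_mul_I, ← Complex.ofReal_cos, ← Complex.ofReal_cosh, ← Complex.ofReal_sin,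
    ← Complex.ofReal_sinh]
  simp [Complex.cos_ofReal_re, Complex.sin_ofReal_re, Complex.sinh_ofReal_re]

theorem sinh_re_im (e : ℂ) : (Complex.sinh e).re = Real.sinh e.re * Real.cos e.im ∧
    (Complex.sinh e).im = Real.cosh e.re * Real.sin e.im := by
  conv in Complex.sinh e => rw [← Complex.re_add_im e]
  conv in (Complex.sinh e).im => rw [← Complex.re_add_im e]
  rw [Complex.sinh_add, Complex.sinh_mul_I, Complex.cosh_mul_I, ← Complex.ofReal_cos,
    ← Complex.ofReal_cosh, ← Complex.ofReal_sin, ← Complex.ofReal_sinh]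
  simp [Complex.cos_ofReal_re, Complex.sin_ofReal_re, Complex.sinh_ofReal_re]

theorem cosh_re_im (e : ℂ) : (Complex.cosh e).re = Real.cosh e.re * Real.cos e.im ∧
    (Complex.cosh e).im = Real.sinh e.re * Real.sin e.im := by
  conv in Complex.cosh e => rw [← Complex.re_add_im e]
  conv in (Complex.cosh e).im => rw [← Complex.re_add_im e]
  rw [Complex.cosh_add, Complex.sinh_mul_I, Complex.cosh_mul_I, ← Complex.ofReal_cos,
    ← Complex.ofReal_cosh, ← Complex.ofReal_sin, ← Complex.ofReal_sinh]
  simp [Complex.cos_ofReal_re, Complex.sin_ofReal_re, Complex.sinh_ofReal_re]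

theorem normSq_cos (θ s : ℝ) : Complex.normSq (Complex.cos (θ + s * Complex.I)) =
    Real.cos θ ^ 2 + Real.sinh s ^ 2 := by
  rw [Complex.normSq_apply, (cos_re_im θ s).1, (cos_re_im θ s).2]
  have h1 := Real.sin_sq_add_cos_sq θ
  have h2 := Real.cosh_sq s
  linear_combination Real.cos θ ^ 2 * h2 + Real.sinh s ^ 2 * h1

theorem normSq_sin (θ s : ℝ) : Complex.normSq (Complex.sin (θ + s * Complex.I)) =
    Real.sin θ ^ 2 + Real.sinh s ^ 2 := by
  rw [Complex.normSq_apply, (sin_re_im θ s).1, (sin_re_im θ s).2]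
  have h1 := Real.sin_sq_add_cos_sq θ
  have h2 := Real.cosh_sq s
  linear_combination Real.sin θ ^ 2 * h2 + Real.sinh s ^ 2 * h1

/-- Real and imaginary part of an angle that belongs to a point in the box. -/
structure AngleBounds (θ s : ℝ) : Prop where
  pos : 0 < θ
  le : θ ≤ Real.pi / 4
  nonneg : 0 ≤ s
  sinh_sq : Real.sinh s ^ 2 ≤ 1 / 2

/-- Dividing by at least 2 puts the real part below π/4, and the imaginary part below half the width
of the box, where sinh² is 1/2. -/
theorem angleBounds {M : ℕ} (hM : 1 < M) {e : ℂ} (he : e ∈ box) :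
    AngleBounds ((Real.pi / 2 - e.im) / M) (e.re / M) := by
  obtain ⟨⟨h1, h2⟩, h3, h4⟩ := he
  have hM' : (2 : ℝ) ≤ M := by exact_mod_cast hM
  have hpi := Real.pi_pos
  have hs : e.re / M ≤ boxWidth / 2 :=
    div_le_div₀ boxWidth_nonneg h2 two_pos hM'
  have hs0 : 0 ≤ e.re / M := div_nonneg h1 (by linarith)
  refine ⟨div_pos (by linarith) (by linarith), ?_, hs0, ?_⟩
  · calc (Real.pi / 2 - e.im) / M ≤ (Real.pi / 2) / 2 :=
        div_le_div₀ (by linarith) (by linarith) two_pos hM'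
      _ = Real.pi / 4 := by ring
  · rw [← sinh_sq_half_boxWidth]
    exact pow_le_pow_left₀ (Real.sinh_nonneg_iff.2 hs0) (Real.sinh_le_sinh.2 hs) 2

namespace AngleBounds

variable {θ s : ℝ}

theorem cos_sq_ge (h : AngleBounds θ s) : 1 / 2 ≤ Real.cos θ ^ 2 := by
  have h1 : Real.cos (Real.pi / 4) ≤ Real.cos θ :=
    Real.cos_le_cos_of_nonneg_of_le_pi h.pos.le (by linarith [Real.pi_pos]) h.le
  rw [Real.cos_pi_div_four] at h1
  have := pow_le_pow_left₀ (by positivity) h1 2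
  rw [div_pow, Real.sq_sqrt two_pos.le] at this
  linarith

theorem sin_sq_le (h : AngleBounds θ s) : Real.sin θ ^ 2 ≤ 1 / 2 := by
  have := Real.sin_sq_add_cos_sq θ
  linarith [h.cos_sq_ge]

theorem cos_pos (h : AngleBounds θ s) : 0 < Real.cos θ :=
  Real.cos_pos_of_mem_Ioo ⟨by linarith [h.pos, Real.pi_pos], by linarith [h.le, Real.pi_pos]⟩

theorem sin_pos (h : AngleBounds θ s) : 0 < Real.sin θ :=
  Real.sin_pos_of_pos_of_lt_pi h.pos (by linarith [h.le, Real.pi_pos])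

theorem sinh_nonneg (h : AngleBounds θ s) : 0 ≤ Real.sinh s := Real.sinh_nonneg_iff.2 h.nonneg

theorem cos_re_pos (h : AngleBounds θ s) : 0 < (Complex.cos (θ + s * Complex.I)).re := by
  rw [(cos_re_im θ s).1]
  exact mul_pos h.cos_pos (Real.cosh_pos s)

theorem cos_im_nonpos (h : AngleBounds θ s) : (Complex.cos (θ + s * Complex.I)).im ≤ 0 := by
  rw [(cos_re_im θ s).2]
  linarith [mul_nonneg h.sin_pos.le h.sinh_nonneg]

theorem cos_im_ge (h : AngleBounds θ s) : -(Complex.cos (θ + s * Complex.I)).im ≤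
    (Complex.cos (θ + s * Complex.I)).re := by
  rw [(cos_re_im θ s).1, (cos_re_im θ s).2, neg_neg]
  refine mul_le_mul ?_ (Real.sinh_lt_cosh s).le h.sinh_nonneg h.cos_pos.le
  exact abs_le_of_sq_le_sq' (by linarith [h.sin_sq_le, h.cos_sq_ge]) h.cos_pos.le |>.2

theorem cos_ne_zero (h : AngleBounds θ s) : Complex.cos (θ + s * Complex.I) ≠ 0 := fun h' => by
  have := h.cos_re_pos
  rw [h'] at this
  exact lt_irrefl _ this

end AngleBounds

/-- The equation for the parameter of a fan. -/
noncomputable def fanEq (M : ℕ) (u e : ℂ) : ℂ := Complex.sinh e - u * Complex.tan (fanAngle M e)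

/-- A coefficient that comes from the other fan. -/
structure IsCoefficient (u : ℂ) : Prop where
  re_pos : 0 < u.re
  im_nonneg : 0 ≤ u.im
  normSq_le : Complex.normSq u ≤ 3 / 2

theorem AngleBounds.isCoefficient {θ s : ℝ} (h : AngleBounds θ s) :
    IsCoefficient (conj (Complex.cos (θ + s * Complex.I))) := by
  refine ⟨?_, ?_, ?_⟩
  · rw [Complex.conj_re]
    exact h.cos_re_pos
  · rw [Complex.conj_im]
    exact neg_nonneg.2 h.cos_im_nonpos
  · rw [Complex.normSq_conj, normSq_cos]
    have := Real.cos_sq_le_one θ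
    linarith [h.sinh_sq]

theorem AngleBounds.tan_re_im {θ s : ℝ} (h : AngleBounds θ s) :
    (Complex.tan (θ + s * Complex.I)).re =
      Real.sin θ * Real.cos θ / (Real.cos θ ^ 2 + Real.sinh s ^ 2) ∧
    (Complex.tan (θ + s * Complex.I)).im =
      Real.sinh s * Real.cosh s / (Real.cos θ ^ 2 + Real.sinh s ^ 2) := by
  have h1 := Real.sin_sq_add_cos_sq θ
  have h2 := Real.cosh_sq s
  have h3 : Real.cos θ ^ 2 + Real.sinh s ^ 2 ≠ 0 := by
    have := h.cos_sq_ge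
    positivity
  rw [Complex.tan_eq_sin_div_cos, Complex.div_re, Complex.div_im, normSq_cos, (sin_re_im θ s).1,
    (sin_re_im θ s).2, (cos_re_im θ s).1, (cos_re_im θ s).2]
  constructor
  · field_simp
    linear_combination Real.sin θ * Real.cos θ * h2
  · field_simp
    linear_combination Real.sinh s * h1

theorem AngleBounds.tan_re_pos {θ s : ℝ} (h : AngleBounds θ s) :
    0 < (Complex.tan (θ + s * Complex.I)).re := by
  rw [h.tan_re_im.1]
  have := h.cos_pos
  have := h.sin_pos
  positivity

theorem AngleBounds.tan_im_pos {θ s : ℝ} (h : AngleBounds θ s) (hs : 0 < s) :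
    0 < (Complex.tan (θ + s * Complex.I)).im := by
  rw [h.tan_re_im.2]
  have := Real.sinh_pos_iff.2 hs
  have := Real.cosh_pos s
  have := h.cos_pos
  positivity

theorem normSq_tan (θ s : ℝ) : Complex.normSq (Complex.tan (θ + s * Complex.I)) =
    (Real.sin θ ^ 2 + Real.sinh s ^ 2) / (Real.cos θ ^ 2 + Real.sinh s ^ 2) := by
  rw [Complex.tan_eq_sin_div_cos, Complex.normSq_div, normSq_cos, normSq_sin]

theorem AngleBounds.normSq_tan_le {θ s : ℝ} (h : AngleBounds θ s) :
    Complex.normSq (Complex.tan (θ + s * Complex.I)) ≤ 1 := by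
  have h1 := h.cos_sq_ge
  have h2 := h.sin_sq_le
  rw [normSq_tan]
  exact div_le_one_of_le₀ (by linarith) (by positivity)

theorem re_sq_le_normSq (w : ℂ) : w.re ^ 2 ≤ Complex.normSq w := by
  rw [Complex.normSq_apply]
  nlinarith [mul_self_nonneg w.im]

theorem im_sq_le_normSq (w : ℂ) : w.im ^ 2 ≤ Complex.normSq w := by
  rw [Complex.normSq_apply]
  nlinarith [mul_self_nonneg w.re]

theorem cos_im_box_ge {e : ℂ} (he : e ∈ box) : √2 / 2 ≤ Real.cos e.im := by
  rw [← Real.cos_pi_div_four]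
  exact Real.cos_le_cos_of_nonneg_of_le_pi he.2.1 (by linarith [Real.pi_pos]) he.2.2

/-- On the left side of the box sinh is imaginary and the tangent is real and positive, so only - Re
u tan remains. -/
theorem fanEq_re_neg {M : ℕ} (hM : 1 < M) {u e : ℂ} (hu : IsCoefficient u) (he : e ∈ box)
    (h : e.re = 0) : (fanEq M u e).re < 0 := by
  have hb := angleBounds hM he
  have h1 := hb.tan_re_pos
  have h2 : (Complex.tan (fanAngle M e)).im = 0 := by
    rw [fanAngle_eq, hb.tan_re_im.2, h]
    simp
  rw [← fanAngle_eq] at h1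
  rw [fanEq, Complex.sub_re, (sinh_re_im e).1, Complex.mul_re, h2, h]
  have := mul_pos hu.re_pos h1
  simp
  linarith

/-- On the bottom side sinh is real, while u tan has positive imaginary part. -/
theorem fanEq_im_neg {M : ℕ} (hM : 1 < M) {u e : ℂ} (hu : IsCoefficient u) (he : e ∈ box)
    (h : e.im = 0) (h0 : 0 < e.re) : (fanEq M u e).im < 0 := by
  have hb := angleBounds hM he
  have h1 := hb.tan_re_pos
  have h2 := hb.tan_im_pos (div_pos h0 (by positivity))
  rw [← fanAngle_eq] at h1 h2
  rw [fanEq, Complex.sub_im, (sinh_re_im e).2, Complex.mul_im, h]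
  have := mul_pos hu.re_pos h2
  have := mul_nonneg hu.im_nonneg h1.le
  simp
  linarith

/-- On the right side Re sinh is at least √3 · √2/2, whose square 3/2 bounds |u tan|²; this fixes
the width of the box. -/
theorem fanEq_re_nonneg {M : ℕ} (hM : 1 < M) {u e : ℂ} (hu : IsCoefficient u) (he : e ∈ box)
    (h : e.re = boxWidth) : 0 ≤ (fanEq M u e).re := by
  have hb := (angleBounds hM he).normSq_tan_le
  rw [← fanAngle_eq] at hb
  have h1 := re_sq_le_normSq (u * Complex.tan (fanAngle M e))
  rw [Complex.normSq_mul] at h1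
  have h2 : Complex.normSq u * Complex.normSq (Complex.tan (fanAngle M e)) ≤ 3 / 2 :=
    (mul_le_of_le_one_right (Complex.normSq_nonneg _) hb).trans hu.normSq_le
  have h3 := cos_im_box_ge he
  have h4 : 3 / 2 ≤ (√3 * Real.cos e.im) ^ 2 := by
    have := pow_le_pow_left₀ (by positivity) h3 2
    rw [div_pow, Real.sq_sqrt two_pos.le] at this
    rw [mul_pow, Real.sq_sqrt (by norm_num)]
    linarith
  rw [fanEq, Complex.sub_re, (sinh_re_im e).1, h, sinh_boxWidth, sub_nonneg]
  have h5 : 0 ≤ √3 * Real.cos e.im := mul_nonneg (Real.sqrt_nonneg _) (le_trans (by positivity) h3)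
  exact (abs_le_of_sq_le_sq' (by linarith) h5).2

/-- On the top side |u tan|² has to stay below cosh²/2, so |tan| ≤ 1 is not enough; |tan|² is
expressed by the doubled angle instead. -/
theorem fanEq_im_nonneg {M : ℕ} (hM : 1 < M) {u e : ℂ} (hu : IsCoefficient u) (he : e ∈ box)
    (h : e.im = Real.pi / 4) : 0 ≤ (fanEq M u e).im := by
  have hb := angleBounds hM he
  have hM' : (2 : ℝ) ≤ M := by exact_mod_cast hM
  have h1 := im_sq_le_normSq (u * Complex.tan (fanAngle M e))
  rw [Complex.normSq_mul] at h1
  set θ := (Real.pi / 2 - e.im) / M with hθ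
  set s := e.re / M with hs
  have ht : Complex.normSq (Complex.tan (fanAngle M e)) =
      (Real.cosh (2 * s) - Real.cos (2 * θ)) / (Real.cosh (2 * s) + Real.cos (2 * θ)) := by
    have e1 := Real.sin_sq_add_cos_sq θ
    have e2 := Real.cosh_sq s
    have e3 := hb.cos_sq_ge
    rw [fanAngle_eq, normSq_tan, Real.cosh_two_mul, Real.cos_two_mul]
    rw [div_eq_div_iff (by positivity) (by nlinarith [sq_nonneg (Real.sinh s)])]
    have e4 : Real.sin θ ^ 2 = 1 - Real.cos θ ^ 2 := by linarith
    rw [e4, e2]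
    ring
  have ha : Real.cosh (2 * s) ≤ Real.cosh e.re := by
    rw [Real.cosh_le_cosh, abs_of_nonneg (by linarith [hb.nonneg]), abs_of_nonneg he.1.1, hs,
      mul_div_assoc', div_le_iff₀ (by linarith)]
    nlinarith [he.1.1]
  have ha1 := Real.one_le_cosh (2 * s)
  have hc : √2 / 2 ≤ Real.cos (2 * θ) := by
    rw [← Real.cos_pi_div_four]
    refine Real.cos_le_cos_of_nonneg_of_le_pi (by linarith [hb.pos]) (by linarith [Real.pi_pos]) ?_
    rw [hθ, h, mul_div_assoc', div_le_iff₀ (by linarith)]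
    nlinarith [Real.pi_pos]
  have hr : (7 : ℝ) / 5 ≤ √2 := Real.le_sqrt_of_sq_le (by norm_num)
  generalize Real.cosh (2 * s) = a at *
  generalize Real.cos (2 * θ) = c at *
  -- Multiplied out, this is (a - 1)²(a + 2) + c(a² - 1) + (4c - 2) ≥ 0.
  have hac : 3 * ((a - c) / (a + c)) ≤ a ^ 2 := by
    rw [mul_div_assoc', div_le_iff₀ (by linarith)]
    nlinarith [mul_nonneg (sq_nonneg (a - 1)) (by linarith : 0 ≤ a + 2), mul_nonneg (by linarith : 0 ≤ c) (by nlinarith : 0 ≤ a ^ 2 - 1)]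
  have h2 : Complex.normSq u * Complex.normSq (Complex.tan (fanAngle M e)) ≤
      (Real.cosh e.re * (√2 / 2)) ^ 2 := by
    calc _ ≤ 3 / 2 * Complex.normSq (Complex.tan (fanAngle M e)) :=
          mul_le_mul_of_nonneg_right hu.normSq_le (Complex.normSq_nonneg _)
      _ ≤ a ^ 2 / 2 := by rw [ht]; linarith
      _ ≤ Real.cosh e.re ^ 2 / 2 := by
          have := pow_le_pow_left₀ (by linarith) ha 2
          linarith
      _ = _ := by rw [mul_pow, div_pow, Real.sq_sqrt two_pos.le]; ring
  rw [fanEq, Complex.sub_im, (sinh_re_im e).2, h, Real.sin_pi_div_four, sub_nonneg]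
  exact (abs_le_of_sq_le_sq' (by linarith) (by have := Real.cosh_pos e.re; positivity)).2

theorem hasDerivAt_fanAngle (M : ℕ) (e : ℂ) : HasDerivAt (fanAngle M) (Complex.I / M) e := by
  have := (((hasDerivAt_id e).const_mul Complex.I).const_add (Real.pi / 2 : ℂ)).div_const (M : ℂ)
  exact HasDerivAt.congr_deriv (f := fanAngle M) this (by simp)

theorem hasDerivAt_fanEq {M : ℕ} (hM : 1 < M) (u : ℂ) {e : ℂ} (he : e ∈ box) :
    HasDerivAt (fanEq M u)
      (Complex.cosh e - u * (1 / Complex.cos (fanAngle M e) ^ 2 * (Complex.I / M))) e := by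
  have hc := (angleBounds hM he).cos_ne_zero
  rw [← fanAngle_eq] at hc
  exact (Complex.hasDerivAt_sinh e).sub
    (((Complex.hasDerivAt_tan hc).comp e (hasDerivAt_fanAngle M e)).const_mul u)

theorem norm_cosh_le {e : ℂ} (he : e ∈ box) : ‖Complex.cosh e‖ ≤ 2 := by
  have h1 : Complex.normSq (Complex.cosh e) ≤ Real.cosh e.re ^ 2 := by
    rw [Complex.normSq_apply, (cosh_re_im e).1, (cosh_re_im e).2]
    have h1 := Real.sin_sq_add_cos_sq e.im
    have h2 := Real.cosh_sq e.re
    nlinarith [sq_nonneg (Real.sin e.im)]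
  have h2 : Real.cosh e.re ≤ 2 := by
    rw [← cosh_boxWidth, Real.cosh_le_cosh, abs_of_nonneg he.1.1, abs_of_nonneg boxWidth_nonneg]
    exact he.1.2
  rw [Complex.normSq_eq_norm_sq] at h1
  exact (abs_le_of_sq_le_sq' h1 (Real.cosh_pos _).le).2.trans h2

/-- The argument of c lies in [-π/4, 0], that of 1/c² in [0, π/2], and u lies in the first quadrant.
-/
theorem im_div_sq_nonneg {u c : ℂ} (hu : 0 ≤ u.re) (hu' : 0 ≤ u.im) (hc : 0 ≤ c.re)
    (hc' : c.im ≤ 0) (hcc : -c.im ≤ c.re) : 0 ≤ (u * (1 / c ^ 2)).im := by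
  have h : (u * (1 / c ^ 2)).im =
      (u.im * (c.re ^ 2 - c.im ^ 2) + u.re * (2 * c.re * -c.im)) / Complex.normSq (c ^ 2) := by
    rw [mul_one_div, Complex.div_im]
    simp [sq]
    ring
  rw [h]
  refine div_nonneg (add_nonneg (mul_nonneg hu' ?_) (mul_nonneg hu ?_)) (Complex.normSq_nonneg _)
  · nlinarith
  · exact mul_nonneg (by linarith) (by linarith)

theorem norm_one_sub_le {D : ℂ} (h1 : 7 / 10 ≤ D.re) (h2 : ‖D‖ ≤ 4) :
    ‖1 - 1 / 100 * D‖ ≤ 994 / 1000 := by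
  have h : ‖1 - 1 / 100 * D‖ ^ 2 = 1 - 2 / 100 * D.re + ‖D‖ ^ 2 / 10000 := by
    rw [← Complex.normSq_eq_norm_sq, ← Complex.normSq_eq_norm_sq, Complex.normSq_apply,
      Complex.normSq_apply]
    simp
    ring
  refine (abs_le_of_sq_le_sq' ?_ (by norm_num)).2
  rw [h]
  nlinarith [norm_nonneg D]

/-- The derivative D of the equation has Re D ≥ 7/10, because the tangent term contributes
nonnegatively, and |D| ≤ 4. A small step against D therefore contracts. -/
theorem norm_deriv_le {M : ℕ} (hM : 1 < M) {u e : ℂ} (hu : IsCoefficient u) (he : e ∈ box) :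
    ‖1 - 1 / 100 * (Complex.cosh e -
      u * (1 / Complex.cos (fanAngle M e) ^ 2 * (Complex.I / M)))‖ ≤ 994 / 1000 := by
  have hb := angleBounds hM he
  have hM' : (2 : ℝ) ≤ M := by exact_mod_cast hM
  have h1 := hb.cos_re_pos
  have h2 := hb.cos_im_nonpos
  have h3 := hb.cos_im_ge
  have h4 := normSq_cos ((Real.pi / 2 - e.im) / M) (e.re / M)
  have h5 := hb.cos_sq_ge
  rw [← fanAngle_eq] at h1 h2 h3 h4
  generalize Complex.cos (fanAngle M e) = c at *
  have h6 : 1 / 2 ≤ Complex.normSq c := by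
    rw [h4]
    nlinarith [sq_nonneg (Real.sinh (e.re / M))]
  refine norm_one_sub_le ?_ ?_
  · have h7 := im_div_sq_nonneg hu.re_pos.le hu.im_nonneg h1.le h2 h3
    have h8 : (u * (1 / c ^ 2 * (Complex.I / M))).re = -((u * (1 / c ^ 2)).im / (M : ℝ)) := by
      rw [← mul_assoc, mul_div_assoc', Complex.div_natCast_re, Complex.mul_I_re, neg_div]
    rw [Complex.sub_re, (cosh_re_im e).1, h8]
    have h9 := cos_im_box_ge he
    have h10 := Real.one_le_cosh e.re
    have hr : (7 : ℝ) / 5 ≤ √2 := Real.le_sqrt_of_sq_le (by norm_num)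
    have h11 : 0 ≤ (u * (1 / c ^ 2)).im / (M : ℝ) := div_nonneg h7 (by linarith)
    nlinarith
  · have h7 : ‖u‖ ≤ 2 := by
      have := hu.normSq_le
      rw [Complex.normSq_eq_norm_sq] at this
      nlinarith [norm_nonneg u]
    have h8 : ‖1 / c ^ 2 * (Complex.I / M)‖ ≤ 1 := by
      rw [Complex.normSq_eq_norm_sq] at h6
      have : ‖1 / c ^ 2 * (Complex.I / M)‖ = 1 / (‖c‖ ^ 2 * M) := by
        simp
        ring
      rw [this]
      refine div_le_one_of_le₀ ?_ (by positivity)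
      nlinarith
    calc _ ≤ ‖Complex.cosh e‖ + ‖u * (1 / c ^ 2 * (Complex.I / M))‖ := norm_sub_le _ _
      _ ≤ 2 + 2 * 1 := by
          refine add_le_add (norm_cosh_le he) ?_
          rw [norm_mul]
          exact mul_le_mul h7 h8 (norm_nonneg _) (by norm_num)
      _ = 4 := by norm_num

theorem convex_box : Convex ℝ box :=
  ((convex_Icc 0 boxWidth).linear_preimage Complex.reLm).inter
    ((convex_Icc 0 (Real.pi / 4)).linear_preimage Complex.imLm)

/-- The nearest point of the box. -/
noncomputable def clamp (e : ℂ) : ℂ :=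
  ⟨max 0 (min boxWidth e.re), max 0 (min (Real.pi / 4) e.im)⟩

theorem clamp_mem (e : ℂ) : clamp e ∈ box :=
  ⟨⟨le_max_left _ _, max_le boxWidth_nonneg (min_le_left _ _)⟩, le_max_left _ _,
    max_le (by positivity) (min_le_left _ _)⟩

theorem norm_clamp_sub_le (e e' : ℂ) : ‖clamp e - clamp e'‖ ≤ ‖e - e'‖ := by
  have key : ∀ a x y : ℝ, |max 0 (min a x) - max 0 (min a y)| ≤ |x - y| := fun a x y => by
    refine (abs_max_sub_max_le_max _ _ _ _).trans ?_
    rw [sub_self, abs_zero, max_eq_right (abs_nonneg _)]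
    refine (abs_min_sub_min_le_max _ _ _ _).trans ?_
    rw [sub_self, abs_zero, max_eq_right (abs_nonneg _)]
  rw [Complex.norm_def, Complex.norm_def]
  refine Real.sqrt_le_sqrt ?_
  rw [Complex.normSq_apply, Complex.normSq_apply]
  exact add_le_add (by simpa [clamp, ← sq] using sq_le_sq.2 (key boxWidth e.re e'.re))
    (by simpa [clamp, ← sq] using sq_le_sq.2 (key (Real.pi / 4) e.im e'.im))

/-- The coefficient that a fan contributes to the equation of the other one. -/
noncomputable def coefficient (N : ℕ) (e : ℂ) : ℂ := conj (Complex.cos (fanAngle N e))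

theorem isCoefficient_coefficient {N : ℕ} (hN : 1 < N) {e : ℂ} (he : e ∈ box) :
    IsCoefficient (coefficient N e) := by
  rw [coefficient, fanAngle_eq]
  exact (angleBounds hN he).isCoefficient

/-- The derivative is a sine of modulus at most 1 divided by `N ≥ 2`. -/
theorem norm_coefficient_sub_le {N : ℕ} (hN : 1 < N) {e e' : ℂ} (he : e ∈ box) (he' : e' ∈ box) :
    ‖coefficient N e - coefficient N e'‖ ≤ 1 / 2 * ‖e - e'‖ := by
  have hN' : (2 : ℝ) ≤ N := by exact_mod_cast hN
  rw [coefficient, coefficient, ← map_sub, Complex.norm_conj]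
  refine convex_box.norm_image_sub_le_of_norm_hasDerivWithin_le
    (f := fun e => Complex.cos (fanAngle N e))
    (fun x _ => ((Complex.hasDerivAt_cos _).comp x (hasDerivAt_fanAngle N x)).hasDerivWithinAt)
    (fun x hx => ?_) he' he
  have hb := angleBounds hN hx
  have h1 : ‖Complex.sin (fanAngle N x)‖ ≤ 1 := by
    have h2 := normSq_sin ((Real.pi / 2 - x.im) / N) (x.re / N)
    rw [← fanAngle_eq, Complex.normSq_eq_norm_sq] at h2
    refine (abs_le_of_sq_le_sq' ?_ zero_le_one).2
    rw [h2]
    linarith [hb.sin_sq_le, hb.sinh_sq]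
  rw [norm_mul, norm_neg, norm_div, Complex.norm_I, Complex.norm_natCast]
  exact (mul_le_of_le_one_left (by positivity) h1).trans
    (one_div_le_one_div_of_le two_pos hN')

/-- One step of the iteration that solves the equation of a fan. -/
noncomputable def fanStep (M : ℕ) (u e : ℂ) : ℂ := e - 1 / 100 * fanEq M u e

theorem norm_fanStep_sub_le {M : ℕ} (hM : 1 < M) {u : ℂ} (hu : IsCoefficient u) {e e' : ℂ}
    (he : e ∈ box) (he' : e' ∈ box) :
    ‖fanStep M u e - fanStep M u e'‖ ≤ 994 / 1000 * ‖e - e'‖ :=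
  convex_box.norm_image_sub_le_of_norm_hasDerivWithin_le
    (fun x hx => ((hasDerivAt_id x).sub
      ((hasDerivAt_fanEq hM u hx).const_mul (1 / 100))).hasDerivWithinAt)
    (fun _ hx => norm_deriv_le hM hu hx) he' he

theorem norm_fanStep_sub_le_coefficient {M : ℕ} (hM : 1 < M) (u u' : ℂ) {e : ℂ} (he : e ∈ box) :
    ‖fanStep M u e - fanStep M u' e‖ ≤ 1 / 100 * ‖u - u'‖ := by
  have h1 : ‖Complex.tan (fanAngle M e)‖ ≤ 1 := by
    have := (angleBounds hM he).normSq_tan_le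
    rw [← fanAngle_eq, Complex.normSq_eq_norm_sq] at this
    exact (abs_le_of_sq_le_sq' (by linarith) zero_le_one).2
  have h2 : fanStep M u e - fanStep M u' e =
      1 / 100 * ((u - u') * Complex.tan (fanAngle M e)) := by
    rw [fanStep, fanStep, fanEq, fanEq]
    ring
  rw [h2, norm_mul, norm_mul]
  have h3 : ‖(1 / 100 : ℂ)‖ = 1 / 100 := by norm_num
  rw [h3]
  exact mul_le_mul_of_nonneg_left (mul_le_of_le_one_right (norm_nonneg _) h1) (by norm_num)

/-- One step of the iteration that solves both equations. -/
noncomputable def twoFanStep (M N : ℕ) (y : ℂ × ℂ) : ℂ × ℂ :=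
  (fanStep M (coefficient N (clamp y.2)) (clamp y.1),
    fanStep N (coefficient M (clamp y.1)) (clamp y.2))

theorem norm_fanStep_clamp_le {M N : ℕ} (hM : 1 < M) (hN : 1 < N) (y y' : ℂ × ℂ) :
    ‖fanStep M (coefficient N (clamp y.2)) (clamp y.1) -
      fanStep M (coefficient N (clamp y'.2)) (clamp y'.1)‖ ≤ 999 / 1000 * ‖y - y'‖ := by
  have h1 := norm_fanStep_sub_le hM (isCoefficient_coefficient hN (clamp_mem y.2))
    (clamp_mem y.1) (clamp_mem y'.1)
  have h2 := norm_fanStep_sub_le_coefficient hM (coefficient N (clamp y.2))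
    (coefficient N (clamp y'.2)) (clamp_mem y'.1)
  have h3 := norm_coefficient_sub_le hN (clamp_mem y.2) (clamp_mem y'.2)
  have h4 := norm_clamp_sub_le y.1 y'.1
  have h5 := norm_clamp_sub_le y.2 y'.2
  have h6 : ‖y.1 - y'.1‖ ≤ ‖y - y'‖ := norm_fst_le (y - y')
  have h7 : ‖y.2 - y'.2‖ ≤ ‖y - y'‖ := norm_snd_le (y - y')
  have h8 := norm_sub_le_norm_sub_add_norm_sub
    (fanStep M (coefficient N (clamp y.2)) (clamp y.1))
    (fanStep M (coefficient N (clamp y.2)) (clamp y'.1))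
    (fanStep M (coefficient N (clamp y'.2)) (clamp y'.1))
  -- The constants add up to 994/1000 + (1/100)(1/2) = 999/1000.
  linarith

theorem contractingWith_twoFanStep {M N : ℕ} (hM : 1 < M) (hN : 1 < N) :
    ContractingWith (999 / 1000) (twoFanStep M N) := by
  refine ⟨by rw [div_lt_one (by norm_num)]; norm_num, LipschitzWith.of_dist_le_mul fun y y' => ?_⟩
  rw [dist_eq_norm, dist_eq_norm, Prod.norm_def]
  -- The second component is the first one with the two fans exchanged.
  have h := norm_fanStep_clamp_le hN hM y.swap y'.swap
  have h' : ‖y.swap - y'.swap‖ = ‖y - y'‖ := by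
    rw [Prod.norm_def, Prod.norm_def]
    exact max_comm _ _
  rw [h'] at h
  push_cast
  exact max_le (norm_fanStep_clamp_le hM hN y y') h

/-- At a fixed point, `clamp y - y` is 1/100 of the equation's value. If clamping changed a
coordinate, this difference would have the sign that the boundary estimates forbid on that side; the
strict ones also keep the solution off the left and bottom sides. -/
theorem fanEq_eq_zero_of_clamp {M : ℕ} (hM : 1 < M) {u : ℂ} (hu : IsCoefficient u) {y : ℂ}
    (hy : fanStep M u (clamp y) = y) :
    fanEq M u (clamp y) = 0 ∧ 0 < (clamp y).re ∧ 0 < (clamp y).im := by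
  have hm := clamp_mem y
  have hre : y.re = (clamp y).re - 1 / 100 * (fanEq M u (clamp y)).re := by
    conv_lhs => rw [← hy, fanStep]
    simp
  have him : y.im = (clamp y).im - 1 / 100 * (fanEq M u (clamp y)).im := by
    conv_lhs => rw [← hy, fanStep]
    simp
  have cre : (clamp y).re = max 0 (min boxWidth y.re) := rfl
  have cim : (clamp y).im = max 0 (min (Real.pi / 4) y.im) := rfl
  have hpi : 0 < Real.pi / 4 := by positivity
  have hp : 0 < (clamp y).re := by
    refine lt_of_le_of_ne hm.1.1 fun h => ?_
    have h1 := fanEq_re_neg hM hu hm h.symm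
    have h2 : 0 < y.re := by rw [hre, ← h]; linarith
    have h3 : 0 < boxWidth := Real.arsinh_pos_iff.2 (by positivity)
    have : 0 < (clamp y).re := cre ▸ lt_max_of_lt_right (lt_min h3 h2)
    exact this.ne h
  have hq : 0 < (clamp y).im := by
    refine lt_of_le_of_ne hm.2.1 fun h => ?_
    have h1 := fanEq_im_neg hM hu hm h.symm hp
    have h2 : 0 < y.im := by rw [him, ← h]; linarith
    have : 0 < (clamp y).im := cim ▸ lt_max_of_lt_right (lt_min hpi h2)
    exact this.ne h
  refine ⟨Complex.ext ?_ ?_, hp, hq⟩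
  · rw [Complex.zero_re]
    rcases hm.1.2.lt_or_eq with h | h
    · have : (clamp y).re = y.re := by
        rw [cre] at hp h ⊢
        rcases max_cases 0 (min boxWidth y.re) with h1 | h1 <;>
          rcases min_cases boxWidth y.re with h2 | h2 <;> linarith [h1.1, h2.1]
      linarith
    · have h1 := fanEq_re_nonneg hM hu hm h
      have : boxWidth ≤ y.re := by
        by_contra! h'
        have h3 : 0 < boxWidth := Real.arsinh_pos_iff.2 (by positivity)
        have : (clamp y).re < boxWidth := by
          rw [cre]
          exact max_lt h3 ((min_le_right _ _).trans_lt h')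
        exact this.ne h
      linarith
  · rw [Complex.zero_im]
    rcases hm.2.2.lt_or_eq with h | h
    · have : (clamp y).im = y.im := by
        rw [cim] at hq h ⊢
        rcases max_cases 0 (min (Real.pi / 4) y.im) with h1 | h1 <;>
          rcases min_cases (Real.pi / 4) y.im with h2 | h2 <;> linarith [h1.1, h2.1]
      linarith
    · have h1 := fanEq_im_nonneg hM hu hm h
      have : Real.pi / 4 ≤ y.im := by
        by_contra! h'
        have : (clamp y).im < Real.pi / 4 := by
          rw [cim]
          exact max_lt hpi ((min_le_right _ _).trans_lt h')
        exact this.ne h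
      linarith

/-- The equations of two fans have a common solution. -/
theorem exists_fanEq_eq_zero {M N : ℕ} (hM : 1 < M) (hN : 1 < N) :
    ∃ e ∈ box, ∃ e' ∈ box, (0 < e.re ∧ 0 < e.im) ∧ (0 < e'.re ∧ 0 < e'.im) ∧
      fanEq M (coefficient N e') e = 0 ∧ fanEq N (coefficient M e) e' = 0 := by
  have hc := contractingWith_twoFanStep hM hN
  have h := hc.fixedPoint_isFixedPt
  set y := hc.fixedPoint with hy
  have h1 := fanEq_eq_zero_of_clamp hM (isCoefficient_coefficient hN (clamp_mem y.2))
    (congrArg Prod.fst h)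
  have h2 := fanEq_eq_zero_of_clamp hN (isCoefficient_coefficient hM (clamp_mem y.1))
    (congrArg Prod.snd h)
  exact ⟨_, clamp_mem y.1, _, clamp_mem y.2, h1.2, h2.2, h1.1, h2.1⟩

/-- It suffices that cos(jα)/sin α lies in the open fourth quadrant. The imaginary part is clearly
negative. Positivity of the real part compares cot(jθ) coth(js) with tan s-type terms independent of
`j`; as this product decreases in `j`, the case `j = M` implies the others. -/
theorem AngleBounds.im_cos_div_sin_sq_neg {θ s : ℝ} (h : AngleBounds θ s) (hs : 0 < s) {M : ℕ}
    (hMθ : M * θ < Real.pi / 2) {u : ℂ} (hu : IsCoefficient u)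
    (he : Complex.I * Complex.cos (θ + s * Complex.I) * Complex.cos (M * (θ + s * Complex.I)) =
      u * Complex.sin (θ + s * Complex.I)) {j : ℕ} (hj : j ≤ M) :
    ((Complex.cos (j * (θ + s * Complex.I)) / Complex.sin (θ + s * Complex.I)) ^ 2).im < 0 := by
  have hsinh : 0 < Real.sinh s := Real.sinh_pos_iff.2 hs
  have hcosh := Real.cosh_pos s
  have hX : 0 < Real.sin θ * Real.cosh s := mul_pos h.sin_pos hcosh
  have hY : 0 < Real.cos θ * Real.sinh s := mul_pos h.cos_pos hsinh
  have hn : 0 < Complex.normSq (Complex.sin (θ + s * Complex.I)) := by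
    rw [normSq_sin]
    have := h.sin_pos
    positivity
  have hne : Complex.sin (θ + s * Complex.I) ≠ 0 := Complex.normSq_pos.1 hn
  have hre : ∀ k : ℕ, (Complex.cos (k * (θ + s * Complex.I)) /
      Complex.sin (θ + s * Complex.I)).re =
      (Real.cos (k * θ) * Real.cosh (k * s) * (Real.sin θ * Real.cosh s) -
        Real.sin (k * θ) * Real.sinh (k * s) * (Real.cos θ * Real.sinh s)) /
        Complex.normSq (Complex.sin (θ + s * Complex.I)) := by
    intro k
    have h1 := cos_re_im (k * θ) (k * s)
    have h2 : (((k * θ : ℝ) : ℂ) + (k * s : ℝ) * Complex.I) = k * (θ + s * Complex.I) := by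
      push_cast
      ring
    rw [h2] at h1
    rw [Complex.div_re, h1.1, h1.2, (sin_re_im θ s).1, (sin_re_im θ s).2]
    ring
  have him : ∀ k : ℕ, (Complex.cos (k * (θ + s * Complex.I)) /
      Complex.sin (θ + s * Complex.I)).im =
      -(Real.sin (k * θ) * Real.sinh (k * s) * (Real.sin θ * Real.cosh s) +
        Real.cos (k * θ) * Real.cosh (k * s) * (Real.cos θ * Real.sinh s)) /
        Complex.normSq (Complex.sin (θ + s * Complex.I)) := by
    intro k
    have h1 := cos_re_im (k * θ) (k * s)
    have h2 : (((k * θ : ℝ) : ℂ) + (k * s : ℝ) * Complex.I) = k * (θ + s * Complex.I) := by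
      push_cast
      ring
    rw [h2] at h1
    rw [Complex.div_im, h1.1, h1.2, (sin_re_im θ s).1, (sin_re_im θ s).2]
    ring
  have hθ := h.pos
  have hcast : (j : ℝ) ≤ M := by exact_mod_cast hj
  have hjθ : j * θ ≤ M * θ := mul_le_mul_of_nonneg_right hcast hθ.le
  have hcj : 0 < Real.cos (j * θ) :=
    Real.cos_pos_of_mem_Ioo ⟨by have := Real.pi_pos; have : 0 ≤ j * θ := by positivity
                                linarith, by linarith⟩
  have hsj : 0 ≤ Real.sin (j * θ) :=
    Real.sin_nonneg_of_nonneg_of_le_pi (by positivity) (by linarith [Real.pi_pos])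
  have hshj : 0 ≤ Real.sinh (j * s) := Real.sinh_nonneg_iff.2 (by positivity)
  have hchj := Real.cosh_pos (j * s)
  -- For `j = M` the fan equation makes the quotient equal to -i u / cos α, with u in the first
  -- quadrant and cos α in the fourth.
  have hM0 : 0 < Real.cos (M * θ) * Real.cosh (M * s) * (Real.sin θ * Real.cosh s) -
      Real.sin (M * θ) * Real.sinh (M * s) * (Real.cos θ * Real.sinh s) := by
    have h1 : Complex.cos (M * (θ + s * Complex.I)) / Complex.sin (θ + s * Complex.I) =
        -(u / Complex.cos (θ + s * Complex.I) * Complex.I) := by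
      have hc := h.cos_ne_zero
      field_simp
      linear_combination -Complex.I * he + Complex.cos (θ + s * Complex.I) *
        Complex.cos (M * (θ + s * Complex.I)) * Complex.I_sq
    have h2 : 0 < (Complex.cos (M * (θ + s * Complex.I)) / Complex.sin (θ + s * Complex.I)).re := by
      rw [h1, Complex.neg_re, Complex.mul_I_re, neg_neg, Complex.div_im, ← sub_div,
        (cos_re_im θ s).1, (cos_re_im θ s).2]
      refine div_pos ?_ (Complex.normSq_pos.2 h.cos_ne_zero)
      have h3 := mul_nonneg hu.im_nonneg (mul_pos h.cos_pos hcosh).le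
      have h4 := mul_pos hu.re_pos (mul_pos h.sin_pos hsinh)
      linarith
    rw [hre, div_pos_iff_of_pos_right hn] at h2
    exact h2
  -- Cotangent and hyperbolic cotangent decrease; their monotonicity is used in product form, and `j
  -- = 0` is separate because both are infinite there.
  have hj0 : 0 < Real.cos (j * θ) * Real.cosh (j * s) * (Real.sin θ * Real.cosh s) -
      Real.sin (j * θ) * Real.sinh (j * s) * (Real.cos θ * Real.sinh s) := by
    rcases Nat.eq_zero_or_pos j with h0 | h0
    · subst h0
      simpa using hX
    · have hj1 : (1 : ℝ) ≤ j := by exact_mod_cast h0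
      have hsjp : 0 < Real.sin (j * θ) :=
        Real.sin_pos_of_pos_of_lt_pi (by positivity) (by linarith [Real.pi_pos])
      have hshjp : 0 < Real.sinh (j * s) := Real.sinh_pos_iff.2 (by positivity)
      have hMp : (0 : ℝ) < M := by linarith
      have hsM : 0 < Real.sin (M * θ) :=
        Real.sin_pos_of_pos_of_lt_pi (by positivity) (by linarith [Real.pi_pos])
      have hshM : 0 < Real.sinh (M * s) := Real.sinh_pos_iff.2 (by positivity)
      have h1 : Real.cos (M * θ) * Real.sin (j * θ) ≤ Real.cos (j * θ) * Real.sin (M * θ) := by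
        have : 0 ≤ Real.sin (M * θ - j * θ) := Real.sin_nonneg_of_nonneg_of_le_pi (by linarith)
          (by have : 0 ≤ j * θ := by positivity
              linarith [Real.pi_pos])
        rw [Real.sin_sub] at this
        linarith
      have h2 : Real.sinh (j * s) * Real.cosh (M * s) ≤ Real.cosh (j * s) * Real.sinh (M * s) := by
        have : 0 ≤ Real.sinh (M * s - j * s) :=
          Real.sinh_nonneg_iff.2 (by
            have := mul_le_mul_of_nonneg_right hcast hs.le
            linarith)
        rw [Real.sinh_sub] at this
        linarith
      have h3 := mul_le_mul h1 h2 (mul_nonneg hshj (Real.cosh_pos _).le)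
        (mul_nonneg hcj.le hsM.le)
      have h4 := mul_le_mul_of_nonneg_right h3 hX.le
      have h5 := mul_pos (mul_pos hsjp hshjp) hM0
      refine pos_of_mul_pos_left ?_ (mul_pos hsM hshM).le
      nlinarith
  rw [sq, Complex.mul_im, hre, him]
  have h1 := div_pos hj0 hn
  have h2 : 0 < (Real.sin (j * θ) * Real.sinh (j * s) * (Real.sin θ * Real.cosh s) +
        Real.cos (j * θ) * Real.cosh (j * s) * (Real.cos θ * Real.sinh s)) /
        Complex.normSq (Complex.sin (θ + s * Complex.I)) := by
    refine div_pos ?_ hn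
    have := mul_nonneg (mul_nonneg hsj hshj) hX.le
    have := mul_pos (mul_pos hcj hchj) hY
    linarith
  rw [neg_div]
  nlinarith [mul_pos h1 h2]

theorem fanAngle_mul {M : ℕ} (hM : 1 < M) (e : ℂ) :
    M * fanAngle M e = Real.pi / 2 + e * Complex.I := by
  have : (M : ℂ) ≠ 0 := by
    have : M ≠ 0 := by omega
    exact_mod_cast this
  rw [fanAngle]
  field_simp

theorem cos_fanAngle_mul {M : ℕ} (hM : 1 < M) (e : ℂ) :
    Complex.cos (M * fanAngle M e) = -(Complex.sinh e * Complex.I) := by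
  rw [fanAngle_mul hM, add_comm, Complex.cos_add_pi_div_two, Complex.sin_mul_I]

theorem sin_fanAngle_mul {M : ℕ} (hM : 1 < M) (e : ℂ) :
    Complex.sin (M * fanAngle M e) = Complex.cosh e := by
  rw [fanAngle_mul hM, add_comm, Complex.sin_add_pi_div_two, Complex.cos_mul_I]

/-- The equation of a fan in terms of its angle. -/
theorem cos_mul_sinh_eq {M : ℕ} (hM : 1 < M) {u e : ℂ} (he : e ∈ box) (h : fanEq M u e = 0) :
    Complex.cos (fanAngle M e) * Complex.sinh e = u * Complex.sin (fanAngle M e) := by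
  have hc := (angleBounds hM he).cos_ne_zero
  rw [← fanAngle_eq] at hc
  rw [fanEq, sub_eq_zero, Complex.tan_eq_sin_div_cos] at h
  rw [h]
  field_simp

theorem cos_fanAngle_mul_eq {M : ℕ} (hM : 1 < M) {u e : ℂ} (he : e ∈ box) (h : fanEq M u e = 0) :
    Complex.I * Complex.cos (fanAngle M e) * Complex.cos (M * fanAngle M e) =
      u * Complex.sin (fanAngle M e) := by
  rw [cos_fanAngle_mul hM, ← cos_mul_sinh_eq hM he h]
  linear_combination -(Complex.cos (fanAngle M e) * Complex.sinh e) * Complex.I_sq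

theorem im_cos_div_sin_sq_neg {M : ℕ} (hM : 1 < M) {u e : ℂ} (hu : IsCoefficient u) (he : e ∈ box)
    (h0 : 0 < e.re) (h1 : 0 < e.im) (h : fanEq M u e = 0) {j : ℕ} (hj : j ≤ M) :
    ((Complex.cos (j * fanAngle M e) / Complex.sin (fanAngle M e)) ^ 2).im < 0 := by
  have hM' : (0 : ℝ) < M := by positivity
  have he' := cos_fanAngle_mul_eq hM he h
  rw [fanAngle_eq] at he' ⊢
  refine (angleBounds hM he).im_cos_div_sin_sq_neg (div_pos h0 hM') ?_ hu he' hj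
  rw [mul_div_cancel₀ _ hM'.ne']
  linarith

theorem re_cos_mul_cosh_pos {M : ℕ} (hM : 1 < M) {e : ℂ} (he : e ∈ box) :
    0 < (Complex.cos (fanAngle M e) * Complex.cosh e).re := by
  have hb := angleBounds hM he
  have h1 := hb.cos_re_pos
  have h2 := hb.cos_im_nonpos
  rw [← fanAngle_eq] at h1 h2
  rw [Complex.mul_re, (cosh_re_im e).1, (cosh_re_im e).2]
  have h3 : 0 < Real.cos e.im := lt_of_lt_of_le (by positivity) (cos_im_box_ge he)
  have h4 : 0 ≤ Real.sin e.im :=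
    Real.sin_nonneg_of_nonneg_of_le_pi he.2.1 (by linarith [he.2.2, Real.pi_pos])
  have h5 := mul_pos h1 (mul_pos (Real.cosh_pos e.re) h3)
  have h6 := mul_nonneg (neg_nonneg.2 h2) (mul_nonneg (Real.sinh_nonneg_iff.2 he.1.1) h4)
  linarith

theorem eq_of_sq_eq_of_re_pos {a b : ℂ} (h : a ^ 2 = b ^ 2) (ha : 0 < a.re) (hb : 0 < b.re) :
    a = b := by
  rcases sq_eq_sq_iff_eq_or_eq_neg.1 h with h | h
  · exact h
  · rw [h, Complex.neg_re] at ha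
    linarith

/-- The second angle is conjugated because the fans need squares in opposite half-planes, while the
equations for `e` and `e'` are of the same form. -/
theorem exists_fanAngles {M N : ℕ} (hM : 1 < M) (hN : 1 < N) : Nonempty (FanAngles M N) := by
  obtain ⟨e, he, e', he', ⟨hp, hq⟩, ⟨hp', hq'⟩, h, h'⟩ := exists_fanEq_eq_zero hM hN
  have hu := isCoefficient_coefficient hN he'
  have hu' := isCoefficient_coefficient hM he
  have hconj : conj (N * fanAngle N e') = (N : ℂ) * conj (fanAngle N e') := by
    rw [map_mul, Complex.conj_natCast]
  have k1 := cos_mul_sinh_eq hM he h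
  have k2 := congrArg conj (cos_mul_sinh_eq hN he' h')
  simp only [coefficient, map_mul, ← Complex.cos_conj, ← Complex.sin_conj, ← Complex.sinh_conj,
    Complex.conj_conj] at k1 k2
  refine ⟨⟨fanAngle M e, conj (fanAngle N e'), ?_, ?_, ?_, ?_, ?_, ?_⟩⟩
  · have := cos_fanAngle_mul_eq hM he h
    rw [coefficient, ← Complex.cos_conj] at this
    exact this
  · have := congrArg conj (cos_fanAngle_mul_eq hN he' h')
    rw [coefficient, map_mul, map_mul, map_mul, Complex.conj_conj, ← Complex.cos_conj,
      ← Complex.cos_conj, ← Complex.sin_conj, hconj, Complex.conj_I] at this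
    linear_combination this
  · rw [← hconj, Complex.sin_conj, sin_fanAngle_mul hM, sin_fanAngle_mul hN]
    -- The fan equations give only the equality of the squares; positive real parts settle the sign.
    refine eq_of_sq_eq_of_re_pos ?_ (re_cos_mul_cosh_pos hM he) ?_
    · have e1 := Complex.cosh_sq e
      have e2 := Complex.cosh_sq (conj e')
      have e3 := Complex.sin_sq_add_cos_sq (fanAngle M e)
      have e4 := Complex.sin_sq_add_cos_sq (conj (fanAngle N e'))
      rw [← Complex.cosh_conj, mul_pow, mul_pow, e1, e2]
      linear_combination (Complex.cos (fanAngle M e) * Complex.sinh e +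
        Complex.cos (conj (fanAngle N e')) * Complex.sin (fanAngle M e)) * k1 -
        (Complex.cos (conj (fanAngle N e')) * Complex.sinh (conj e') +
        Complex.cos (fanAngle M e) * Complex.sin (conj (fanAngle N e'))) * k2 +
        Complex.cos (conj (fanAngle N e')) ^ 2 * e3 - Complex.cos (fanAngle M e) ^ 2 * e4
    · have := re_cos_mul_cosh_pos hN he'
      rw [Complex.cos_conj, ← map_mul, Complex.conj_re]
      exact this
  · exact fun j hj => im_cos_div_sin_sq_neg hM hu he hp hq h hj
  · intro j hj
    have := im_cos_div_sin_sq_neg hN hu' he' hp' hq' h' hj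
    have hc : (Complex.cos (j * conj (fanAngle N e')) / Complex.sin (conj (fanAngle N e'))) ^ 2 =
        conj ((Complex.cos (j * fanAngle N e') / Complex.sin (fanAngle N e')) ^ 2) := by
      rw [map_pow, map_div₀, ← Complex.cos_conj, ← Complex.sin_conj, map_mul, Complex.conj_natCast]
    rw [hc, Complex.conj_im]
    linarith
  -- |cos α|² = cos² θ + sinh² s with cos² θ ≥ 1/2, and the inequality is strict because s > 0.
  · have hb := angleBounds hM he
    rw [norm_pow, ← Complex.normSq_eq_norm_sq, fanAngle_eq, normSq_cos]
    have := hb.cos_sq_ge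
    have h1 : 0 < Real.sinh (e.re / M) := Real.sinh_pos_iff.2 (div_pos hp (by positivity))
    have := pow_pos h1 2
    linarith

end

/-! ### Assembling the triangulations, moves and solutions. -/

theorem TwoThreeMove.rename_keep {G T T' : IdealTriangulation} (m : TwoThreeMove G T')
    (e : G.LabelledIso T) (t : {t : G.Tet // t ≠ m.a ∧ t ≠ m.b})
    (h : e.equiv t.1 ≠ (m.rename e).a ∧ e.equiv t.1 ≠ (m.rename e).b) :
    ((m.rename e).keep ⟨e.equiv t.1, h⟩).1 = (m.keep t).1 :=
  congrArg (fun t => (m.keep t).1) (Subtype.ext (e.equiv.symm_apply_apply t.1))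

namespace FanAngles

variable {M N : ℕ} (Θ : FanAngles M N)

theorem first_isSolution (hM : 1 < M) (hN : 1 < N) :
    ((middleSite M N hM hN).graft firstPatch).IsSolution
      (Θ.graftShape hM hN firstPatch (firstShape Θ.v)) := by
  have hv := Θ.v_im_pos
  refine Θ.graft_isSolution hM hN firstTable (fun c => ?_) (fun c f c' h hc => ?_)
    (isShape_first hv Θ.pivot_sq Θ.rung_sq)
    (middleEdgeLabelling hM hN firstTable (κ := Fin (2 * M + 2 * N) ⊕ Unit)
      -- The names 1, 3, 5 belong to the upper edges of the middle layers, which still occur after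
      -- the move; only one of the two spare names is needed yet, so both are merged.
      (Sum.map id fun _ => ()) ![1, 3, 5] (fun c => ?_) (by decide) (fun e => ?_) (by simp))
  · by_cases h : c = 1
    · exact ((firstShape_im hv c).1 h).ge
    · exact ((firstShape_im hv c).2 h).le
  -- The only flat tetrahedron is not glued to itself.
  · refine (firstShape_im hv c').2 ?_
    have h1 : c = 1 := by
      by_contra h'
      exact ((firstShape_im hv c).2 h').ne' hc
    subst h1
    rintro rfl
    revert h f
    decide
  · refine congrArg (Sum.map id fun _ => ()) ?_
    fin_cases c <;> refine congrArg Sum.inl (Fin.ext ?_) <;> simp [middleLayer] <;> omega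
  · rcases e with k | u
    · exact .inl ⟨k, rfl⟩
    · exact .inr ⟨0, 0, 3, by decide, rfl⟩

theorem second_isSolution (hM : 1 < M) (hN : 1 < N) :
    ((middleSite M N hM hN).graft secondPatch).IsSolution
      (Θ.graftShape hM hN secondPatch (secondShape Θ.v)) := by
  have hv := Θ.v_im_pos
  have hw : 1 / 2 < ‖1 - Θ.v‖ := Θ.one_sub_v ▸ Θ.norm_cos
  refine Θ.graft_isSolution hM hN secondTable (fun c => ?_) (fun c f c' h hc => ?_)
    (isShape_second hv Θ.pivot_sq Θ.rung_sq)
    (middleEdgeLabelling hM hN secondTable id ![1, 3, 5] (fun c => ?_) (by decide) (fun e => ?_)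
      (by simp))
  · by_cases h : c = 3
    · exact ((secondShape_im hv hw c).1 h).ge
    · exact ((secondShape_im hv hw c).2 h).le
  · refine (secondShape_im hv hw c').2 ?_
    have h1 : c = 3 := by
      by_contra h'
      exact ((secondShape_im hv hw c).2 h').ne' hc
    subst h1
    rintro rfl
    revert h f
    decide
  · fin_cases c <;> refine congrArg Sum.inl (Fin.ext ?_) <;> simp [middleLayer] <;> omega
  · rcases e with k | e
    · exact .inl ⟨k, rfl⟩
    · fin_cases e
      · exact .inr ⟨1, 0, 3, by decide, rfl⟩
      · exact .inr ⟨0, 0, 3, by decide, rfl⟩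

/-- The identification of names after the last move, which removes the edge in the middle of the
fan; its name is used for the first one of the new edges. -/
def lastName {M : ℕ} (N : ℕ) (hM : 1 < M) :
    Fin (2 * M + 2 * N) ⊕ Fin 2 → Fin (2 * M + 2 * N) ⊕ Unit :=
  Sum.elim .inl ![.inl (middleLayer N hM 0), .inr ()]

theorem third_isGeometricSolution (hM : 1 < M) (hN : 1 < N) :
    ((middleSite M N hM hN).graft thirdPatch).IsGeometricSolution
      (Θ.graftShape hM hN thirdPatch (thirdShape Θ.v)) := by
  have hv := Θ.v_im_pos
  have hw : 1 / 2 < ‖1 - Θ.v‖ := Θ.one_sub_v ▸ Θ.norm_cos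
  refine ⟨Θ.graft_isSolution hM hN thirdTable (fun c => (thirdShape_im_pos hv hw c).le)
    (fun c f c' h hc => thirdShape_im_pos hv hw c') (isShape_third hv Θ.pivot_sq Θ.rung_sq)
    -- The name 6 takes the place of 1, whose edge has disappeared.
    (middleEdgeLabelling hM hN thirdTable (lastName N hM) ![6, 3, 5] (fun c => ?_) (by decide)
      (fun e => ?_) (by simp)), ?_⟩
  · fin_cases c
    · rfl
    · refine congrArg Sum.inl (Fin.ext ?_)
      simp [middleLayer]
      omega
    · refine congrArg Sum.inl (Fin.ext ?_)
      simp [middleLayer]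
      omega
  · rcases e with k | u
    · exact .inl ⟨k, rfl⟩
    · exact .inr ⟨0, 0, 3, by decide, rfl⟩
  · rintro (t | c)
    · exact Θ.shape_im_pos hM hN t.1
    · exact thirdShape_im_pos hv hw c

theorem flat_iff {m : ℕ} (hM : 1 < M) (hN : 1 < N) (P : Patch m) {z : Fin m → ℂ} {c₀ : Fin m}
    (hz : ∀ c, (c = c₀ → (z c).im = 0) ∧ (c ≠ c₀ → 0 < (z c).im))
    (t : ((middleSite M N hM hN).graft P).Tet) :
    (Θ.graftShape hM hN P z t).im = 0 ↔ t = .inr c₀ := by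
  rcases t with t | c
  · exact ⟨fun h => absurd h (Θ.shape_im_pos hM hN t.1).ne', fun h => absurd h Sum.inl_ne_inr⟩
  · refine ⟨fun h => ?_, fun h => (hz c).1 (Sum.inr_injective h)⟩
    by_contra hc
    exact ((hz c).2 fun h' => hc (congrArg _ h')).ne' h

end FanAngles

/-- The tetrahedra of `T` are `t₁, t₂, …` in the order of the layering, starting with the toggle
before the fan of `L ^ (2 * M)`; so `tₖ` is the element `k - 1` of `Fin (2 * M + 2 * N)`. -/
theorem lemma4p1 (M N : ℕ) (hM : 1 < M) (hN : 1 < N) :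
    let T := monodromyTriangulation (wordLR (2 * M) (2 * N))
    let tM : T.Tet := (⟨M - 1, by omega⟩ : Fin (2 * M + 2 * N))
    let tM1 : T.Tet := (⟨M, by omega⟩ : Fin (2 * M + 2 * N))
    let tM2 : T.Tet := (⟨M + 1, by omega⟩ : Fin (2 * M + 2 * N))
    ∃ (T₁ T₂ T' : IdealTriangulation)
      (m₁ : TwoThreeMove T T₁) (m₂ : TwoThreeMove T₁ T₂) (m₃ : ThreeTwoMove T₂ T')
      (z : T.Tet → ℂ) (z₁ : T₁.Tet → ℂ) (z₂ : T₂.Tet → ℂ) (z' : T'.Tet → ℂ),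
      -- the first move replaces `t_M` and `t_{M+1}`
      (m₁.a = tM ∧ m₁.b = tM1) ∧
      -- the second one replaces a tetrahedron created by the first one and `t_{M+2}`
      ((∃ i, m₂.a = m₁.c i) ∧ ∃ h, m₂.b = (m₁.keep ⟨tM2, h⟩).1) ∧
      -- the third one replaces three tetrahedra created by the first two
      (∀ i, (∃ j, m₃.c i = m₂.c j) ∨ ∃ j h, m₃.c i = (m₂.keep ⟨m₁.c j, h⟩).1) ∧
      -- shapes of the complete structure, followed through the moves
      T.IsGeometricSolution z ∧
      (m₁.Tracks z z₁ ∧ T₁.IsSolution z₁) ∧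
      (m₂.Tracks z₁ z₂ ∧ T₂.IsSolution z₂) ∧
      m₃.Tracks z' z₂ ∧
      -- the first move creates a flat tetrahedron, the only one in `T₁`; it is kept by the second
      -- move, is the only one in `T₂`, and is removed by the third move
      (∃ i h j, (∀ t, (z₁ t).im = 0 ↔ t = m₁.c i) ∧
        (∀ t, (z₂ t).im = 0 ↔ t = (m₂.keep ⟨m₁.c i, h⟩).1) ∧
        m₃.c j = (m₂.keep ⟨m₁.c i, h⟩).1) ∧
      -- the result is geometric, has one tetrahedron more than `T`, and is not isomorphic to `T`
      T'.IsGeometricSolution z' ∧ T'.IsGeometric ∧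
      Fintype.card T'.Tet = (2 * M + 2 * N) + 1 ∧
      ¬ T.Isomorphic T' := by
  obtain ⟨Θ⟩ := exists_fanAngles hM hN
  intro T tM tM1 tM2
  set X := middleSite M N hM hN with hX
  have hv := Θ.v_im_pos
  have hw : 1 / 2 < ‖1 - Θ.v‖ := Θ.one_sub_v ▸ Θ.norm_cos
  have ht2 : (middleIso M N hM hN).equiv (.inr 2) = tM2 := by
    refine Fin.ext ?_
    change M - 1 + 2 = M + 1
    omega
  have hne : ∀ {m m' : ℕ} {P : Patch m} {P' : Patch m'} (μ : PatchMove P P') (c : Fin m),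
      c ≠ μ.a → c ≠ μ.b → (Sum.inr c : (X.graft P).Tet) ≠ (μ.toMove X).a ∧
        (Sum.inr c : (X.graft P).Tet) ≠ (μ.toMove X).b := fun μ c h1 h2 =>
    ⟨fun h => h1 (Sum.inr_injective h), fun h => h2 (Sum.inr_injective h)⟩
  have hcard : Fintype.card (X.graft thirdPatch).Tet = (2 * M + 2 * N) + 1 := by
    have : Fintype.card (X.graft thirdPatch).Tet + 3 = 2 * M + 2 * N + 4 :=
      card_graft hM hN thirdPatch
    omega
  refine ⟨X.graft firstPatch, X.graft secondPatch, X.graft thirdPatch,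
    (firstMove.toMove X).rename (middleIso M N hM hN), secondMove.toMove X, thirdMove.toMove X,
    Θ.shape, Θ.graftShape hM hN _ (firstShape Θ.v), Θ.graftShape hM hN _ (secondShape Θ.v),
    Θ.graftShape hM hN _ (thirdShape Θ.v), ⟨rfl, ?_⟩, ⟨⟨0, rfl⟩, ?_⟩, ?_,
    Θ.isGeometricSolution hM hN, ⟨?_, Θ.first_isSolution hM hN⟩, ⟨?_, Θ.second_isSolution hM hN⟩,
    -- The flat tetrahedron has index 1 among those of the first move and index 0 among those
    -- removed at the end.
    ?_, ⟨1, hne secondMove 1 (by decide) (by decide), 0, ?_, ?_, rfl⟩,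
    Θ.third_isGeometricSolution hM hN, ⟨_, Θ.third_isGeometricSolution hM hN⟩, hcard, ?_⟩
  · refine Fin.ext ?_
    change M - 1 + 1 = M
    omega
  · rw [← ht2]
    refine ⟨⟨fun h => ?_, fun h => ?_⟩, ?_⟩
    · exact absurd (Sum.inr_injective ((middleIso M N hM hN).equiv.injective h)) (by decide)
    · exact absurd (Sum.inr_injective ((middleIso M N hM hN).equiv.injective h)) (by decide)
    · exact (TwoThreeMove.rename_keep (firstMove.toMove X) (middleIso M N hM hN)
        ⟨.inr 2, hne firstMove 2 (by decide) (by decide)⟩ _).symm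
  · intro i
    fin_cases i
    · exact .inr ⟨1, hne secondMove 1 (by decide) (by decide), rfl⟩
    · exact .inl ⟨2, rfl⟩
    · exact .inr ⟨2, hne secondMove 2 (by decide) (by decide), rfl⟩
  · refine TwoThreeMove.tracks_rename _ _ (firstMove.tracks_toMove X (fun t => rfl)
      (fun c => Θ.shape_middleLayer hM hN c) (fun c => rfl) (firstMove_tracks hv).1
      (firstMove_tracks hv).2)
  · exact secondMove.tracks_toMove X (fun t => rfl) (fun c => rfl) (fun c => rfl)
      (secondMove_tracks hv).1 (secondMove_tracks hv).2
  · exact thirdMove.tracks_toMove X (fun t => rfl) (fun c => rfl) (fun c => rfl)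
      (thirdMove_tracks hv).1 (thirdMove_tracks hv).2
  · exact Θ.flat_iff hM hN firstPatch (firstShape_im hv)
  · exact Θ.flat_iff hM hN secondPatch (secondShape_im hv hw)
  -- The numbers of tetrahedra differ.
  · rintro ⟨e, -⟩
    have h := Fintype.card_congr e
    have hT : Fintype.card T.Tet = 2 * M + 2 * N := Fintype.card_fin _
    omega
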